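/- **Setting.** An algebraic quantum group (AQG) $(A,\Delta)$ is a multiplier Hopf $*$-algebra with a non-zero positive left invariant functional: $A$ is a non-degenerate complex $*$-algebra (not necessarily unital), $\Delta:A\to M(A\otimes A)$ is a coassociative $*$-homomorphism such that $a\otimes b\mapsto\Delta(a)(1\otimes b)$ and $a\otimes b\mapsto(a\otimes 1)\Delta(b)$ are bijections of $A\otimes A$ onto $A\otimes A\subset M(A\otimes A)$, and $\varphi:A\to\mathbb C$ is a fixed non-zero linear functional with $\varphi(a^*a)\ge 0$ and $(\iota\otimes\varphi)\Delta(a)=\varphi(a)1$. Such a $\varphi$ is automatically faithful, and there is a unique counit $\varepsilon$, which is a $*$-homomorphism. $(A,\Delta)$ is *discrete* if there is $h\neq 0$ in $A$ with $ah=\varepsilon(a)h$ for all $a\in A$. $\mathrm{Rep}(A,\Delta)$ is the tensor category whose objects are the $*$-representations $\theta$ of $A$ on complex pre-Hilbert spaces $K$ with $\theta(A)K=K$ and whose arrows are all intertwining linear maps; $\theta\times\theta'=(\theta\otimes\theta')\circ\Delta$ (with $\theta\otimes\theta'$ extended to $M(A\otimes A)$) acts on the pre-Hilbert space $K\otimes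 K'$, and the unit object is $\varepsilon$ on $\mathbb C$. For $\theta$ on $K$ let $I_\theta(a)=\varepsilon(a)\,\mathrm{id}_K$; this is a functor in $\theta$, the identity on underlying linear maps. The left regular representation $\pi_l(a)x=ax$ acts on $A$ with inner product $(x,y)=\varphi(y^*x)$. Let $\mathcal F(a)=\varphi(\,\cdot\,a)$, a bijection of $A$ onto $\hat A=\{\varphi(\,\cdot\,a):a\in A\}$, let $\hat m(\omega\otimes\omega')=(\omega\otimes\omega')\Delta$ be the product of $\hat A$, and let $\tilde m=\mathcal F^{-1}\hat m(\mathcal F\otimes\mathcal F):A\otimes A\to A$. An arrow is *unitary* if it is an isomorphism preserving inner products. $\mathrm{Rep}_*(A,\Delta)$ is the full subcategory of representations that are direct sums of finite dimensional irreducible $*$-representations, each equivalence class occurring with finite multiplicity. **Theorem.** Let $(A,\Delta)$ be an AQG. 1. $\tilde m$ is an arrow $\pi_l\times\pi_l\to\pi_l$ of $\mathrm{Rep}(A,\Delta)$ and $(\pi_l,\tilde m)$ is a semigroup: $\tilde m(\tilde m\otimes\mathrm{id})=\tilde m(\mathrm{id}\otimes\tilde m)$. Consequently, for all $\theta$, $\pi_l\times\theta$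 is a left $\pi_l$-module by $\tilde m\otimes\mathrm{id}$ and $\theta\times\pi_l$ is a right $\pi_l$-module by $\mathrm{id}\otimes\tilde m$. 2. $\pi_l$ is absorbing: for every $\theta\in\mathrm{Rep}(A,\Delta)$ on $K$ one has $\pi_l\times\theta\cong\pi_l\times I_\theta\cong(\dim K)\,\pi_l$ and $\theta\times\pi_l\cong I_\theta\times\pi_l\cong(\dim K)\,\pi_l$, as follows. - There is a natural family of isomorphisms of left $\pi_l$-modules $V_\theta:\pi_l\times I_\theta\to\pi_l\times\theta$ which are unitary whenever $(A,\Delta)$ is discrete and $\theta$ is finite dimensional. - The formula $x\otimes\theta(a)v\mapsto\sum_i x_i\otimes\theta(a_i)v$, where $\sum_i x_i\otimes a_i=\Delta(x)(1\otimes a)$, also defines a natural family of isomorphisms of left $\pi_l$-modules $\pi_l\times I_\theta\to\pi_l\times\theta$. - The formula $U_\theta(\theta(a)v\otimes x)=\sum_i\theta(a_i)v\otimes x_i$, where $\sum_i a_i\otimes x_i=\Delta(x)(a\otimes1)$, defines a natural family of isomorphisms of right $\pi_l$-modules $U_\theta:I_\theta\times\pi_l\to\theta\times\pi_l$, which are unitary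 whenever $(A,\Delta)$ is discrete and $\theta$ is finite dimensional. 3. There is an arrow $\tilde\eta:\varepsilon\to\pi_l$ such that $(\pi_l,\tilde m,\tilde\eta)$ is a monoid if and only if $(A,\Delta)$ is discrete. 4. If $(A,\Delta)$ is discrete, then $\pi_l$ belongs to $\mathrm{Rep}_*(A,\Delta)$, and $\mathrm{Rep}_*(A,\Delta)$ carries a $*$-operation (contravariant, antilinear, involutive, the identity on objects) with $(su,v)=(u,s^*v)$ for all arrows $s$. -/

import Mathlib

open scoped TensorProduct InnerProductSpace ComplexConjugate
open TensorProduct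

universe u

noncomputable section

section Multipliers

variable (B : Type u) [NonUnitalRing B] [Module ℂ B] [IsScalarTower ℂ B B] [SMulCommClass ℂ B B]

/-- The multiplier algebra `M(B)`: pairs `(ψ, ϕ)` of a left multiplier `ψ` and a right multiplier
`ϕ` with `ϕ(a) b = a ψ(b)`, the product being `(ψ₁ ∘ ψ₂, ϕ₂ ∘ ϕ₁)`. -/
def multiplierSubalgebra : Subalgebra ℂ (Module.End ℂ B × (Module.End ℂ B)ᵐᵒᵖ) where
  carrier := {p | (∀ a b, p.1 (a * b) = p.1 a * b) ∧
    (∀ a b, p.2.unop (a * b) = a * p.2.unop b) ∧ ∀ a b, p.2.unop a * b = a * p.1 b}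
  mul_mem' := by
    rintro p q ⟨h1, h2, h3⟩ ⟨k1, k2, k3⟩
    refine ⟨fun a b => ?_, fun a b => ?_, fun a b => ?_⟩
    · simp [h1, k1]
    · simp [h2, k2]
    · simp [h3, k3]
  add_mem' := by
    rintro p q ⟨h1, h2, h3⟩ ⟨k1, k2, k3⟩
    refine ⟨fun a b => ?_, fun a b => ?_, fun a b => ?_⟩
    · simp [h1, k1, add_mul]
    · simp [h2, k2, mul_add]
    · simp [h3, k3, add_mul, mul_add]
  algebraMap_mem' := by
    intro r
    refine ⟨fun a b => ?_, fun a b => ?_, fun a b => ?_⟩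
    · simp [Module.algebraMap_end_apply, smul_mul_assoc]
    · simp [MulOpposite.algebraMap_apply, Module.algebraMap_end_apply, mul_smul_comm]
    · simp [MulOpposite.algebraMap_apply, Module.algebraMap_end_apply, mul_smul_comm,
        smul_mul_assoc]

/-- The multiplier algebra as a type; a unital complex algebra. -/
abbrev Mult : Type u := multiplierSubalgebra B

variable {B}

namespace Mult

/-- Left multiplication `b ↦ x b` by a multiplier `x`. -/
def L (x : Mult B) : B →ₗ[ℂ] B := x.1.1

/-- Right multiplication `b ↦ b x` by a multiplier `x`. -/
def R (x : Mult B) : B →ₗ[ℂ] B := x.1.2.unop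

theorem L_mul (x : Mult B) (a b : B) : x.L (a * b) = x.L a * b := x.2.1 a b
theorem R_mul (x : Mult B) (a b : B) : x.R (a * b) = a * x.R b := x.2.2.1 a b
theorem central (x : Mult B) (a b : B) : x.R a * b = a * x.L b := x.2.2.2 a b

@[ext] theorem ext {x y : Mult B} (h : x.L = y.L) (h' : x.R = y.R) : x = y :=
  Subtype.ext (Prod.ext h (MulOpposite.unop_injective h'))

/-- Build a multiplier out of its two maps. -/
def mk (l r : B →ₗ[ℂ] B) (h1 : ∀ a b, l (a * b) = l a * b) (h2 : ∀ a b, r (a * b) = a * r b)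
    (h3 : ∀ a b, r a * b = a * l b) : Mult B :=
  ⟨(l, MulOpposite.op r), h1, h2, h3⟩

@[simp] theorem L_one : (1 : Mult B).L = LinearMap.id := rfl
@[simp] theorem R_one : (1 : Mult B).R = LinearMap.id := rfl
@[simp] theorem L_mul' (x y : Mult B) (b : B) : (x * y).L b = x.L (y.L b) := rfl
@[simp] theorem R_mul' (x y : Mult B) (b : B) : (x * y).R b = y.R (x.R b) := rfl
@[simp] theorem L_add (x y : Mult B) : (x + y).L = x.L + y.L := rfl
@[simp] theorem R_add (x y : Mult B) : (x + y).R = x.R + y.R := rfl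
@[simp] theorem L_smul (c : ℂ) (x : Mult B) : (c • x).L = c • x.L := rfl
@[simp] theorem R_smul (c : ℂ) (x : Mult B) : (c • x).R = c • x.R := rfl

/-- The canonical map `B → M(B)`. -/
def emb (b : B) : Mult B :=
  mk (LinearMap.mulLeft ℂ b) (LinearMap.mulRight ℂ b) (fun x y => by simp [mul_assoc])
    (fun x y => by simp [mul_assoc]) (fun x y => by simp [mul_assoc])

@[simp] theorem L_emb (b x : B) : (emb b).L x = b * x := rfl
@[simp] theorem R_emb (b x : B) : (emb b).R x = x * b := rfl

/-- The element `x ⊗ y` of `M(B ⊗ B)` for multipliers `x, y` of `B`. -/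
def tmul (x y : Mult B) : Mult (B ⊗[ℂ] B) :=
  mk (TensorProduct.map x.L y.L) (TensorProduct.map x.R y.R)
    (fun s t => by
      induction s with
      | zero => simp
      | add s s' hs hs' => simp only [add_mul, map_add, hs, hs']
      | tmul a b =>
        induction t with
        | zero => simp
        | add t t' ht ht' => simp only [mul_add, map_add, ht, ht']
        | tmul c d => simp [L_mul])
    (fun s t => by
      induction s with
      | zero => simp
      | add s s' hs hs' => simp only [add_mul, map_add, hs, hs']
      | tmul a b =>
        induction t with
        | zero => simp
        | add t t' ht ht' => simp only [mul_add, map_add, ht, ht']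
        | tmul c d => simp [R_mul])
    (fun s t => by
      induction s with
      | zero => simp
      | add s s' hs hs' => simp only [add_mul, map_add, hs, hs']
      | tmul a b =>
        induction t with
        | zero => simp
        | add t t' ht ht' => simp only [mul_add, map_add, ht, ht']
        | tmul c d => simp [central])

@[simp] theorem L_tmul (x y : Mult B) : (tmul x y).L = TensorProduct.map x.L y.L := rfl
@[simp] theorem R_tmul (x y : Mult B) : (tmul x y).R = TensorProduct.map x.R y.R := rfl

variable [StarRing B] [StarModule ℂ B]

/-- The conjugate `b ↦ (f (b*))*` of a linear map. -/
def conjMap (f : B →ₗ[ℂ] B) : B →ₗ[ℂ] B where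
  toFun b := star (f (star b))
  map_add' := by simp
  map_smul' := by simp

/-- The `*`-operation of `M(B)`: `x* b = (b* x)*` and `b x* = (x b*)*`. -/
instance : Star (Mult B) where
  star x := mk (conjMap x.R) (conjMap x.L)
    (fun a b => by simp [conjMap, R_mul]) (fun a b => by simp [conjMap, L_mul])
    (fun a b => by
      simp only [conjMap, LinearMap.coe_mk, AddHom.coe_mk]
      conv_lhs => rw [← star_star b, ← star_mul, ← central, star_mul, star_star])

@[simp] theorem L_star (x : Mult B) (b : B) : (star x).L b = star (x.R (star b)) := rfl
@[simp] theorem R_star (x : Mult B) (b : B) : (star x).R b = star (x.L (star b)) := rfl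

instance : StarRing (Mult B) where
  star_involutive x := by ext <;> simp
  star_mul x y := by ext <;> simp
  star_add x y := by ext <;> simp

instance : StarModule ℂ (Mult B) where
  star_smul c x := by ext <;> simp

end Mult

end Multipliers

/-- The tensor square of a `*`-algebra is a `*`-algebra. -/
instance tensorStarRing {A : Type u} [NonUnitalRing A] [StarRing A] [Module ℂ A]
    [IsScalarTower ℂ A A] [SMulCommClass ℂ A A] [StarModule ℂ A] : StarRing (A ⊗[ℂ] A) where
  star_add := star_add
  star_mul s t := by
    induction s with
    | zero => simp
    | add s s' hs hs' => simp only [add_mul, mul_add, star_add, hs, hs']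
    | tmul a b =>
      induction t with
      | zero => simp
      | add t t' ht ht' => simp only [add_mul, mul_add, star_add, ht, ht']
      | tmul c d => simp

/-- The slice map `ι ⊗ f`. -/
def sliceR {A : Type u} [AddCommGroup A] [Module ℂ A] (f : A →ₗ[ℂ] ℂ) : A ⊗[ℂ] A →ₗ[ℂ] A :=
  (TensorProduct.rid ℂ A).toLinearMap ∘ₗ f.lTensor A

/-- The slice map `f ⊗ ι`. -/
def sliceL {A : Type u} [AddCommGroup A] [Module ℂ A] (f : A →ₗ[ℂ] ℂ) : A ⊗[ℂ] A →ₗ[ℂ] A :=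
  (TensorProduct.lid ℂ A).toLinearMap ∘ₗ f.rTensor A

@[simp] theorem sliceR_tmul {A : Type u} [AddCommGroup A] [Module ℂ A] (f : A →ₗ[ℂ] ℂ) (a b : A) :
    sliceR f (a ⊗ₜ b) = f b • a := by simp [sliceR]

@[simp] theorem sliceL_tmul {A : Type u} [AddCommGroup A] [Module ℂ A] (f : A →ₗ[ℂ] ℂ) (a b : A) :
    sliceL f (a ⊗ₜ b) = f a • b := by simp [sliceL]

open scoped ComplexOrder in
/-- An algebraic quantum group: a multiplier Hopf `*`-algebra `(A, Δ)` over `ℂ`, that is, a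
non-degenerate `*`-algebra `A` with a coassociative `*`-homomorphism `Δ : A → M(A ⊗ A)` such that
`a ⊗ b ↦ Δ(a)(1 ⊗ b)` and `a ⊗ b ↦ (a ⊗ 1)Δ(b)` are bijections of `A ⊗ A` onto `A ⊗ A ⊆ M(A ⊗ A)`,
together with a non-zero positive left invariant functional `φ`. -/
structure AlgQuantumGroup (A : Type u) [NonUnitalRing A] [StarRing A] [Module ℂ A]
    [IsScalarTower ℂ A A] [SMulCommClass ℂ A A] [StarModule ℂ A] where
  /-- `A` is non-degenerate (the condition on the other side follows by applying `*`). -/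
  nondeg : ∀ a : A, (∀ b, a * b = 0) → a = 0
  /-- The comultiplication. -/
  Δ : A →⋆ₙₐ[ℂ] Mult (A ⊗[ℂ] A)
  /-- The bijection `a ⊗ b ↦ Δ(a)(1 ⊗ b)`. -/
  T₁ : A ⊗[ℂ] A ≃ₗ[ℂ] A ⊗[ℂ] A
  /-- The bijection `a ⊗ b ↦ (a ⊗ 1)Δ(b)`. -/
  T₂ : A ⊗[ℂ] A ≃ₗ[ℂ] A ⊗[ℂ] A
  T₁_spec : ∀ a b, Mult.emb (T₁ (a ⊗ₜ b)) = Δ a * Mult.tmul 1 (Mult.emb b)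
  T₂_spec : ∀ a b, Mult.emb (T₂ (a ⊗ₜ b)) = Mult.tmul (Mult.emb a) 1 * Δ b
  /-- Coassociativity:
  `(a ⊗ 1 ⊗ 1)(Δ ⊗ ι)(Δ(b)(1 ⊗ c)) = (ι ⊗ Δ)((a ⊗ 1)Δ(b))(1 ⊗ 1 ⊗ c)`. -/
  coassoc : ∀ a b c : A,
    TensorProduct.assoc ℂ A A A
        (T₂.toLinearMap.rTensor A ((TensorProduct.assoc ℂ A A A).symm (a ⊗ₜ T₁ (b ⊗ₜ c)))) =
      T₁.toLinearMap.lTensor A (TensorProduct.assoc ℂ A A A (T₂ (a ⊗ₜ b) ⊗ₜ c))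
  /-- The left invariant functional. -/
  φ : A →ₗ[ℂ] ℂ
  φ_ne_zero : φ ≠ 0
  φ_pos : ∀ a, 0 ≤ φ (star a * a)
  /-- `(ι ⊗ φ)Δ(b) = φ(b)1`. -/
  φ_left_invariant : ∀ a b, sliceR φ (T₂ (a ⊗ₜ b)) = φ b • a

/-- A jointly injective family of linear maps stays jointly injective after tensoring. -/
theorem rTensor_joint_inj {ι : Type*} {M M' N : Type*} [AddCommGroup M] [Module ℂ M]
    [AddCommGroup M'] [Module ℂ M'] [AddCommGroup N] [Module ℂ N] (f : ι → M →ₗ[ℂ] M')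
    (h : ∀ m, (∀ i, f i m = 0) → m = 0) (t : M ⊗[ℂ] N)
    (ht : ∀ i, (f i).rTensor N t = 0) : t = 0 := by
  classical
  let b := Module.Basis.ofVectorSpace ℂ N
  have key : ∀ (g : M →ₗ[ℂ] M') (t : M ⊗[ℂ] N) j,
      equivFinsuppOfBasisRight b (g.rTensor N t) j = g (equivFinsuppOfBasisRight b t j) := by
    intro g t j
    induction t with
    | zero => simp
    | add s s' hs hs' => simp [hs, hs']
    | tmul m n => simp
  apply (equivFinsuppOfBasisRight (M := M) b).injective
  ext j
  simp only [map_zero, Finsupp.coe_zero, Pi.zero_apply]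
  exact h _ fun i => by rw [← key, ht, map_zero]; rfl

theorem lTensor_joint_inj {ι : Type*} {M M' N : Type*} [AddCommGroup M] [Module ℂ M]
    [AddCommGroup M'] [Module ℂ M'] [AddCommGroup N] [Module ℂ N] (f : ι → M →ₗ[ℂ] M')
    (h : ∀ m, (∀ i, f i m = 0) → m = 0) (t : N ⊗[ℂ] M)
    (ht : ∀ i, (f i).lTensor N t = 0) : t = 0 := by
  apply (TensorProduct.comm ℂ N M).injective
  rw [map_zero]
  refine rTensor_joint_inj f h _ fun i => ?_
  rw [← LinearMap.comm_comp_lTensor_comp_comm_eq]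
  simp [ht]

theorem mul_tmul_eq {A : Type u} [NonUnitalRing A] [Module ℂ A]
    [IsScalarTower ℂ A A] [SMulCommClass ℂ A A] (x : A ⊗[ℂ] A) (a b : A) : x * (a ⊗ₜ b) =
    (LinearMap.mulRight ℂ a).rTensor A ((LinearMap.mulRight ℂ b).lTensor A x) := by
  induction x with
  | zero => simp
  | add s s' hs hs' => simp only [add_mul, map_add, hs, hs']
  | tmul c d => simp

theorem tmul_mul_eq {A : Type u} [NonUnitalRing A] [Module ℂ A]
    [IsScalarTower ℂ A A] [SMulCommClass ℂ A A] (x : A ⊗[ℂ] A) (a b : A) : (a ⊗ₜ b) * x =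
    (LinearMap.mulLeft ℂ a).rTensor A ((LinearMap.mulLeft ℂ b).lTensor A x) := by
  induction x with
  | zero => simp
  | add s s' hs hs' => simp only [mul_add, map_add, hs, hs']
  | tmul c d => simp

namespace AlgQuantumGroup

variable {A : Type u} [NonUnitalRing A] [StarRing A] [Module ℂ A]
  [IsScalarTower ℂ A A] [SMulCommClass ℂ A A] [StarModule ℂ A]

theorem nondeg' (G : AlgQuantumGroup A) (a : A) (h : ∀ b, b * a = 0) : a = 0 := by
  have := G.nondeg (star a) (fun b => by rw [← star_star b, ← star_mul, h, star_zero])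
  simpa using congrArg star this

variable (G : AlgQuantumGroup A)

theorem L_T₁ (a b : A) (x : A ⊗[ℂ] A) :
    (G.Δ a).L ((LinearMap.mulLeft ℂ b).lTensor A x) = G.T₁ (a ⊗ₜ b) * x :=
  (congrArg (fun m : Mult (A ⊗[ℂ] A) => m.L x) (G.T₁_spec a b)).symm

theorem R_T₂ (a b : A) (x : A ⊗[ℂ] A) :
    (G.Δ b).R ((LinearMap.mulRight ℂ a).rTensor A x) = x * G.T₂ (a ⊗ₜ b) :=
  (congrArg (fun m : Mult (A ⊗[ℂ] A) => m.R x) (G.T₂_spec a b)).symm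

theorem L_T₂ (a b : A) (x : A ⊗[ℂ] A) :
    (LinearMap.mulLeft ℂ a).rTensor A ((G.Δ b).L x) = G.T₂ (a ⊗ₜ b) * x :=
  (congrArg (fun m : Mult (A ⊗[ℂ] A) => m.L x) (G.T₂_spec a b)).symm

theorem R_T₁ (a b : A) (x : A ⊗[ℂ] A) :
    (LinearMap.mulRight ℂ b).lTensor A ((G.Δ a).R x) = x * G.T₁ (a ⊗ₜ b) :=
  (congrArg (fun m : Mult (A ⊗[ℂ] A) => m.R x) (G.T₁_spec a b)).symm

theorem tensor_nondeg (G : AlgQuantumGroup A) (x : A ⊗[ℂ] A) (h : ∀ y, x * y = 0) : x = 0 := by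
  refine lTensor_joint_inj (fun b : A => LinearMap.mulRight ℂ b) (fun a ha => G.nondeg a ha) x
    fun b => ?_
  refine rTensor_joint_inj (fun b : A => LinearMap.mulRight ℂ b) (fun a ha => G.nondeg a ha) _
    fun a => ?_
  rw [← mul_tmul_eq, h]

/-- `(a ⊗ 1) (Δ(b)(1 ⊗ c)) = ((a ⊗ 1)Δ(b))(1 ⊗ c)`. -/
theorem mixed (a b c : A) : (LinearMap.mulLeft ℂ a).rTensor A (G.T₁ (b ⊗ₜ c)) =
    (LinearMap.mulRight ℂ c).lTensor A (G.T₂ (a ⊗ₜ b)) := by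
  rw [← sub_eq_zero]
  refine tensor_nondeg G _ fun y => ?_
  rw [sub_mul, sub_eq_zero]
  have h1 : ∀ (s y : A ⊗[ℂ] A), (LinearMap.mulLeft ℂ a).rTensor A s * y =
      (LinearMap.mulLeft ℂ a).rTensor A (s * y) := by
    intro s y
    induction s with
    | zero => simp
    | add s s' hs hs' => simp only [add_mul, map_add, hs, hs']
    | tmul c d =>
      induction y with
      | zero => simp
      | add s s' hs hs' => simp only [mul_add, map_add, hs, hs']
      | tmul c d => simp [mul_assoc]
  have h2 : ∀ (s y : A ⊗[ℂ] A), (LinearMap.mulRight ℂ c).lTensor A s * y =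
      s * (LinearMap.mulLeft ℂ c).lTensor A y := by
    intro s y
    induction s with
    | zero => simp
    | add s s' hs hs' => simp only [add_mul, map_add, hs, hs']
    | tmul c d =>
      induction y with
      | zero => simp
      | add s s' hs hs' => simp only [mul_add, map_add, hs, hs']
      | tmul c d => simp [mul_assoc]
  rw [h1, h2, ← L_T₁, L_T₂]

/-- `T₂` acting on the first two legs. -/
def P : A ⊗[ℂ] (A ⊗[ℂ] A) ≃ₗ[ℂ] A ⊗[ℂ] (A ⊗[ℂ] A) :=
  (TensorProduct.assoc ℂ A A A).symm ≪≫ₗ G.T₂.rTensor A ≪≫ₗ TensorProduct.assoc ℂ A A A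

/-- `T₁` acting on the last two legs. -/
def Q : A ⊗[ℂ] (A ⊗[ℂ] A) ≃ₗ[ℂ] A ⊗[ℂ] (A ⊗[ℂ] A) := G.T₁.lTensor A

theorem P_Q (x) : G.P (G.Q x) = G.Q (G.P x) := by
  induction x with
  | zero => simp
  | add s s' hs hs' => simp only [map_add, hs, hs']
  | tmul a y =>
    induction y with
    | zero => simp
    | add s s' hs hs' => simp only [map_add, tmul_add, hs, hs']
    | tmul b c => exact G.coassoc a b c

theorem P_Q_symm (x) : G.P (G.Q.symm x) = G.Q.symm (G.P x) := by
  apply G.Q.injective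
  rw [← P_Q]; simp

theorem P_symm_Q (x) : G.P.symm (G.Q x) = G.Q (G.P.symm x) := by
  apply G.P.injective
  rw [P_Q]; simp

theorem P_symm_Q_symm (x) : G.P.symm (G.Q.symm x) = G.Q.symm (G.P.symm x) := by
  apply G.P.injective
  rw [P_Q_symm]; simp

theorem exists_φ_one : ∃ p, G.φ p = 1 := by
  obtain ⟨p, hp⟩ : ∃ p, G.φ p ≠ 0 := by
    by_contra! h
    exact G.φ_ne_zero (LinearMap.ext h)
  exact ⟨(G.φ p)⁻¹ • p, by simp [hp]⟩

theorem aux1 (x : A ⊗[ℂ] A) (c : A) :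
    (LinearMap.mul' ℂ A ∘ₗ G.T₁.symm.toLinearMap).lTensor A (TensorProduct.assoc ℂ A A A (x ⊗ₜ c))
      = LinearMap.mul' ℂ A (G.T₂.symm x) ⊗ₜ c := by
  obtain ⟨y, rfl⟩ := G.T₂.surjective x
  rw [LinearEquiv.symm_apply_apply]
  induction y with
  | zero => simp
  | add s s' hs hs' => simp only [map_add, add_tmul, hs, hs']
  | tmul a b =>
    have h1 : TensorProduct.assoc ℂ A A A (G.T₂ (a ⊗ₜ b) ⊗ₜ c) = G.P (a ⊗ₜ (b ⊗ₜ c)) := rfl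
    rw [h1, LinearMap.lTensor_comp, LinearMap.comp_apply]
    change (LinearMap.mul' ℂ A).lTensor A (G.Q.symm (G.P _)) = _
    rw [← P_Q_symm]
    have h2 : G.Q.symm (a ⊗ₜ (b ⊗ₜ c)) = a ⊗ₜ G.T₁.symm (b ⊗ₜ c) := rfl
    rw [h2]
    have h3 : ∀ y : A ⊗[ℂ] A, (LinearMap.mul' ℂ A).lTensor A (G.P (a ⊗ₜ y)) =
        (LinearMap.mulLeft ℂ a).rTensor A (G.T₁ y) := by
      intro y
      induction y with
      | zero => simp
      | add s s' hs hs' => simp only [map_add, tmul_add, hs, hs']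
      | tmul p q =>
        rw [mixed]
        change (LinearMap.mul' ℂ A).lTensor A (TensorProduct.assoc ℂ A A A (G.T₂ (a ⊗ₜ p) ⊗ₜ q)) = _
        generalize G.T₂ (a ⊗ₜ p) = z
        induction z with
        | zero => simp
        | add s s' hs hs' => simp only [map_add, add_tmul, hs, hs']
        | tmul u w => simp
    rw [h3]; simp

theorem exists_eps : ∃ ε : A →ₗ[ℂ] ℂ, (∀ q c, LinearMap.mul' ℂ A (G.T₁.symm (q ⊗ₜ c)) = ε q • c) ∧
    ∀ p q, LinearMap.mul' ℂ A (G.T₂.symm (p ⊗ₜ q)) = ε q • p := by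
  obtain ⟨p0, hp0⟩ := G.exists_φ_one
  let ε : A →ₗ[ℂ] ℂ := G.φ ∘ₗ LinearMap.mul' ℂ A ∘ₗ G.T₂.symm.toLinearMap ∘ₗ
    TensorProduct.mk ℂ A A p0
  have h1 : ∀ q c, LinearMap.mul' ℂ A (G.T₁.symm (q ⊗ₜ c)) = ε q • c := by
    intro q c
    have := congrArg (sliceL G.φ) (G.aux1 (p0 ⊗ₜ q) c)
    simpa [hp0, ε] using this
  refine ⟨ε, h1, fun p q => ?_⟩
  have := congrArg (sliceR G.φ) (G.aux1 (p ⊗ₜ q) p0)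
  simpa [h1, hp0] using this.symm

theorem exists_eps' : ∃ ε : A →ₗ[ℂ] ℂ, (∀ x, LinearMap.mul' ℂ A (G.T₁.symm x) = sliceL ε x) ∧
    (∀ x, LinearMap.mul' ℂ A (G.T₂.symm x) = sliceR ε x) ∧
    (∀ x, sliceR ε (G.T₂ x) = LinearMap.mul' ℂ A x) ∧
    (∀ x, sliceL ε (G.T₁ x) = LinearMap.mul' ℂ A x) := by
  obtain ⟨ε, h1, h2⟩ := G.exists_eps
  have h1' : ∀ x, LinearMap.mul' ℂ A (G.T₁.symm x) = sliceL ε x := by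
    intro x
    induction x with
    | zero => simp
    | add s s' hs hs' => simp only [map_add, hs, hs']
    | tmul a b => simp [h1]
  have h2' : ∀ x, LinearMap.mul' ℂ A (G.T₂.symm x) = sliceR ε x := by
    intro x
    induction x with
    | zero => simp
    | add s s' hs hs' => simp only [map_add, hs, hs']
    | tmul a b => simp [h2]
  refine ⟨ε, h1', h2', fun x => by rw [← h2']; simp, fun x => ?_⟩
  induction x with
  | zero => simp
  | add s s' hs hs' => simp only [map_add, hs, hs']
  | tmul b c =>
    obtain ⟨p0, hp0⟩ := G.exists_φ_one
    have key := congrArg (fun z => (LinearMap.mul' ℂ A).rTensor A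
      ((TensorProduct.assoc ℂ A A A).symm z)) (G.P_symm_Q (p0 ⊗ₜ (b ⊗ₜ c)))
    have e1 : ∀ y : A ⊗[ℂ] A, (LinearMap.mul' ℂ A).rTensor A
        ((TensorProduct.assoc ℂ A A A).symm (G.P.symm (p0 ⊗ₜ y))) = p0 ⊗ₜ sliceL ε y := by
      intro y
      induction y with
      | zero => simp
      | add s s' hs hs' => simp only [map_add, tmul_add, hs, hs']
      | tmul p q =>
        change (LinearMap.mul' ℂ A).rTensor A ((TensorProduct.assoc ℂ A A A).symm
          (TensorProduct.assoc ℂ A A A (G.T₂.symm (p0 ⊗ₜ p) ⊗ₜ q))) = _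
        simp [h2, smul_tmul]
    have e2 : ∀ y : A ⊗[ℂ] A, (LinearMap.mul' ℂ A).rTensor A ((TensorProduct.assoc ℂ A A A).symm
        (G.Q (TensorProduct.assoc ℂ A A A (y ⊗ₜ c)))) =
        (LinearMap.mulRight ℂ c).lTensor A (G.T₂ y) := by
      intro y
      induction y with
      | zero => simp
      | add s s' hs hs' => simp only [map_add, add_tmul, hs, hs']
      | tmul p q =>
        rw [← mixed]
        change (LinearMap.mul' ℂ A).rTensor A ((TensorProduct.assoc ℂ A A A).symm
          (p ⊗ₜ G.T₁ (q ⊗ₜ c))) = _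
        generalize G.T₁ (q ⊗ₜ c) = z
        induction z with
        | zero => simp
        | add s s' hs hs' => simp only [map_add, tmul_add, hs, hs']
        | tmul u w => simp
    have e3 : G.P.symm (p0 ⊗ₜ (b ⊗ₜ c)) = TensorProduct.assoc ℂ A A A (G.T₂.symm (p0 ⊗ₜ b) ⊗ₜ c) :=
      rfl
    have e4 : G.Q (p0 ⊗ₜ (b ⊗ₜ c)) = p0 ⊗ₜ G.T₁ (b ⊗ₜ c) := rfl
    simp only [e3, e4] at key
    rw [e1, e2] at key
    have := congrArg (sliceL G.φ) key
    simpa [hp0] using this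

end AlgQuantumGroup

/-- Elements of `M ⊗ N` whose slices are killed by a jointly described subspace of `N`. -/
theorem slice_induction {ι M N M' : Type*} [AddCommGroup M] [Module ℂ M]
    [AddCommGroup N] [Module ℂ N] [AddCommGroup M'] [Module ℂ M'] (f : ι → N →ₗ[ℂ] ℂ)
    (t : M ⊗[ℂ] N) (ht : ∀ i, TensorProduct.rid ℂ M ((f i).lTensor M t) = 0)
    (g : M ⊗[ℂ] N →ₗ[ℂ] M') (hg : ∀ m n, (∀ i, f i n = 0) → g (m ⊗ₜ n) = 0) : g t = 0 := by
  classical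
  let b := Module.Basis.ofVectorSpace ℂ M
  have key : ∀ (h : N →ₗ[ℂ] ℂ) (t : M ⊗[ℂ] N) j,
      b.repr (TensorProduct.rid ℂ M (h.lTensor M t)) j = h (equivFinsuppOfBasisLeft b t j) := by
    intro h t j
    induction t with
    | zero => simp
    | add s s' hs hs' => simp [hs, hs']
    | tmul m n => simp [mul_comm]
  have h1 : ∀ j i, f i (equivFinsuppOfBasisLeft b t j) = 0 := fun j i => by
    rw [← key, ht]; simp
  rw [← (equivFinsuppOfBasisLeft b).symm_apply_apply t, equivFinsuppOfBasisLeft_symm_apply,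
    Finsupp.sum, map_sum]
  exact Finset.sum_eq_zero fun j _ => hg _ _ (h1 j)

namespace AlgQuantumGroup

variable {A : Type u} [NonUnitalRing A] [StarRing A] [Module ℂ A]
  [IsScalarTower ℂ A A] [SMulCommClass ℂ A A] [StarModule ℂ A] (G : AlgQuantumGroup A)

theorem T₂_mul (a b b' : A) : G.T₂ (a ⊗ₜ (b * b')) = (G.Δ b').R (G.T₂ (a ⊗ₜ b)) := by
  rw [← sub_eq_zero]
  refine tensor_nondeg G _ fun y => ?_
  rw [sub_mul, sub_eq_zero, Mult.central, ← L_T₂, ← L_T₂, map_mul, Mult.L_mul']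

theorem T₁_mul (n u w : A) : G.T₁ ((n * u) ⊗ₜ w) = (G.Δ n).L (G.T₁ (u ⊗ₜ w)) := by
  rw [← sub_eq_zero]
  refine tensor_nondeg G _ fun y => ?_
  rw [sub_mul, sub_eq_zero, ← Mult.L_mul, ← L_T₁, ← L_T₁, map_mul, Mult.L_mul']

end AlgQuantumGroup

theorem lTensor_mulLeft_mul {A : Type u} [NonUnitalRing A] [Module ℂ A]
    [IsScalarTower ℂ A A] [SMulCommClass ℂ A A] (q : A) (s y : A ⊗[ℂ] A) :
    (LinearMap.mulLeft ℂ q).lTensor A (s * y) = (LinearMap.mulLeft ℂ q).lTensor A s * y := by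
  induction s with
  | zero => simp
  | add s s' hs hs' => simp only [add_mul, map_add, hs, hs']
  | tmul c d =>
    induction y with
    | zero => simp
    | add s s' hs hs' => simp only [mul_add, map_add, hs, hs']
    | tmul c d => simp [mul_assoc]

theorem rTensor_mulLeft_mul {A : Type u} [NonUnitalRing A] [Module ℂ A]
    [IsScalarTower ℂ A A] [SMulCommClass ℂ A A] (q : A) (s y : A ⊗[ℂ] A) :
    (LinearMap.mulLeft ℂ q).rTensor A (s * y) = (LinearMap.mulLeft ℂ q).rTensor A s * y := by
  induction s with
  | zero => simp
  | add s s' hs hs' => simp only [add_mul, map_add, hs, hs']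
  | tmul c d =>
    induction y with
    | zero => simp
    | add s s' hs hs' => simp only [mul_add, map_add, hs, hs']
    | tmul c d => simp [mul_assoc]

theorem lTensor_mulRight_mul {A : Type u} [NonUnitalRing A] [Module ℂ A]
    [IsScalarTower ℂ A A] [SMulCommClass ℂ A A] (q : A) (s y : A ⊗[ℂ] A) :
    (LinearMap.mulRight ℂ q).lTensor A s * y = s * (LinearMap.mulLeft ℂ q).lTensor A y := by
  induction s with
  | zero => simp
  | add s s' hs hs' => simp only [add_mul, map_add, hs, hs']
  | tmul c d =>
    induction y with
    | zero => simp
    | add s s' hs hs' => simp only [mul_add, map_add, hs, hs']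
    | tmul c d => simp [mul_assoc]

theorem rTensor_mulRight_mul {A : Type u} [NonUnitalRing A] [Module ℂ A]
    [IsScalarTower ℂ A A] [SMulCommClass ℂ A A] (q : A) (s y : A ⊗[ℂ] A) :
    (LinearMap.mulRight ℂ q).rTensor A s * y = s * (LinearMap.mulLeft ℂ q).rTensor A y := by
  induction s with
  | zero => simp
  | add s s' hs hs' => simp only [add_mul, map_add, hs, hs']
  | tmul c d =>
    induction y with
    | zero => simp
    | add s s' hs hs' => simp only [mul_add, map_add, hs, hs']
    | tmul c d => simp [mul_assoc]

theorem star_rTensor_mulRight {A : Type u} [NonUnitalRing A] [StarRing A] [Module ℂ A]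
    [IsScalarTower ℂ A A] [SMulCommClass ℂ A A] [StarModule ℂ A] (x : A) (z : A ⊗[ℂ] A) :
    (LinearMap.mulRight ℂ (star x)).rTensor A (star z) =
      star ((LinearMap.mulLeft ℂ x).rTensor A z) := by
  induction z with
  | zero => simp
  | add s s' hs hs' => simp only [map_add, star_add, hs, hs']
  | tmul c d => simp

theorem star_sliceR {A : Type u} [AddCommGroup A] [StarAddMonoid A] [Module ℂ A]
    [StarModule ℂ A] (f g : A →ₗ[ℂ] ℂ) (h : ∀ a, g (star a) = conj (f a)) (t : A ⊗[ℂ] A) :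
    sliceR g (star t) = star (sliceR f t) := by
  induction t with
  | zero => simp
  | add s s' hs hs' => simp only [map_add, star_add, hs, hs']
  | tmul c d => simp [h]

theorem sliceR_rTensor_mulLeft {A : Type u} [NonUnitalRing A] [Module ℂ A]
    [IsScalarTower ℂ A A] [SMulCommClass ℂ A A] (f : A →ₗ[ℂ] ℂ) (c : A) (t : A ⊗[ℂ] A) :
    sliceR f ((LinearMap.mulLeft ℂ c).rTensor A t) = c * sliceR f t := by
  induction t with
  | zero => simp
  | add s s' hs hs' => simp only [map_add, mul_add, hs, hs']
  | tmul c d => simp [mul_smul_comm]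

theorem sliceR_rTensor_mulRight {A : Type u} [NonUnitalRing A] [Module ℂ A]
    [IsScalarTower ℂ A A] [SMulCommClass ℂ A A] (f : A →ₗ[ℂ] ℂ) (c : A) (t : A ⊗[ℂ] A) :
    sliceR f ((LinearMap.mulRight ℂ c).rTensor A t) = sliceR f t * c := by
  induction t with
  | zero => simp
  | add s s' hs hs' => simp only [map_add, add_mul, hs, hs']
  | tmul c d => simp [smul_mul_assoc]

theorem sliceR_lTensor {A : Type u} [NonUnitalRing A] [Module ℂ A]
    [IsScalarTower ℂ A A] [SMulCommClass ℂ A A] (f : A →ₗ[ℂ] ℂ) (c : A) (t : A ⊗[ℂ] A) :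
    sliceR f ((LinearMap.mulLeft ℂ c).lTensor A t) = sliceR (f ∘ₗ LinearMap.mulLeft ℂ c) t := by
  induction t with
  | zero => simp
  | add s s' hs hs' => simp only [map_add, hs, hs']
  | tmul c d => simp

namespace AlgQuantumGroup

variable {A : Type u} [NonUnitalRing A] [StarRing A] [Module ℂ A]
  [IsScalarTower ℂ A A] [SMulCommClass ℂ A A] [StarModule ℂ A] (G : AlgQuantumGroup A)

theorem R_Δ_tmul (b p q : A) :
    (G.Δ b).R (p ⊗ₜ q) = (LinearMap.mulLeft ℂ q).lTensor A (G.T₂ (p ⊗ₜ b)) := by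
  rw [← sub_eq_zero]
  refine tensor_nondeg G _ fun y => ?_
  rw [sub_mul, sub_eq_zero, Mult.central, ← lTensor_mulLeft_mul, ← L_T₂, tmul_mul_eq]
  exact LinearMap.congr_fun ((LinearMap.rTensor_comp_lTensor ..).trans
    (LinearMap.lTensor_comp_rTensor ..).symm) _

/-- The element `Δ(b)(a ⊗ 1)` of `A ⊗ A`. -/
def T₃ (b a : A) : A ⊗[ℂ] A := star (G.T₂ (star a ⊗ₜ star b))

theorem L_T₃ (b a : A) (z : A ⊗[ℂ] A) :
    (G.Δ b).L ((LinearMap.mulLeft ℂ a).rTensor A z) = G.T₃ b a * z := by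
  have h := G.R_T₂ (star a) (star b) (star z)
  rw [map_star, Mult.R_star, star_rTensor_mulRight, star_star] at h
  have h' := congrArg star h
  rw [star_star, star_mul, star_star] at h'
  exact h'

theorem L_Δ_tmul (n p x : A) :
    (G.Δ n).L (p ⊗ₜ x) = (LinearMap.mulRight ℂ x).lTensor A (G.T₃ n p) := by
  rw [← sub_eq_zero]
  refine tensor_nondeg G _ fun y => ?_
  rw [sub_mul, sub_eq_zero, ← Mult.L_mul, lTensor_mulRight_mul, ← L_T₃, tmul_mul_eq]

theorem mixed' (c y x : A) : (LinearMap.mulLeft ℂ c).rTensor A (G.T₃ y x) =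
    (LinearMap.mulRight ℂ x).rTensor A (G.T₂ (c ⊗ₜ y)) := by
  rw [← sub_eq_zero]
  refine tensor_nondeg G _ fun z => ?_
  rw [sub_mul, sub_eq_zero, ← rTensor_mulLeft_mul, rTensor_mulRight_mul, ← L_T₃, L_T₂]

theorem span_T₃ (t : A ⊗[ℂ] A) : t ∈ Submodule.span ℂ {s | ∃ y x, G.T₃ y x = s} := by
  obtain ⟨w, hw⟩ := G.T₂.surjective (star t)
  have : t = star (G.T₂ w) := by rw [hw, star_star]
  rw [this]
  clear hw this
  induction w with
  | zero => simp
  | add s s' hs hs' => rw [map_add, star_add]; exact add_mem hs hs'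
  | tmul a b => exact Submodule.subset_span ⟨star b, star a, by simp [T₃]⟩

theorem φ_left_invariant' (y x : A) : sliceR G.φ (G.T₃ y x) = G.φ y • x := by
  rw [← sub_eq_zero]
  refine G.nondeg' _ fun c => ?_
  rw [mul_sub, sub_eq_zero, ← sliceR_rTensor_mulLeft, mixed', sliceR_rTensor_mulRight,
    φ_left_invariant, smul_mul_assoc, mul_smul_comm]

/-- Existence of the counit. -/
theorem exists_counit : ∃ ε : A →⋆ₙₐ[ℂ] ℂ,
    (∀ a b, sliceL (ε : A →ₗ[ℂ] ℂ) (G.T₁ (a ⊗ₜ b)) = a * b) ∧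
    (∀ a b, sliceR (ε : A →ₗ[ℂ] ℂ) (G.T₂ (a ⊗ₜ b)) = a * b) := by
  obtain ⟨ε, h1, h2, h3, h4⟩ := G.exists_eps'
  obtain ⟨p0, hp0⟩ := G.exists_φ_one
  have hmul : ∀ q s, ε (q * s) = ε q * ε s := by
    intro q s
    have key : ∀ z, sliceR ε ((LinearMap.mulLeft ℂ q).lTensor A z) = ε q • sliceR ε z := by
      intro z
      obtain ⟨w, rfl⟩ := G.T₂.surjective z
      induction w with
      | zero => simp
      | add s s' hs hs' => simp only [map_add, smul_add, hs, hs']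
      | tmul p b' =>
        obtain ⟨y, hy⟩ := G.T₂.surjective (p ⊗ₜ q)
        have e1 : G.T₂ ((LinearMap.mulRight ℂ b').lTensor A y) = (G.Δ b').R (G.T₂ y) := by
          clear hy
          induction y with
          | zero => simp
          | add s s' hs hs' => simp only [map_add, hs, hs']
          | tmul a b => simp [T₂_mul]
        have e2 : LinearMap.mul' ℂ A ((LinearMap.mulRight ℂ b').lTensor A y) =
            LinearMap.mul' ℂ A y * b' := by
          clear hy e1
          induction y with
          | zero => simp
          | add s s' hs hs' => simp only [map_add, add_mul, hs, hs']
          | tmul a b => simp [mul_assoc]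
        rw [← R_Δ_tmul, ← hy, ← e1, h3, h3, e2, ← G.T₂.symm_apply_apply y, h2, hy]
        simp [smul_mul_assoc]
    have := congrArg G.φ (key (p0 ⊗ₜ s))
    simpa [hp0] using this
  have h5 : ∀ y x, sliceR ε (G.T₃ y x) = y * x := by
    intro y x
    rw [← sub_eq_zero]
    refine G.nondeg' _ fun c => ?_
    rw [mul_sub, sub_eq_zero, ← sliceR_rTensor_mulLeft, mixed', sliceR_rTensor_mulRight, h3]
    simp [mul_assoc]
  let ε' : A →ₗ[ℂ] ℂ :=
    { toFun := fun a => conj (ε (star a))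
      map_add' := by simp
      map_smul' := by simp }
  have h6 : ∀ y x, sliceR ε' (G.T₃ y x) = y * x := by
    intro y x
    rw [T₃, star_sliceR ε ε' (by simp [ε']), h3]
    simp
  have h7 : ∀ t, sliceR ε t = sliceR ε' t := by
    intro t
    have ht := G.span_T₃ t
    induction ht using Submodule.span_induction with
    | mem x h => obtain ⟨y, x, rfl⟩ := h; rw [h5, h6]
    | zero => simp
    | add x y _ _ hx hy => simp [hx, hy]
    | smul a x _ hx => simp [hx]
  have hstar : ∀ a, ε (star a) = star (ε a) := by
    intro a
    have := congrArg G.φ (h7 (p0 ⊗ₜ star a))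
    simpa [hp0, ε'] using this
  refine ⟨{ toFun := ε, map_smul' := fun c a => by simp, map_zero' := by simp,
            map_add' := by simp, map_mul' := hmul, map_star' := hstar }, ?_, ?_⟩
  · intro a b
    exact (h4 _).trans (by simp)
  · intro a b
    exact (h3 _).trans (by simp)

/-- The counit `ε`: the unique linear functional, and a `*`-homomorphism, with
`(ε ⊗ ι)(Δ(a)(1 ⊗ b)) = ab` and `(ι ⊗ ε)((a ⊗ 1)Δ(b)) = ab`. -/
def ε : A →⋆ₙₐ[ℂ] ℂ := G.exists_counit.choose

theorem sliceL_ε (a b : A) : sliceL (G.ε : A →ₗ[ℂ] ℂ) (G.T₁ (a ⊗ₜ b)) = a * b :=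
  G.exists_counit.choose_spec.1 a b

theorem sliceR_ε (a b : A) : sliceR (G.ε : A →ₗ[ℂ] ℂ) (G.T₂ (a ⊗ₜ b)) = a * b :=
  G.exists_counit.choose_spec.2 a b

theorem exists_ε_one : ∃ d, G.ε d = 1 := by
  obtain ⟨d, hd⟩ : ∃ d, G.ε d ≠ 0 := by
    by_contra! h
    obtain ⟨p, hp⟩ := G.exists_φ_one
    have h0 : (G.ε : A →ₗ[ℂ] ℂ) = 0 := LinearMap.ext h
    have : p = 0 := G.nondeg p fun b => by
      rw [← sliceR_ε, h0]; simp [sliceR]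
    simp [this] at hp
  exact ⟨(G.ε d)⁻¹ • d, by simp [hd]⟩

/-- The left invariant functional is faithful. -/
theorem φ_faithful (n : A) (hn : ∀ b, G.φ (b * n) = 0) : n = 0 := by
  obtain ⟨p0, hp0⟩ := G.exists_φ_one
  obtain ⟨d0, hd0⟩ := G.exists_ε_one
  let f : A → A →ₗ[ℂ] ℂ := fun b => G.φ ∘ₗ LinearMap.mulLeft ℂ b
  let ε : A →ₗ[ℂ] ℂ := G.ε
  have hε : ∀ q s, ε (q * s) = ε q * ε s := fun q s => map_mul G.ε q s
  have s1 : ∀ n, (∀ b, G.φ (b * n) = 0) → ∀ b p, sliceR (f b) (G.T₂ (p ⊗ₜ n)) = 0 := by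
    intro n hn b p
    rw [← sliceR_lTensor, ← R_Δ_tmul]
    obtain ⟨y, hy⟩ := G.T₂.surjective (p ⊗ₜ b)
    rw [← hy]
    clear hy
    induction y with
    | zero => simp
    | add s s' hs hs' => simp only [map_add, hs, hs', add_zero]
    | tmul a b => rw [← T₂_mul, φ_left_invariant, hn, zero_smul]
  have s2 : ∀ n, (∀ b, G.φ (b * n) = 0) → ∀ b p, sliceR (f b) (G.T₃ n p) = 0 := by
    intro n hn b p
    refine G.nondeg' _ fun c => ?_
    rw [← sliceR_rTensor_mulLeft, mixed', sliceR_rTensor_mulRight, s1 n hn, zero_mul]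
  have hm2 : ∀ x, LinearMap.mul' ℂ A (G.T₂.symm x) = sliceR ε x := by
    intro x
    obtain ⟨y, rfl⟩ := G.T₂.surjective x
    rw [LinearEquiv.symm_apply_apply]
    induction y with
    | zero => simp
    | add s s' hs hs' => simp only [map_add, hs, hs']
    | tmul a b => simp [ε, sliceR_ε]
  have hm1 : ∀ x, LinearMap.mul' ℂ A (G.T₁.symm x) = sliceL ε x := by
    intro x
    obtain ⟨y, rfl⟩ := G.T₁.surjective x
    rw [LinearEquiv.symm_apply_apply]
    induction y with
    | zero => simp
    | add s s' hs hs' => simp only [map_add, hs, hs']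
    | tmul a b => simp [ε, sliceL_ε]
  have s3 : ∀ b a x, sliceR ε (G.T₂.symm (b ⊗ₜ a)) * x = b * sliceL ε (G.T₁.symm (a ⊗ₜ x)) := by
    intro b a x
    have key := congrArg (fun z => LinearMap.mul' ℂ A ((LinearMap.mul' ℂ A).lTensor A z))
      (G.P_symm_Q_symm (b ⊗ₜ (a ⊗ₜ x)))
    have e1 : ∀ y : A ⊗[ℂ] A, LinearMap.mul' ℂ A ((LinearMap.mul' ℂ A).lTensor A
        (G.P.symm (b ⊗ₜ y))) = b * sliceL ε y := by
      intro y
      induction y with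
      | zero => simp
      | add s s' hs hs' => simp only [map_add, tmul_add, mul_add, hs, hs']
      | tmul p q =>
        have : G.P.symm (b ⊗ₜ (p ⊗ₜ q)) =
          TensorProduct.assoc ℂ A A A (G.T₂.symm (b ⊗ₜ p) ⊗ₜ q) := rfl
        rw [this]
        have h := hm2 (b ⊗ₜ p)
        have e : ∀ w : A ⊗[ℂ] A, LinearMap.mul' ℂ A ((LinearMap.mul' ℂ A).lTensor A
            (TensorProduct.assoc ℂ A A A (w ⊗ₜ q))) = LinearMap.mul' ℂ A w * q := by
          intro w
          induction w with
          | zero => simp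
          | add s s' hs hs' => simp only [map_add, add_tmul, add_mul, hs, hs']
          | tmul u v => simp [mul_assoc]
        rw [e, h]; simp [smul_mul_assoc, mul_smul_comm]
    have e2 : ∀ z : A ⊗[ℂ] A, LinearMap.mul' ℂ A ((LinearMap.mul' ℂ A).lTensor A
        (G.Q.symm (TensorProduct.assoc ℂ A A A (z ⊗ₜ x)))) = sliceR ε z * x := by
      intro z
      induction z with
      | zero => simp
      | add s s' hs hs' => simp only [map_add, add_tmul, add_mul, hs, hs']
      | tmul p q =>
        have : G.Q.symm (TensorProduct.assoc ℂ A A A ((p ⊗ₜ q) ⊗ₜ x)) =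
          p ⊗ₜ G.T₁.symm (q ⊗ₜ x) := rfl
        rw [this]
        simp [hm1, smul_mul_assoc]
    have e3 : G.Q.symm (b ⊗ₜ (a ⊗ₜ x)) = b ⊗ₜ G.T₁.symm (a ⊗ₜ x) := rfl
    have e4 : G.P.symm (b ⊗ₜ (a ⊗ₜ x)) = TensorProduct.assoc ℂ A A A (G.T₂.symm (b ⊗ₜ a) ⊗ₜ x) :=
      rfl
    simp only [e3, e4] at key
    rw [e1, e2] at key
    exact key.symm
  have s4 : ∀ n w, G.T₁.symm ((G.Δ n).L w) = (LinearMap.mulLeft ℂ n).rTensor A (G.T₁.symm w) := by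
    intro n w
    obtain ⟨v, rfl⟩ := G.T₁.surjective w
    rw [LinearEquiv.symm_apply_apply, LinearEquiv.symm_apply_eq]
    induction v with
    | zero => simp
    | add s s' hs hs' => simp only [map_add, hs, hs']
    | tmul a b => simp [T₁_mul]
  let Rb : A → A →ₗ[ℂ] A := fun b => sliceR ε ∘ₗ G.T₂.symm.toLinearMap ∘ₗ TensorProduct.mk ℂ A A b
  let Gb : A → A ⊗[ℂ] A →ₗ[ℂ] A := fun b => LinearMap.mul' ℂ A ∘ₗ (Rb b).rTensor A
  have s5 : ∀ b n p, Gb b (G.T₃ n p) = ε n • Rb b p := by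
    intro b n p
    rw [← sub_eq_zero]
    refine G.nondeg _ fun x => ?_
    rw [sub_mul, sub_eq_zero]
    have e : ∀ s, Gb b s * x = b * sliceL ε (G.T₁.symm ((LinearMap.mulRight ℂ x).lTensor A s)) := by
      intro s
      induction s with
      | zero => simp
      | add s s' hs hs' => simp only [map_add, add_mul, mul_add, hs, hs']
      | tmul u v => simp [Gb, Rb, mul_assoc, ← s3]
    rw [e, ← L_Δ_tmul, s4]
    have e' : ∀ t, sliceL ε ((LinearMap.mulLeft ℂ n).rTensor A t) = ε n • sliceL ε t := by
      intro t
      induction t with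
      | zero => simp
      | add s s' hs hs' => simp only [map_add, smul_add, hs, hs']
      | tmul u v => simp [hε, mul_smul]
    rw [e', mul_smul_comm, ← s3, smul_mul_assoc]
    rfl
  have s6 : ∀ n, (∀ b, G.φ (b * n) = 0) → ε n = 0 := by
    intro n hn
    have h1 : ∀ b p, ε n • G.φ (Rb b p) = 0 := by
      intro b p
      rw [← map_smul, ← s5]
      exact slice_induction f (G.T₃ n p) (fun c => s2 n hn c p) (G.φ ∘ₗ Gb b)
        (fun m k hk => hk (Rb b m))
    have h2 : ∀ z, ε n • G.φ (sliceR ε (G.T₂.symm z)) = 0 := by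
      intro z
      induction z with
      | zero => simp
      | add s s' hs hs' => simp only [map_add, smul_add, hs, hs', add_zero]
      | tmul u v => exact h1 u v
    have := h2 (G.T₂ (p0 ⊗ₜ d0))
    simpa [hp0, hd0, ε] using this
  refine G.nondeg' n fun p => ?_
  rw [← sliceR_ε]
  refine slice_induction f _ (fun c => s1 n hn c p) (sliceR ε) fun m k hk => ?_
  rw [sliceR_tmul, s6 k hk, zero_smul]

end AlgQuantumGroup

section PreHilbert

variable {K K' : Type u} [AddCommGroup K] [Module ℂ K] [AddCommGroup K'] [Module ℂ K']

/-- The inner product of the pre-Hilbert space `K ⊗ K'`. -/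
@[reducible] def tensorCore (c : InnerProductSpace.Core ℂ K) (c' : InnerProductSpace.Core ℂ K') :
    InnerProductSpace.Core ℂ (K ⊗[ℂ] K') :=
  letI : NormedAddCommGroup K := c.toNormedAddCommGroup
  letI : InnerProductSpace ℂ K := InnerProductSpace.ofCore c.toCore
  letI : NormedAddCommGroup K' := c'.toNormedAddCommGroup
  letI : InnerProductSpace ℂ K' := InnerProductSpace.ofCore c'.toCore
  (InnerProductSpace.toCore : InnerProductSpace.Core ℂ (K ⊗[ℂ] K'))

theorem tensorCore_tmul (c : InnerProductSpace.Core ℂ K) (c' : InnerProductSpace.Core ℂ K')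
    (u v : K) (u' v' : K') :
    (tensorCore c c').inner (u ⊗ₜ u') (v ⊗ₜ v') = c.inner u v * c'.inner u' v' := rfl

/-- The inner product of a direct sum of copies of a pre-Hilbert space. -/
@[reducible] def finsuppCore (I : Type u) (c : InnerProductSpace.Core ℂ K) :
    InnerProductSpace.Core ℂ (I →₀ K) := by
  classical
  letI := c
  have h0 : ∀ (f g : I →₀ K) (s : Finset I), f.support ⊆ s →
      (f.sum fun i v => c.inner v (g i)) = ∑ i ∈ s, c.inner (f i) (g i) := fun f g s hs =>
    Finsupp.sum_of_support_subset _ hs _ fun i _ => InnerProductSpace.Core.inner_zero_left _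
  exact
  { inner := fun f g => f.sum fun i v => c.inner v (g i)
    conj_inner_symm := fun f g => by
      rw [h0 f g (f.support ∪ g.support) Finset.subset_union_left,
        h0 g f (f.support ∪ g.support) Finset.subset_union_right, map_sum]
      exact Finset.sum_congr rfl fun i _ => c.conj_inner_symm _ _
    re_inner_nonneg := fun f => by
      rw [Finsupp.sum, map_sum]
      exact Finset.sum_nonneg fun i _ => c.re_inner_nonneg _
    add_left := fun f g h => by
      rw [h0 (f + g) h (f.support ∪ g.support) Finsupp.support_add,
        h0 f h (f.support ∪ g.support) Finset.subset_union_left,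
        h0 g h (f.support ∪ g.support) Finset.subset_union_right, ← Finset.sum_add_distrib]
      exact Finset.sum_congr rfl fun i _ => c.add_left _ _ _
    smul_left := fun f g r => by
      rw [h0 (r • f) g f.support Finsupp.support_smul, Finsupp.sum, Finset.mul_sum]
      exact Finset.sum_congr rfl fun i _ => c.smul_left _ _ _
    definite := fun f hf => by
      have h1 := congrArg Complex.re hf
      rw [Finsupp.sum, Complex.re_sum, Complex.zero_re] at h1
      replace h1 := (Finset.sum_eq_zero_iff_of_nonneg fun i _ =>
        c.re_inner_nonneg (f i)).1 h1
      ext i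
      by_cases hi : i ∈ f.support
      · exact c.definite _ (Complex.ext (h1 i hi)
          (InnerProductSpace.Core.inner_self_im (𝕜 := ℂ) (f i)))
      · simpa using hi }

theorem finsuppCore_apply (I : Type u) (c : InnerProductSpace.Core ℂ K) (f g : I →₀ K) :
    (finsuppCore I c).inner f g = f.sum fun i v => c.inner v (g i) := rfl

/-- An inner product as a sesquilinear map. -/
def coreForm (c : InnerProductSpace.Core ℂ K) : K →ₗ⋆[ℂ] K →ₗ[ℂ] ℂ :=
  let _ := c
  LinearMap.mk₂'ₛₗ (starRingEnd ℂ) (RingHom.id ℂ) (fun u v => c.inner u v)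
    (fun u u' v => c.add_left u u' v) (fun r u v => c.smul_left u v r)
    (fun u v v' => InnerProductSpace.Core.inner_add_right u v v')
    (fun _ u v => InnerProductSpace.Core.inner_smul_right u v)

theorem coreForm_apply (c : InnerProductSpace.Core ℂ K) (u v : K) :
    coreForm c u v = c.inner u v := rfl

/-- The standard inner product on the line `ℂ` (in the universe at hand). -/
@[reducible] def lineCore : InnerProductSpace.Core ℂ (ULift.{u} ℂ) where
  inner z w := conj z.down * w.down
  conj_inner_symm z w := by simp [mul_comm]
  re_inner_nonneg z := by
    simp [mul_self_nonneg, add_nonneg]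
  add_left := by simp [add_mul]
  smul_left := by simp [mul_assoc]
  definite z hz := by
    have : z.down = 0 := by simpa using hz
    exact ULift.down_injective this

end PreHilbert

theorem ext_on_act {B : Type u} [NonUnitalRing B] [Module ℂ B] {V : Type u} [AddCommGroup V]
    [Module ℂ V] {V' : Type*} [AddCommGroup V'] [Module ℂ V'] (ρ : B →ₙₐ[ℂ] Module.End ℂ V)
    (hd : Submodule.span ℂ {w | ∃ b v, ρ b v = w} = ⊤) {S T : V →ₗ[ℂ] V'}
    (h : ∀ b v, S (ρ b v) = T (ρ b v)) : S = T :=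
  LinearMap.ext_on hd (by rintro _ ⟨b, v, rfl⟩; exact h b v)

theorem core_ext {V : Type u} [AddCommGroup V] [Module ℂ V] (c : InnerProductSpace.Core ℂ V)
    {s : Set V} (hs : Submodule.span ℂ s = ⊤) {u : V} (h : ∀ v ∈ s, c.inner u v = 0) : u = 0 := by
  have h0 : coreForm c u = (0 : V →ₗ[ℂ] ℂ) := LinearMap.ext_on hs (fun v hv => h v hv)
  exact c.definite u (LinearMap.congr_fun h0 u)

theorem cancel_of_star {B : Type u} [NonUnitalRing B] [StarRing B] [Module ℂ B] {V : Type u}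
    [AddCommGroup V] [Module ℂ V] (c : InnerProductSpace.Core ℂ V) (ρ : B →ₙₐ[ℂ] Module.End ℂ V)
    (hd : Submodule.span ℂ {w | ∃ b v, ρ b v = w} = ⊤)
    (hs : ∀ b u v, c.inner (ρ b u) v = c.inner u (ρ (star b) v)) (u : V)
    (h : ∀ b, ρ b u = 0) : u = 0 := by
  refine core_ext c hd ?_
  rintro _ ⟨b, v, rfl⟩
  have h0 : coreForm c 0 = 0 := map_zero _
  rw [← star_star b, ← hs, h, ← coreForm_apply, h0, LinearMap.zero_apply]

/-- `Δ(a)(b ⊗ c) = (Δ(a)(1 ⊗ c))(b ⊗ 1)`. -/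
theorem AlgQuantumGroup.L_Δ_tmul' {A : Type u} [NonUnitalRing A] [StarRing A] [Module ℂ A]
    [IsScalarTower ℂ A A] [SMulCommClass ℂ A A] [StarModule ℂ A] (G : AlgQuantumGroup A)
    (a b c : A) :
    (G.Δ a).L (b ⊗ₜ c) = (LinearMap.mulRight ℂ b).rTensor A (G.T₁ (a ⊗ₜ c)) := by
  rw [← sub_eq_zero]
  refine tensor_nondeg G _ fun y => ?_
  rw [sub_mul, sub_eq_zero, ← Mult.L_mul, rTensor_mulRight_mul, ← L_T₁, tmul_mul_eq]
  exact congrArg _ (LinearMap.congr_fun ((LinearMap.rTensor_comp_lTensor ..).trans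
    (LinearMap.lTensor_comp_rTensor ..).symm) _)

section Extension

variable {B : Type u} [NonUnitalRing B] [Module ℂ B] [IsScalarTower ℂ B B] [SMulCommClass ℂ B B]
  {V : Type u} [AddCommGroup V] [Module ℂ V]

theorem exists_extension (ρ : B →ₙₐ[ℂ] Module.End ℂ V)
    (hd : Submodule.span ℂ {w | ∃ b v, ρ b v = w} = ⊤) (hc : ∀ v, (∀ b, ρ b v = 0) → v = 0)
    (m : Mult B) : ∃ T : Module.End ℂ V, ∀ b v, T (ρ b v) = ρ (m.L b) v := by
  let μ : B ⊗[ℂ] V →ₗ[ℂ] V := TensorProduct.lift (ρ : B →ₗ[ℂ] Module.End ℂ V)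
  have hμ : LinearMap.range μ = ⊤ := by
    rw [eq_top_iff, ← hd, Submodule.span_le]
    rintro _ ⟨b, v, rfl⟩
    exact ⟨b ⊗ₜ v, by simp [μ]⟩
  obtain ⟨s, hs⟩ := μ.exists_rightInverse_of_surjective hμ
  have key : ∀ t, μ t = 0 → μ (m.L.rTensor V t) = 0 := by
    intro t ht
    refine hc _ fun c => ?_
    have : ∀ t, ρ c (μ (m.L.rTensor V t)) = ρ (m.R c) (μ t) := by
      intro t
      induction t with
      | zero => simp
      | add s s' hs hs' => simp only [map_add, hs, hs']
      | tmul b v =>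
        have e := congrArg (fun z => ρ z v) (m.central c b)
        simp only [map_mul] at e
        simpa [μ] using e.symm
    rw [this, ht, map_zero]
  refine ⟨μ ∘ₗ m.L.rTensor V ∘ₗ s, fun b v => ?_⟩
  have h1 : μ (s (ρ b v) - b ⊗ₜ v) = 0 := by
    rw [map_sub, sub_eq_zero]
    have := LinearMap.congr_fun hs (ρ b v)
    simpa [μ] using this
  have h2 := key _ h1
  rw [map_sub, map_sub, sub_eq_zero] at h2
  simpa [μ] using h2

/-- The operator `ρ(m)` determined by `ρ(m)ρ(b)v = ρ(mb)v`. -/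
def extMap (ρ : B →ₙₐ[ℂ] Module.End ℂ V)
    (hd : Submodule.span ℂ {w | ∃ b v, ρ b v = w} = ⊤) (hc : ∀ v, (∀ b, ρ b v = 0) → v = 0)
    (m : Mult B) : Module.End ℂ V := (exists_extension ρ hd hc m).choose

theorem extMap_apply (ρ : B →ₙₐ[ℂ] Module.End ℂ V)
    (hd : Submodule.span ℂ {w | ∃ b v, ρ b v = w} = ⊤) (hc : ∀ v, (∀ b, ρ b v = 0) → v = 0)
    (m : Mult B) (b : B) (v : V) : extMap ρ hd hc m (ρ b v) = ρ (m.L b) v :=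
  (exists_extension ρ hd hc m).choose_spec b v

/-- The unique extension, `ρ(m)ρ(b)v = ρ(mb)v`, of a representation of `B` to `M(B)`. -/
def extendMult (ρ : B →ₙₐ[ℂ] Module.End ℂ V)
    (hd : Submodule.span ℂ {w | ∃ b v, ρ b v = w} = ⊤) (hc : ∀ v, (∀ b, ρ b v = 0) → v = 0) :
    Mult B →ₐ[ℂ] Module.End ℂ V :=
  AlgHom.ofLinearMap
    { toFun := extMap ρ hd hc
      map_add' := fun m n => ext_on_act ρ hd fun b v => by
        simp [extMap_apply]
      map_smul' := fun c m => ext_on_act ρ hd fun b v => by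
        simp [extMap_apply] }
    (ext_on_act ρ hd fun b v => by simp [extMap_apply])
    (fun m n => ext_on_act ρ hd fun b v => by simp [extMap_apply])

theorem extendMult_apply (ρ : B →ₙₐ[ℂ] Module.End ℂ V)
    (hd : Submodule.span ℂ {w | ∃ b v, ρ b v = w} = ⊤) (hc : ∀ v, (∀ b, ρ b v = 0) → v = 0)
    (m : Mult B) (b : B) (v : V) : extendMult ρ hd hc m (ρ b v) = ρ (m.L b) v :=
  extMap_apply ρ hd hc m b v

theorem extendMult_star [StarRing B] [StarModule ℂ B] (c : InnerProductSpace.Core ℂ V)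
    (ρ : B →ₙₐ[ℂ] Module.End ℂ V)
    (hd : Submodule.span ℂ {w | ∃ b v, ρ b v = w} = ⊤) (hc : ∀ v, (∀ b, ρ b v = 0) → v = 0)
    (hs : ∀ b u v, c.inner (ρ b u) v = c.inner u (ρ (star b) v)) (m : Mult B) (u v : V) :
    c.inner (extendMult ρ hd hc m u) v = c.inner u (extendMult ρ hd hc (star m) v) := by
  have h1 : ∀ b u, (coreForm c) (extendMult ρ hd hc m (ρ b u)) =
      (coreForm c (ρ b u)) ∘ₗ extendMult ρ hd hc (star m) := by
    intro b u
    refine ext_on_act (V' := ℂ) ρ hd fun d v => ?_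
    rw [LinearMap.comp_apply, extendMult_apply, extendMult_apply, coreForm_apply, coreForm_apply,
      hs, hs, ← Module.End.mul_apply, ← Module.End.mul_apply, ← map_mul, ← map_mul, ← Mult.central,
      Mult.R_star, star_star]
  have h2 : ∀ u v, coreForm c (extendMult ρ hd hc m u) v =
      coreForm c u (extendMult ρ hd hc (star m) v) := by
    intro u v
    have hu : u ∈ Submodule.span ℂ {w | ∃ b v, ρ b v = w} := hd ▸ Submodule.mem_top
    induction hu using Submodule.span_induction with
    | mem x h => obtain ⟨b, w, rfl⟩ := h; exact LinearMap.congr_fun (h1 b w) v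
    | zero => simp
    | add x y _ _ hx hy => simp [hx, hy]
    | smul a x _ hx => simp [hx]
  exact h2 u v

end Extension

variable {A : Type u} [NonUnitalRing A] [StarRing A] [Module ℂ A]
  [IsScalarTower ℂ A A] [SMulCommClass ℂ A A] [StarModule ℂ A]

/-- An object of `Rep(A, Δ)`: a `*`-representation `π` of `A` on a pre-Hilbert space `K` with
`π(A)K = K`. -/
structure StarRep (G : AlgQuantumGroup A) : Type (u + 1) where
  /-- The underlying vector space. -/
  K : Type u
  [addCommGroup : AddCommGroup K]
  [module : Module ℂ K]
  /-- The inner product, conjugate linear in the first variable. -/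
  core : InnerProductSpace.Core ℂ K
  /-- The action of `A`. -/
  act : A →ₙₐ[ℂ] Module.End ℂ K
  nondeg : Submodule.span ℂ {w | ∃ a v, act a v = w} = ⊤
  act_star : ∀ a u v, core.inner (act a u) v = core.inner u (act (star a) v)

namespace StarRep

attribute [instance] StarRep.addCommGroup StarRep.module

variable {G : AlgQuantumGroup A}

theorem cancel (X : StarRep G) (u : X.K) (h : ∀ a, X.act a u = 0) : u = 0 :=
  cancel_of_star X.core X.act X.nondeg X.act_star u h

/-- The arrows of `Rep(A, Δ)`: intertwining linear maps. -/
@[ext] structure Hom (X Y : StarRep G) : Type u where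
  /-- The underlying linear map. -/
  lin : X.K →ₗ[ℂ] Y.K
  comm : ∀ a v, lin (X.act a v) = Y.act a (lin v)

open CategoryTheory

instance : Category (StarRep G) where
  Hom := Hom
  id X := ⟨LinearMap.id, fun _ _ => rfl⟩
  comp f g := ⟨g.lin ∘ₗ f.lin, fun a v => by simp [f.comm, g.comm]⟩

@[ext] theorem hom_ext {X Y : StarRep G} {f g : X ⟶ Y} (h : f.lin = g.lin) : f = g := Hom.ext h

@[simp] theorem id_lin (X : StarRep G) : Hom.lin (𝟙 X) = LinearMap.id := rfl
@[simp] theorem comp_lin {X Y Z : StarRep G} (f : X ⟶ Y) (g : Y ⟶ Z) :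
    Hom.lin (f ≫ g) = g.lin ∘ₗ f.lin := rfl

/-- The isomorphism given by an intertwining linear equivalence. -/
def isoMk {X Y : StarRep G} (e : X.K ≃ₗ[ℂ] Y.K) (h : ∀ a v, e (X.act a v) = Y.act a (e v)) :
    X ≅ Y where
  hom := ⟨e, h⟩
  inv := ⟨e.symm, fun a v => by
    apply e.injective
    change e (e.symm _) = e (X.act a (e.symm v))
    rw [h]; simp⟩
  hom_inv_id := by ext v; simp
  inv_hom_id := by ext v; simp

/-- The representation `π ⊗ π'` of `A ⊗ A` on `K ⊗ K'`. -/
def extAct (X Y : StarRep G) : A ⊗[ℂ] A →ₙₐ[ℂ] Module.End ℂ (X.K ⊗[ℂ] Y.K) where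
  __ := TensorProduct.homTensorHomMap (RingHom.id ℂ) X.K Y.K X.K Y.K ∘ₗ
    TensorProduct.map (X.act : A →ₗ[ℂ] _) (Y.act : A →ₗ[ℂ] _)
  map_zero' := by simp
  map_mul' s t := by
    induction s with
    | zero => simp
    | add s s' hs hs' => simp only [add_mul, LinearMap.toFun_eq_coe, map_add] at hs hs' ⊢; rw [hs, hs']
    | tmul a b =>
      induction t with
      | zero => simp
      | add t t' ht ht' =>
        simp only [mul_add, LinearMap.toFun_eq_coe, map_add] at ht ht' ⊢; rw [ht, ht']
      | tmul c d => 
        ext v w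
        simp

@[simp] theorem extAct_tmul (X Y : StarRep G) (a b : A) :
    X.extAct Y (a ⊗ₜ b) = TensorProduct.map (X.act a) (Y.act b) := rfl

theorem extAct_nondeg (X Y : StarRep G) :
    Submodule.span ℂ {w | ∃ x v, X.extAct Y x v = w} = ⊤ := by
  rw [eq_top_iff, ← TensorProduct.span_tmul_eq_top, Submodule.span_le]
  rintro _ ⟨v, w, rfl⟩
  have hv : v ∈ Submodule.span ℂ {w | ∃ b v, X.act b v = w} := X.nondeg ▸ Submodule.mem_top
  have hw : w ∈ Submodule.span ℂ {w | ∃ b v, Y.act b v = w} := Y.nondeg ▸ Submodule.mem_top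
  rw [SetLike.mem_coe]
  induction hv using Submodule.span_induction with
  | zero => simp
  | add x y _ _ hx hy => rw [add_tmul]; exact add_mem hx hy
  | smul a x _ hx => rw [← smul_tmul']; exact Submodule.smul_mem _ _ hx
  | mem x h =>
    obtain ⟨a, v, rfl⟩ := h
    induction hw using Submodule.span_induction with
    | zero => simp
    | add x y _ _ hx hy => rw [tmul_add]; exact add_mem hx hy
    | smul a x _ hx => rw [tmul_smul]; exact Submodule.smul_mem _ _ hx
    | mem x h =>
      obtain ⟨b, w, rfl⟩ := h
      exact Submodule.subset_span ⟨a ⊗ₜ b, v ⊗ₜ w, by simp⟩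

theorem extAct_star (X Y : StarRep G) (x : A ⊗[ℂ] A) (u v : X.K ⊗[ℂ] Y.K) :
    (tensorCore X.core Y.core).inner (X.extAct Y x u) v =
      (tensorCore X.core Y.core).inner u (X.extAct Y (star x) v) := by
  rw [← coreForm_apply, ← coreForm_apply]
  induction x with
  | zero => simp
  | add s s' hs hs' =>
    simp only [map_add, star_add, LinearMap.add_apply, hs, hs']
  | tmul a b =>
    induction u with
    | zero => simp
    | add s s' hs hs' => simp only [map_add, LinearMap.add_apply, hs, hs']
    | tmul p q =>
      induction v with
      | zero => simp
      | add s s' hs hs' => simp only [map_add, hs, hs']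
      | tmul r s =>
        simp only [star_tmul, extAct_tmul, TensorProduct.map_tmul, coreForm_apply, tensorCore_tmul,
          X.act_star, Y.act_star]

theorem extAct_cancel (X Y : StarRep G) (u : X.K ⊗[ℂ] Y.K) (h : ∀ x, X.extAct Y x u = 0) :
    u = 0 :=
  cancel_of_star _ _ (X.extAct_nondeg Y) (X.extAct_star Y) u h

/-- The action of `A` on `K ⊗ K'` by `(π ⊗ π')Δ(a)`, where `π ⊗ π'` is extended to
`M(A ⊗ A)`. -/
def tensorAct (X Y : StarRep G) : A →ₙₐ[ℂ] Module.End ℂ (X.K ⊗[ℂ] Y.K) :=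
  ((extendMult (X.extAct Y) (X.extAct_nondeg Y) (X.extAct_cancel Y) :
      Mult (A ⊗[ℂ] A) →ₐ[ℂ] _) : Mult (A ⊗[ℂ] A) →ₙₐ[ℂ] _).comp G.Δ.toNonUnitalAlgHom

theorem tensorAct_apply (X Y : StarRep G) (a : A) (x : A ⊗[ℂ] A) (v : X.K ⊗[ℂ] Y.K) :
    X.tensorAct Y a (X.extAct Y x v) = X.extAct Y ((G.Δ a).L x) v :=
  extendMult_apply (X.extAct Y) (X.extAct_nondeg Y) (X.extAct_cancel Y) (G.Δ a) x v

theorem extAct_mulRight (X Y : StarRep G) (b : A) (t : A ⊗[ℂ] A) (v : X.K) (w : Y.K) :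
    X.extAct Y ((LinearMap.mulRight ℂ b).rTensor A t) (v ⊗ₜ w) =
      X.extAct Y t (X.act b v ⊗ₜ w) := by
  induction t with
  | zero => simp
  | add s s' hs hs' => simp only [map_add, LinearMap.add_apply, hs, hs']
  | tmul p q => simp

theorem extAct_mulLeft (X Y : StarRep G) (a : A) (t : A ⊗[ℂ] A) (u : X.K ⊗[ℂ] Y.K) :
    X.extAct Y ((LinearMap.mulLeft ℂ a).rTensor A t) u =
      (X.act a).rTensor Y.K (X.extAct Y t u) := by
  induction t with
  | zero => simp
  | add s s' hs hs' => simp only [map_add, LinearMap.add_apply, hs, hs']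
  | tmul p q =>
    induction u with
    | zero => simp
    | add s s' hs hs' => simp only [map_add, hs, hs']
    | tmul p q => simp

/-- `(π × π')(a)(v ⊗ π'(c)w) = (π ⊗ π')(Δ(a)(1 ⊗ c))(v ⊗ w)`. -/
theorem tensorAct_right (X Y : StarRep G) (a c : A) (v : X.K) (w : Y.K) :
    X.tensorAct Y a (v ⊗ₜ Y.act c w) = X.extAct Y (G.T₁ (a ⊗ₜ c)) (v ⊗ₜ w) := by
  have : X.tensorAct Y a ∘ₗ (TensorProduct.mk ℂ X.K Y.K).flip (Y.act c w) =
      X.extAct Y (G.T₁ (a ⊗ₜ c)) ∘ₗ (TensorProduct.mk ℂ X.K Y.K).flip w := by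
    refine ext_on_act X.act X.nondeg fun b v => ?_
    have h1 : X.act b v ⊗ₜ[ℂ] Y.act c w = X.extAct Y (b ⊗ₜ c) (v ⊗ₜ w) := by simp
    simp only [LinearMap.comp_apply, LinearMap.flip_apply, TensorProduct.mk_apply]
    rw [h1, tensorAct_apply, G.L_Δ_tmul', extAct_mulRight]
  exact LinearMap.congr_fun this v

/-- `(π(a) ⊗ 1)(π × π')(b) = (π ⊗ π')((a ⊗ 1)Δ(b))`. -/
theorem tensorAct_left (X Y : StarRep G) (a b : A) (u : X.K ⊗[ℂ] Y.K) :
    (X.act a).rTensor Y.K (X.tensorAct Y b u) = X.extAct Y (G.T₂ (a ⊗ₜ b)) u := by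
  have : (X.act a).rTensor Y.K ∘ₗ X.tensorAct Y b = X.extAct Y (G.T₂ (a ⊗ₜ b)) := by
    refine ext_on_act (X.extAct Y) (X.extAct_nondeg Y) fun x v => ?_
    rw [LinearMap.comp_apply, tensorAct_apply, ← extAct_mulLeft, G.L_T₂, map_mul]
    rfl
  exact LinearMap.congr_fun this u

theorem tensorAct_nondeg (X Y : StarRep G) :
    Submodule.span ℂ {w | ∃ a v, X.tensorAct Y a v = w} = ⊤ := by
  rw [eq_top_iff, ← X.extAct_nondeg Y, Submodule.span_le]
  rintro _ ⟨x, v, rfl⟩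
  rw [SetLike.mem_coe]
  obtain ⟨t, rfl⟩ := G.T₁.surjective x
  induction t with
  | zero => simp
  | add s s' hs hs' => simp only [map_add, LinearMap.add_apply]; exact add_mem hs hs'
  | tmul a c =>
    induction v with
    | zero => simp
    | add s s' hs hs' => simp only [map_add]; exact add_mem hs hs'
    | tmul p q => exact Submodule.subset_span ⟨a, _, X.tensorAct_right Y a c p q⟩

/-- The tensor product `π × π'` of two representations. -/
@[reducible] def tensor (X Y : StarRep G) : StarRep G where
  K := X.K ⊗[ℂ] Y.K
  core := tensorCore X.core Y.core
  act := X.tensorAct Y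
  nondeg := X.tensorAct_nondeg Y
  act_star a u v := by
    have := extendMult_star (tensorCore X.core Y.core) (X.extAct Y) (X.extAct_nondeg Y)
      (X.extAct_cancel Y) (X.extAct_star Y) (G.Δ a) u v
    rw [← map_star] at this
    exact this

theorem ε_act_nondeg {K : Type u} [AddCommGroup K] [Module ℂ K] (G : AlgQuantumGroup A) :
    Submodule.span ℂ {w : K | ∃ a v, (G.ε a • (1 : Module.End ℂ K)) v = w} = ⊤ := by
  obtain ⟨d, hd⟩ := G.exists_ε_one
  rw [eq_top_iff]
  intro v _
  exact Submodule.subset_span ⟨d, v, by simp [hd]⟩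

/-- The action `a ↦ ε(a)1` on a vector space. -/
def scalarAct (G : AlgQuantumGroup A) (K : Type u) [AddCommGroup K] [Module ℂ K] :
    A →ₙₐ[ℂ] Module.End ℂ K where
  toFun a := G.ε a • 1
  map_smul' c a := by simp [smul_smul]
  map_zero' := by simp
  map_add' := by simp [add_smul]
  map_mul' a b := by simp [smul_smul, mul_comm]

/-- The representation by multiples of the identity `a ↦ ε(a)1` on a pre-Hilbert space. -/
@[reducible] def scalarRep (G : AlgQuantumGroup A) (K : Type u) [AddCommGroup K] [Module ℂ K]
    (c : InnerProductSpace.Core ℂ K) : StarRep G where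
  K := K
  core := c
  act := scalarAct G K
  nondeg := ε_act_nondeg G
  act_star a u v := by
    have h : coreForm c (G.ε a • u) v = coreForm c u (G.ε (star a) • v) := by
      simp [map_star]
    exact h

/-- The trivial representation `ε` on `ℂ`, the tensor unit. -/
@[reducible] def unit (G : AlgQuantumGroup A) : StarRep G := scalarRep G (ULift.{u} ℂ) lineCore

/-- The representation `I_θ`. -/
@[reducible] def triv (X : StarRep G) : StarRep G := scalarRep G X.K X.core

/-- The tensor product of arrows. -/
def tensorMap {X X' Y Y' : StarRep G} (f : X ⟶ X') (g : Y ⟶ Y') :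
    X.tensor Y ⟶ X'.tensor Y' where
  lin := TensorProduct.map f.lin g.lin
  comm a v := by
    have h0 : ∀ x v, TensorProduct.map f.lin g.lin (X.extAct Y x v) =
        X'.extAct Y' x (TensorProduct.map f.lin g.lin v) := by
      intro x v
      induction x with
      | zero => simp
      | add s s' hs hs' => simp only [map_add, LinearMap.add_apply, hs, hs']
      | tmul p q =>
        induction v with
        | zero => simp
        | add s s' hs hs' => simp only [map_add, hs, hs']
        | tmul r s => simp [f.comm, g.comm]
    have : TensorProduct.map f.lin g.lin ∘ₗ X.tensorAct Y a =
        X'.tensorAct Y' a ∘ₗ TensorProduct.map f.lin g.lin := by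
      refine ext_on_act (X.extAct Y) (X.extAct_nondeg Y) fun x v => ?_
      rw [LinearMap.comp_apply, LinearMap.comp_apply, tensorAct_apply, h0, h0, tensorAct_apply]
    exact LinearMap.congr_fun this v

theorem assoc_comm (X Y Z : StarRep G) (b : A) (u : (X.K ⊗[ℂ] Y.K) ⊗[ℂ] Z.K) :
    TensorProduct.assoc ℂ X.K Y.K Z.K ((X.tensor Y).tensorAct Z b u) =
      X.tensorAct (Y.tensor Z) b (TensorProduct.assoc ℂ X.K Y.K Z.K u) := by
  let ev : ∀ (W : StarRep G), W.K → A →ₗ[ℂ] W.K := fun W w =>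
    (LinearMap.applyₗ w : Module.End ℂ W.K →ₗ[ℂ] W.K) ∘ₗ (W.act : A →ₗ[ℂ] Module.End ℂ W.K)
  have ev_apply : ∀ (W : StarRep G) (w : W.K) a, ev W w a = W.act a w := fun _ _ _ => rfl
  have key : ∀ a (x : X.K) (y : Y.K) (c : A) (z : Z.K),
      (X.act a).rTensor (Y.K ⊗[ℂ] Z.K) (TensorProduct.assoc ℂ X.K Y.K Z.K
        ((X.tensor Y).tensorAct Z b ((x ⊗ₜ y) ⊗ₜ Z.act c z))) =
      (X.act a).rTensor (Y.K ⊗[ℂ] Z.K) (X.tensorAct (Y.tensor Z) b (x ⊗ₜ (y ⊗ₜ Z.act c z))) := by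
    intro a x y c z
    let Ψ : A ⊗[ℂ] (A ⊗[ℂ] A) →ₗ[ℂ] X.K ⊗[ℂ] (Y.K ⊗[ℂ] Z.K) :=
      TensorProduct.map (ev X x) (TensorProduct.map (ev Y y) (ev Z z))
    have e1 : ∀ s : A ⊗[ℂ] A, (X.act a).rTensor (Y.K ⊗[ℂ] Z.K) (TensorProduct.assoc ℂ X.K Y.K Z.K
        ((X.tensor Y).extAct Z s ((x ⊗ₜ y) ⊗ₜ z))) = Ψ (G.P (a ⊗ₜ s)) := by
      intro s
      induction s with
      | zero => simp
      | add s s' hs hs' => simp only [map_add, LinearMap.add_apply, tmul_add, hs, hs']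
      | tmul q r =>
        have h1 : G.P (a ⊗ₜ (q ⊗ₜ r)) = TensorProduct.assoc ℂ A A A (G.T₂ (a ⊗ₜ q) ⊗ₜ r) := rfl
        rw [h1, extAct_tmul, TensorProduct.map_tmul]
        have h2 : ∀ w : X.K ⊗[ℂ] Y.K, (X.act a).rTensor (Y.K ⊗[ℂ] Z.K)
            (TensorProduct.assoc ℂ X.K Y.K Z.K (w ⊗ₜ Z.act r z)) =
            TensorProduct.assoc ℂ X.K Y.K Z.K ((X.act a).rTensor Y.K w ⊗ₜ Z.act r z) := by
          intro w
          induction w with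
          | zero => simp
          | add s s' hs hs' => simp only [map_add, add_tmul, hs, hs']
          | tmul p q => simp
        refine (h2 _).trans ?_
        rw [tensorAct_left]
        generalize G.T₂ (a ⊗ₜ q) = t
        induction t with
        | zero => simp
        | add s s' hs hs' => simp only [map_add, LinearMap.add_apply, add_tmul, hs, hs']
        | tmul p q => simp [Ψ, ev_apply]
    have e2 : ∀ s : A ⊗[ℂ] A, X.extAct (Y.tensor Z) s (x ⊗ₜ (y ⊗ₜ Z.act c z)) =
        Ψ (G.Q (TensorProduct.assoc ℂ A A A (s ⊗ₜ c))) := by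
      intro s
      induction s with
      | zero => simp
      | add s s' hs hs' => simp only [map_add, LinearMap.add_apply, add_tmul, hs, hs']
      | tmul p q =>
        have h1 : G.Q (TensorProduct.assoc ℂ A A A ((p ⊗ₜ q) ⊗ₜ c)) = p ⊗ₜ G.T₁ (q ⊗ₜ c) := rfl
        rw [h1, extAct_tmul, TensorProduct.map_tmul]
        have h2 := tensorAct_right Y Z q c y z
        refine (congrArg (fun w => X.act p x ⊗ₜ[ℂ] w) h2).trans ?_
        generalize G.T₁ (q ⊗ₜ c) = t
        induction t with
        | zero => simp
        | add s s' hs hs' => simp only [map_add, LinearMap.add_apply, tmul_add, hs, hs']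
        | tmul p q => simp [Ψ, ev_apply]
    have e3 := tensorAct_left X (Y.tensor Z) a b (x ⊗ₜ (y ⊗ₜ Z.act c z))
    have e4 := tensorAct_right (X.tensor Y) Z b c (x ⊗ₜ y) z
    have e5 := congrArg Ψ (G.P_Q (a ⊗ₜ (b ⊗ₜ c)))
    refine (congrArg (fun w => (X.act a).rTensor (Y.K ⊗[ℂ] Z.K)
      (TensorProduct.assoc ℂ X.K Y.K Z.K w)) e4).trans ((e1 _).trans (e5.trans ?_))
    exact (e2 _).symm.trans e3.symm
  have h : (TensorProduct.assoc ℂ X.K Y.K Z.K).toLinearMap ∘ₗ (X.tensor Y).tensorAct Z b =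
      X.tensorAct (Y.tensor Z) b ∘ₗ (TensorProduct.assoc ℂ X.K Y.K Z.K).toLinearMap := by
    refine TensorProduct.ext (TensorProduct.ext ?_)
    ext x y : 2
    refine ext_on_act Z.act Z.nondeg fun c z => ?_
    rw [← sub_eq_zero]
    refine rTensor_joint_inj (fun a => X.act a) X.cancel _ fun a => ?_
    rw [map_sub, sub_eq_zero]
    exact key a x y c z
  exact LinearMap.congr_fun h u

theorem lid_comm (X : StarRep G) (b : A) (u : ULift.{u} ℂ ⊗[ℂ] X.K) :
    TensorProduct.lid ℂ X.K (ULift.moduleEquiv.toLinearMap.rTensor X.K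
      ((unit G).tensorAct X b u)) =
    X.act b (TensorProduct.lid ℂ X.K (ULift.moduleEquiv.toLinearMap.rTensor X.K u)) := by
  have h : (TensorProduct.lid ℂ X.K).toLinearMap ∘ₗ ULift.moduleEquiv.toLinearMap.rTensor X.K ∘ₗ
      (unit G).tensorAct X b = X.act b ∘ₗ (TensorProduct.lid ℂ X.K).toLinearMap ∘ₗ
        (ULift.moduleEquiv : ULift.{u} ℂ ≃ₗ[ℂ] ℂ).toLinearMap.rTensor X.K := by
    refine TensorProduct.ext ?_
    ext z : 1
    refine ext_on_act X.act X.nondeg fun c v => ?_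
    have e1 := tensorAct_right (unit G) X b c z v
    have e2 : ∀ t : A ⊗[ℂ] A, TensorProduct.lid ℂ X.K (ULift.moduleEquiv.toLinearMap.rTensor X.K
        ((unit G).extAct X t (z ⊗ₜ v))) = z.down • X.act (sliceL (G.ε : A →ₗ[ℂ] ℂ) t) v := by
      intro t
      induction t with
      | zero => simp
      | add s s' hs hs' => simp only [map_add, LinearMap.add_apply, smul_add, hs, hs']
      | tmul p q =>
        change TensorProduct.lid ℂ X.K (ULift.moduleEquiv.toLinearMap.rTensor X.K
          ((G.ε p • (z : ULift.{u} ℂ)) ⊗ₜ X.act q v)) = _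
        simp [smul_smul, mul_comm]
    have e3 := e2 (G.T₁ (b ⊗ₜ c))
    rw [G.sliceL_ε, ← e1] at e3
    refine e3.trans ?_
    simp
  exact LinearMap.congr_fun h u

theorem rid_comm (X : StarRep G) (b : A) (u : X.K ⊗[ℂ] ULift.{u} ℂ) :
    TensorProduct.rid ℂ X.K (ULift.moduleEquiv.toLinearMap.lTensor X.K
      (X.tensorAct (unit G) b u)) =
    X.act b (TensorProduct.rid ℂ X.K (ULift.moduleEquiv.toLinearMap.lTensor X.K u)) := by
  rw [← sub_eq_zero]
  refine X.cancel _ fun a => ?_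
  rw [map_sub, sub_eq_zero]
  have e1 := tensorAct_left X (unit G) a b u
  have e0 : ∀ w : X.K ⊗[ℂ] ULift.{u} ℂ,
      X.act a (TensorProduct.rid ℂ X.K (ULift.moduleEquiv.toLinearMap.lTensor X.K w)) =
      TensorProduct.rid ℂ X.K (ULift.moduleEquiv.toLinearMap.lTensor X.K
        ((X.act a).rTensor (ULift.{u} ℂ) w)) := by
    intro w
    induction w with
    | zero => simp
    | add s s' hs hs' => simp only [map_add, hs, hs']
    | tmul p q => simp
  have e2 : ∀ (u : X.K ⊗[ℂ] ULift.{u} ℂ) (t : A ⊗[ℂ] A),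
      TensorProduct.rid ℂ X.K (ULift.moduleEquiv.toLinearMap.lTensor X.K
        (X.extAct (unit G) t u)) = X.act (sliceR (G.ε : A →ₗ[ℂ] ℂ) t)
          (TensorProduct.rid ℂ X.K (ULift.moduleEquiv.toLinearMap.lTensor X.K u)) := by
    intro u t
    induction t with
    | zero => simp
    | add s s' hs hs' => simp only [map_add, LinearMap.add_apply, hs, hs']
    | tmul p q =>
      induction u with
      | zero => simp
      | add s s' hs hs' => simp only [map_add, hs, hs']
      | tmul x z =>
        change TensorProduct.rid ℂ X.K (ULift.moduleEquiv.toLinearMap.lTensor X.K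
          (X.act p x ⊗ₜ (G.ε q • z))) = _
        simp [smul_smul, mul_comm]
  have e3 := e2 u (G.T₂ (a ⊗ₜ b))
  rw [G.sliceR_ε, ← e1] at e3
  refine (e0 _).trans (e3.trans ?_)
  simp

open MonoidalCategory

instance : MonoidalCategoryStruct (StarRep G) where
  tensorObj := tensor
  whiskerLeft X _ _ f := tensorMap (𝟙 X) f
  whiskerRight f Y := tensorMap f (𝟙 Y)
  tensorHom := tensorMap
  tensorUnit := unit G
  associator X Y Z := isoMk (TensorProduct.assoc ℂ X.K Y.K Z.K) (assoc_comm X Y Z)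
  leftUnitor X := isoMk (LinearEquiv.rTensor X.K ULift.moduleEquiv ≪≫ₗ TensorProduct.lid ℂ X.K)
    (lid_comm X)
  rightUnitor X := isoMk (LinearEquiv.lTensor X.K ULift.moduleEquiv ≪≫ₗ TensorProduct.rid ℂ X.K)
    (rid_comm X)

/-- The tensor category `Rep(A, Δ)`. -/
instance : MonoidalCategory (StarRep G) where
  tensorHom_def f g := by
    apply hom_ext
    exact TensorProduct.ext' fun _ _ => rfl
  id_tensorHom_id X Y := by
    apply hom_ext
    exact TensorProduct.ext' fun _ _ => rfl
  tensorHom_comp_tensorHom f g h k := by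
    apply hom_ext
    exact TensorProduct.ext' fun _ _ => rfl
  whiskerLeft_id X Y := by
    apply hom_ext
    exact TensorProduct.ext' fun _ _ => rfl
  id_whiskerRight X Y := by
    apply hom_ext
    exact TensorProduct.ext' fun _ _ => rfl
  associator_naturality f g h := by
    apply hom_ext
    exact TensorProduct.ext_threefold fun _ _ _ => rfl
  leftUnitor_naturality f := by
    apply hom_ext
    refine TensorProduct.ext' fun z v => ?_
    exact (map_smul f.lin (ULift.moduleEquiv (R := ℂ) z) v).symm
  rightUnitor_naturality f := by
    apply hom_ext
    refine TensorProduct.ext' fun v z => ?_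
    exact (map_smul f.lin (ULift.moduleEquiv (R := ℂ) z) v).symm
  pentagon W X Y Z := by
    apply hom_ext
    exact TensorProduct.ext_fourfold fun _ _ _ _ => rfl
  triangle X Y := by
    apply hom_ext
    refine TensorProduct.ext_threefold fun v z w => ?_
    exact (TensorProduct.smul_tmul (ULift.moduleEquiv (R := ℂ) z) v w).symm

end StarRep

namespace AlgQuantumGroup

variable (G : AlgQuantumGroup A)

open scoped ComplexOrder in
theorem φ_hermitian (a b : A) : conj (G.φ (star b * a)) = G.φ (star a * b) := by
  have im0 : ∀ c, (G.φ (star c * c)).im = 0 := fun c => (Complex.le_def.1 (G.φ_pos c)).2.symm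
  have h1 := im0 (a + b)
  have h2 := im0 (a + Complex.I • b)
  have ha := im0 a
  have hb := im0 b
  simp only [star_add, star_smul, add_mul, mul_add, map_add, smul_mul_assoc, mul_smul_comm,
    map_smul, Complex.add_im, ha, hb, smul_eq_mul, Complex.mul_im, Complex.I_re, Complex.I_im,
    Complex.star_def, Complex.conj_re, Complex.conj_im, Complex.mul_re] at h1 h2
  apply Complex.ext
  · rw [Complex.conj_re]; linarith
  · rw [Complex.conj_im]; linarith

open scoped ComplexOrder in
/-- The inner product `φ(x* y)` of `A`. -/
@[reducible] def regCore : InnerProductSpace.Core ℂ A :=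
  let c : PreInnerProductSpace.Core ℂ A :=
    { inner := fun x y => G.φ (star x * y)
      conj_inner_symm := fun x y => G.φ_hermitian x y
      re_inner_nonneg := fun x => (Complex.le_def.1 (G.φ_pos x)).1
      add_left := fun x y z => by simp [add_mul]
      smul_left := fun x y r => by simp [smul_mul_assoc] }
  { c with
    definite := fun x hx => by
      refine G.φ_faithful x fun b => ?_
      have h := InnerProductSpace.Core.inner_mul_inner_self_le (𝕜 := ℂ) (c := c) (star b) x
      have hx' : c.inner x x = 0 := hx
      have h' : ‖c.inner (star b) x‖ * ‖c.inner x (star b)‖ ≤ 0 := by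
        refine h.trans ?_
        change _ * RCLike.re (c.inner x x) ≤ 0
        rw [hx']; simp
      have h2 : ‖c.inner x (star b)‖ = ‖c.inner (star b) x‖ := by
        rw [← c.conj_inner_symm, RCLike.norm_conj]
      rw [h2] at h'
      have h3 : ‖c.inner (star b) x‖ = 0 := by nlinarith [norm_nonneg (c.inner (star b) x)]
      have h4 : G.φ (star (star b) * x) = 0 := norm_eq_zero.1 h3
      simpa using h4 }

theorem regCore_apply (x y : A) : G.regCore.inner x y = G.φ (star x * y) := rfl

/-- The left regular representation `π_l(a)x = ax` on `A` with the inner product `φ(x* y)`. -/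
@[reducible] def piL : StarRep G where
  K := A
  core := G.regCore
  act := NonUnitalAlgHom.lmul ℂ A
  nondeg := by
    rw [eq_top_iff]
    rintro a -
    obtain ⟨d, hd⟩ := G.exists_ε_one
    have h : ∀ t : A ⊗[ℂ] A, sliceR (G.ε : A →ₗ[ℂ] ℂ) (G.T₂ t) ∈
        Submodule.span ℂ {w | ∃ a v, NonUnitalAlgHom.lmul ℂ A a v = w} := by
      intro t
      induction t with
      | zero => simp
      | add s s' hs hs' => simp only [map_add]; exact add_mem hs hs'
      | tmul a b => exact Submodule.subset_span ⟨a, b, (G.sliceR_ε a b).symm⟩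
    have := h (G.T₂.symm (a ⊗ₜ d))
    simpa [hd] using this
  act_star a u v := by
    change G.φ (star (a * u) * v) = G.φ (star u * (star a * v))
    rw [star_mul, mul_assoc]

/-- `(A, Δ)` is discrete: there is a non-zero left integral in `A`. -/
def IsDiscrete : Prop := ∃ h : A, h ≠ 0 ∧ ∀ a, a * h = G.ε a • h

/-- The map `a ↦ aφ = φ(· a)` from `A` to its linear dual. -/
def fourierMap : A →ₗ[ℂ] Module.Dual ℂ A where
  toFun a := G.φ ∘ₗ LinearMap.mulRight ℂ a
  map_add' a b := by ext c; simp [mul_add]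
  map_smul' r a := by ext c; simp [mul_smul_comm]

@[simp] theorem fourierMap_apply (a c : A) : G.fourierMap a c = G.φ (c * a) := rfl

/-- The space `Â = {aφ : a ∈ A}` of the dual quantum group. -/
def dual : Submodule ℂ (Module.Dual ℂ A) := LinearMap.range G.fourierMap

/-- The Fourier transform `F(a) = aφ`, a bijection from `A` to `Â`. -/
def fourier : A ≃ₗ[ℂ] G.dual :=
  LinearEquiv.ofInjective G.fourierMap
    ((injective_iff_map_eq_zero _).2 fun a ha => G.φ_faithful a fun b => LinearMap.congr_fun ha b)

/-- `c ↦ (φ ⊗ φ)(Δ(c)t)` for `t ∈ A ⊗ A`. -/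
def dualMulAux : A ⊗[ℂ] A →ₗ[ℂ] Module.Dual ℂ A where
  toFun t :=
    { toFun := fun c => G.φ (sliceR G.φ ((G.Δ c).L t))
      map_add' := by simp
      map_smul' := by simp }
  map_add' s t := by ext c; simp
  map_smul' r t := by ext c; simp

@[simp] theorem dualMulAux_apply (t : A ⊗[ℂ] A) (c : A) :
    G.dualMulAux t c = G.φ (sliceR G.φ ((G.Δ c).L t)) := rfl

theorem dualMulAux_mem (t : A ⊗[ℂ] A) : G.dualMulAux t ∈ G.dual := by
  have ht := G.span_T₃ t
  induction ht using Submodule.span_induction with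
  | zero => simp
  | add x y _ _ hx hy => rw [map_add]; exact add_mem hx hy
  | smul a x _ hx => rw [map_smul]; exact Submodule.smul_mem _ _ hx
  | mem s h =>
    obtain ⟨y, x, rfl⟩ := h
    refine ⟨G.φ x • y, ?_⟩
    ext c
    have h1 : (G.Δ c).L (G.T₃ y x) = G.T₃ (c * y) x := by
      rw [← sub_eq_zero]
      refine tensor_nondeg G _ fun z => ?_
      rw [sub_mul, sub_eq_zero, ← Mult.L_mul, ← L_T₃, ← L_T₃, map_mul, Mult.L_mul']
    simp [h1, φ_left_invariant', mul_comm]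

/-- The multiplication `m̂(ω ⊗ ω') = (ω ⊗ ω')Δ` of `Â`. For `ω = aφ` and `ω' = bφ`, the functional
`(ω ⊗ ω')Δ` is `c ↦ (φ ⊗ φ)(Δ(c)(a ⊗ b))`. -/
def dualMul : G.dual ⊗[ℂ] G.dual →ₗ[ℂ] G.dual :=
  (G.dualMulAux.codRestrict G.dual G.dualMulAux_mem) ∘ₗ
    TensorProduct.map G.fourier.symm.toLinearMap G.fourier.symm.toLinearMap

/-- The map `m̃ = F⁻¹ m̂ (F ⊗ F)`. -/
def mTilde : A ⊗[ℂ] A →ₗ[ℂ] A :=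
  G.fourier.symm.toLinearMap ∘ₗ G.dualMul ∘ₗ
    TensorProduct.map G.fourier.toLinearMap G.fourier.toLinearMap

/-- `φ(c m̃(t)) = (φ ⊗ φ)(Δ(c)t)`. -/
theorem φ_mul_mTilde (c : A) (t : A ⊗[ℂ] A) :
    G.φ (c * G.mTilde t) = G.φ (sliceR G.φ ((G.Δ c).L t)) := by
  have h1 : (G.fourier (G.mTilde t) : Module.Dual ℂ A) c = G.φ (c * G.mTilde t) := rfl
  have h2 : TensorProduct.map G.fourier.symm.toLinearMap G.fourier.symm.toLinearMap
      (TensorProduct.map G.fourier.toLinearMap G.fourier.toLinearMap t) = t := by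
    induction t with
    | zero => simp
    | add s s' hs hs' => simp only [map_add]; rw [hs, hs'] <;> rfl
    | tmul a b => simp
  rw [← h1, mTilde, LinearMap.comp_apply, LinearEquiv.coe_coe, LinearEquiv.apply_symm_apply,
    dualMul, LinearMap.comp_apply, LinearMap.comp_apply, h2]
  rfl

end AlgQuantumGroup

namespace StarRep

open CategoryTheory MonoidalCategory

variable {G : AlgQuantumGroup A}

/-- The functor `θ ↦ I_θ`, the identity on underlying linear maps. -/
def trivFunctor (G : AlgQuantumGroup A) : StarRep G ⥤ StarRep G where
  obj X := X.triv
  map {X Y} f := ⟨f.lin, fun a v => map_smul f.lin (G.ε a) v⟩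

/-- The action of `A` on a direct sum of copies of `K`. -/
def copiesAct (I : Type u) (X : StarRep G) : A →ₙₐ[ℂ] Module.End ℂ (I →₀ X.K) where
  toFun a := Finsupp.mapRange.linearMap (X.act a)
  map_smul' c a := by ext; simp
  map_zero' := by ext; simp
  map_add' a b := by ext; simp
  map_mul' a b := by ext; simp

theorem copiesAct_apply (I : Type u) (X : StarRep G) (a : A) (f : I →₀ X.K) (i : I) :
    copiesAct I X a f i = X.act a (f i) := rfl

theorem copiesAct_single (I : Type u) (X : StarRep G) (a : A) (i : I) (v : X.K) :
    copiesAct I X a (Finsupp.single i v) = Finsupp.single i (X.act a v) :=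
  Finsupp.mapRange_single (hf := map_zero (X.act a))

/-- The direct sum of copies of `X` indexed by `I`. -/
@[reducible] def copies (I : Type u) (X : StarRep G) : StarRep G where
  K := I →₀ X.K
  core := finsuppCore I X.core
  act := copiesAct I X
  nondeg := by
    rw [eq_top_iff]
    rintro f -
    induction f using Finsupp.induction_linear with
    | zero => simp
    | add f g hf hg => exact add_mem hf hg
    | single i v =>
      have hv : v ∈ Submodule.span ℂ {w | ∃ b v, X.act b v = w} := X.nondeg ▸ Submodule.mem_top
      induction hv using Submodule.span_induction with
      | zero => simp
      | add x y _ _ hx hy => rw [Finsupp.single_add]; exact add_mem hx hy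
      | smul a x _ hx => rw [← Finsupp.smul_single]; exact Submodule.smul_mem _ _ hx
      | mem x h =>
        obtain ⟨a, v, rfl⟩ := h
        exact Submodule.subset_span ⟨a, Finsupp.single i v, copiesAct_single I X a i v⟩
  act_star a f g := by
    classical
    let _ := X.core
    rw [finsuppCore_apply, finsuppCore_apply]
    refine (Finsupp.sum_of_support_subset (s := f.support) (copiesAct I X a f) ?_ _
      fun i _ => InnerProductSpace.Core.inner_zero_left (𝕜 := ℂ) (g i)).trans ?_
    · intro i hi
      rw [Finsupp.mem_support_iff, copiesAct_apply] at hi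
      rw [Finsupp.mem_support_iff]
      exact fun h => hi (by rw [h, map_zero])
    · exact Finset.sum_congr rfl fun i _ => X.act_star a (f i) (g i)

/-- The linear map `a ↦ π(a)v`. -/
def orbit (X : StarRep G) (v : X.K) : A →ₗ[ℂ] X.K :=
  (X.act : A →ₗ[ℂ] Module.End ℂ X.K).flip v

@[simp] theorem orbit_apply (X : StarRep G) (v : X.K) (a : A) : X.orbit v a = X.act a v := rfl

/-- An arrow is unitary if it is an isomorphism preserving the inner products. -/
def IsUnitary {X Y : StarRep G} (f : X ⟶ Y) : Prop :=
  IsIso f ∧ ∀ u v : X.K, Y.core.inner (f.lin u) (f.lin v) = X.core.inner u v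

/-- A subspace of `K` invariant under `A`. -/
def IsInvariant (X : StarRep G) (W : Submodule ℂ X.K) : Prop := ∀ a, ∀ w ∈ W, X.act a w ∈ W

/-- A finite dimensional irreducible subrepresentation. -/
def IsFinIrreducible (X : StarRep G) (W : Submodule ℂ X.K) : Prop :=
  X.IsInvariant W ∧ Module.Finite ℂ W ∧ W ≠ ⊥ ∧
    ∀ W' ≤ W, X.IsInvariant W' → W' = ⊥ ∨ W' = W

/-- Equivalence of two subrepresentations. -/
def SubEquiv (X : StarRep G) (W W' : Submodule ℂ X.K) : Prop :=
  ∃ e : W ≃ₗ[ℂ] W', ∀ (a : A) (w v : W), (v : X.K) = X.act a w → (e v : X.K) = X.act a (e w)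

/-- The objects of `Rep_*(A, Δ)`: direct sums of finite dimensional irreducible
`*`-representations, each equivalence class occurring with finite multiplicity. -/
def repStar (G : AlgQuantumGroup A) : ObjectProperty (StarRep G) := fun X =>
  ∃ (I : Type u) (W : I → Submodule ℂ X.K), (∀ i, X.IsFinIrreducible (W i)) ∧ iSupIndep W ∧
    ⨆ i, W i = ⊤ ∧ ∀ i, {j | X.SubEquiv (W i) (W j)}.Finite

/-- A `*`-operation on the full subcategory of `Rep(A, Δ)` given by `P`: a contravariant, antilinear
and involutive operation on arrows, the identity on objects, compatible with the inner products. -/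
structure StarOperation (P : ObjectProperty (StarRep G)) where
  /-- The adjoint of an arrow. -/
  adj : ∀ {X Y : StarRep G}, P X → P Y → (X ⟶ Y) → (Y ⟶ X)
  adj_id : ∀ {X : StarRep G} (hX : P X), adj hX hX (𝟙 X) = 𝟙 X
  adj_comp : ∀ {X Y Z : StarRep G} (hX : P X) (hY : P Y) (hZ : P Z) (s : X ⟶ Y) (t : Y ⟶ Z),
    adj hX hZ (s ≫ t) = adj hY hZ t ≫ adj hX hY s
  adj_adj : ∀ {X Y : StarRep G} (hX : P X) (hY : P Y) (s : X ⟶ Y), adj hY hX (adj hX hY s) = s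
  adj_linear : ∀ {X Y : StarRep G} (hX : P X) (hY : P Y) (r s t : X ⟶ Y) (c : ℂ),
    r.lin = s.lin + c • t.lin →
      (adj hX hY r).lin = (adj hX hY s).lin + conj c • (adj hX hY t).lin
  inner_adj : ∀ {X Y : StarRep G} (hX : P X) (hY : P Y) (s : X ⟶ Y) (u : X.K) (v : Y.K),
    Y.core.inner (s.lin u) v = X.core.inner u ((adj hX hY s).lin v)

end StarRep

section Modules

open CategoryTheory MonoidalCategory

universe w

variable {C : Type*} [Category.{w} C] [MonoidalCategory C] {Q : C}

/-- `(Q, m)` is a semigroup: `m(m ⊗ id) = m(id ⊗ m)`. -/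
def IsSemigroupObj (m : Q ⊗ Q ⟶ Q) : Prop :=
  m ▷ Q ≫ m = (α_ Q Q Q).hom ≫ Q ◁ m ≫ m

/-- `(Q, m, η)` is a monoid. -/
def IsMonoidObj (m : Q ⊗ Q ⟶ Q) (η : 𝟙_ C ⟶ Q) : Prop :=
  IsSemigroupObj m ∧ η ▷ Q ≫ m = (λ_ Q).hom ∧ Q ◁ η ≫ m = (ρ_ Q).hom

/-- `(X, μ)` is a left module over the semigroup `(Q, m)`. -/
def IsLeftModule (m : Q ⊗ Q ⟶ Q) {X : C} (μ : Q ⊗ X ⟶ X) : Prop :=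
  m ▷ X ≫ μ = (α_ Q Q X).hom ≫ Q ◁ μ ≫ μ

/-- `(X, μ)` is a right module over the semigroup `(Q, m)`. -/
def IsRightModule (m : Q ⊗ Q ⟶ Q) {X : C} (μ : X ⊗ Q ⟶ X) : Prop :=
  μ ▷ Q ≫ μ = (α_ X Q Q).hom ≫ X ◁ m ≫ μ

/-- Morphisms of left modules. -/
def IsLeftModuleHom {X Y : C} (μ : Q ⊗ X ⟶ X) (ν : Q ⊗ Y ⟶ Y) (s : X ⟶ Y) : Prop :=
  μ ≫ s = Q ◁ s ≫ ν

/-- Morphisms of right modules. -/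
def IsRightModuleHom {X Y : C} (μ : X ⊗ Q ⟶ X) (ν : Y ⊗ Q ⟶ Y) (s : X ⟶ Y) : Prop :=
  μ ≫ s = s ▷ Q ≫ ν

/-- The action `m ⊗ id` on `Q ⊗ X`. -/
def leftAction (m : Q ⊗ Q ⟶ Q) (X : C) : Q ⊗ (Q ⊗ X) ⟶ Q ⊗ X := (α_ Q Q X).inv ≫ m ▷ X

/-- The action `id ⊗ m` on `X ⊗ Q`. -/
def rightAction (m : Q ⊗ Q ⟶ Q) (X : C) : (X ⊗ Q) ⊗ Q ⟶ X ⊗ Q := (α_ X Q Q).hom ≫ X ◁ m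

end Modules

end

open CategoryTheory MonoidalCategory

/-! The engine is the faithful left invariant functional φ. The product m̃ is characterised by φ(c
m̃(t)) = (φ ⊗ φ)(Δ(c)t), and left invariance gives φ ∘ m̃ = φ ⊗ φ. Moreover an arrow f into π_l is
determined by φ ∘ f, because φ(c f(u)) = φ(f(cu)); arrows into θ × π_l and π_l × θ are likewise
determined by their slices under φ (`hom_piL_ext`, `hom_tensor_piL_ext`, `hom_piL_tensor_ext`).
Associativity of m̃ and the module properties of the twists thereby become short computations with
slices.

Absorption comes from the twists v ⊗ x ↦ Δ(x)(v ⊗ 1) and x ⊗ v ↦ Δ(x)(1 ⊗ v). The first is isometric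
by left invariance (`inner_rightTwist`), hence injective. Injectivity of the second is obtained
without an antipode: coassociativity expresses the twist of θ × π_l through that of θ and `T₁`
(`leftTwist_tensor_piL`), while θ × π_l ≅ I_θ × π_l, whose twist is `T₁` itself up to a permutation
of legs. The second twist respects the left actions because x ↦ (φ ⊗ ι)(Δ(x)(1 ⊗ v)) is a left
invariant K-valued map, and every left invariant χ satisfies χ ∘ m̃ = φ ⊗ χ.

If h is a non-zero integral, φ(h)⁻¹h is the unit for m̃; conversely a unit arrow sends 1 to such an
integral. The functional (φ ⊗ ι)Δ is then φ times one operator δ on each representation, so the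
second twist distorts inner products exactly by δ. This δ is symmetric with positive eigenvalues and
diagonalisable, since each element of A lies in a finite dimensional left ideal. Precomposition with
δ^(-1/2) on the second leg makes the twist unitary.

The same left ideals make π_l locally finite, so it is a direct sum of finite dimensional
irreducibles. Multiplicities are finite because each bA is finite dimensional. In Rep_*, Schur's
lemma and finite multiplicity leave only finitely many summands pairing with a given irreducible, so
adjoints exist by the Riesz lemma in finite dimension (`exists_adjoint`). -/

noncomputable section TensorSquare

/-! ### Slices of tensors by linear functionals, and joint injectivity. -/

section Slices

variable {M N M' : Type*} [AddCommGroup M] [Module ℂ M] [AddCommGroup N] [Module ℂ N]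
  [AddCommGroup M'] [Module ℂ M']

/-- The slice map `id ⊗ f : M ⊗ N → M`. -/
def rightSlice (M : Type*) [AddCommGroup M] [Module ℂ M] (f : N →ₗ[ℂ] ℂ) : M ⊗[ℂ] N →ₗ[ℂ] M :=
  (TensorProduct.rid ℂ M).toLinearMap ∘ₗ f.lTensor M

/-- The slice map `f ⊗ id : N ⊗ M → M`. -/
def leftSlice (M : Type*) [AddCommGroup M] [Module ℂ M] (f : N →ₗ[ℂ] ℂ) : N ⊗[ℂ] M →ₗ[ℂ] M :=
  (TensorProduct.lid ℂ M).toLinearMap ∘ₗ f.rTensor M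

@[simp] theorem rightSlice_tmul (f : N →ₗ[ℂ] ℂ) (m : M) (n : N) :
    rightSlice M f (m ⊗ₜ n) = f n • m := by simp [rightSlice]

@[simp] theorem leftSlice_tmul (f : N →ₗ[ℂ] ℂ) (m : M) (n : N) :
    leftSlice M f (n ⊗ₜ m) = f n • m := by simp [leftSlice]

theorem rightSlice_rTensor (f : N →ₗ[ℂ] ℂ) (g : M →ₗ[ℂ] M') (t : M ⊗[ℂ] N) :
    rightSlice M' f (g.rTensor N t) = g (rightSlice M f t) := by
  induction t with
  | zero => simp
  | add s s' hs hs' => simp only [map_add, hs, hs']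
  | tmul m n => simp

theorem leftSlice_lTensor (f : N →ₗ[ℂ] ℂ) (g : M →ₗ[ℂ] M') (t : N ⊗[ℂ] M) :
    leftSlice M' f (g.lTensor N t) = g (leftSlice M f t) := by
  induction t with
  | zero => simp
  | add s s' hs hs' => simp only [map_add, hs, hs']
  | tmul m n => simp

theorem rightSlice_lTensor (f : N →ₗ[ℂ] ℂ) (g : M' →ₗ[ℂ] N) (t : M ⊗[ℂ] M') :
    rightSlice M f (g.lTensor M t) = rightSlice M (f ∘ₗ g) t := by
  induction t with
  | zero => simp
  | add s s' hs hs' => simp only [map_add, hs, hs']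
  | tmul m n => simp

theorem leftSlice_rTensor (f : N →ₗ[ℂ] ℂ) (g : M' →ₗ[ℂ] N) (t : M' ⊗[ℂ] M) :
    leftSlice M f (g.rTensor M t) = leftSlice M (f ∘ₗ g) t := by
  induction t with
  | zero => simp
  | add s s' hs hs' => simp only [map_add, hs, hs']
  | tmul m n => simp

theorem eq_zero_of_rightSlice {ι : Type*} (f : ι → N →ₗ[ℂ] ℂ)
    (hf : ∀ n, (∀ i, f i n = 0) → n = 0) (t : M ⊗[ℂ] N) (h : ∀ i, rightSlice M (f i) t = 0) :
    t = 0 :=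
  lTensor_joint_inj f hf t fun i =>
    (TensorProduct.rid ℂ M).injective ((h i).trans (map_zero _).symm)

theorem eq_zero_of_leftSlice {ι : Type*} (f : ι → N →ₗ[ℂ] ℂ)
    (hf : ∀ n, (∀ i, f i n = 0) → n = 0) (t : N ⊗[ℂ] M) (h : ∀ i, leftSlice M (f i) t = 0) :
    t = 0 :=
  rTensor_joint_inj f hf t fun i =>
    (TensorProduct.lid ℂ M).injective ((h i).trans (map_zero _).symm)

/-- A linear map prescribed after composition with a jointly injective family exists as soon as its
values exist on a spanning set. -/
theorem exists_lift_of_joint_inj {ι V : Type*} [AddCommGroup V] [Module ℂ V]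
    (r : ι → M →ₗ[ℂ] M') (hr : ∀ m, (∀ i, r i m = 0) → m = 0) (g : ι → V →ₗ[ℂ] M')
    {s : Set V} (hs : Submodule.span ℂ s = ⊤) (h : ∀ v ∈ s, ∃ m, ∀ i, r i m = g i v) :
    ∃ T : V →ₗ[ℂ] M, ∀ i v, r i (T v) = g i v := by
  have h1 : ∀ v, ∃ m, ∀ i, r i m = g i v := by
    intro v
    have hv : v ∈ Submodule.span ℂ s := hs ▸ Submodule.mem_top
    induction hv using Submodule.span_induction with
    | mem x hx => exact h x hx
    | zero => exact ⟨0, fun i => by simp⟩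
    | add x y _ _ hx hy =>
      obtain ⟨m, hm⟩ := hx
      obtain ⟨n, hn⟩ := hy
      exact ⟨m + n, fun i => by rw [map_add, map_add, hm, hn]⟩
    | smul c x _ hx =>
      obtain ⟨m, hm⟩ := hx
      exact ⟨c • m, fun i => by rw [map_smul, map_smul, hm]⟩
  choose T hT using h1
  have huniq : ∀ m n, (∀ i, r i m = r i n) → m = n := fun m n hmn =>
    sub_eq_zero.1 (hr _ fun i => by rw [map_sub, hmn, sub_self])
  exact ⟨{ toFun := T
           map_add' := fun x y => huniq _ _ fun i => by simp only [map_add, hT]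
           map_smul' := fun c x => huniq _ _ fun i => by simp [hT] }, fun i v => hT v i⟩

end Slices

/-! ### The product m̃, left invariant maps and integrals. -/

namespace AlgQuantumGroup

variable {A : Type u} [NonUnitalRing A] [StarRing A] [Module ℂ A]
  [IsScalarTower ℂ A A] [SMulCommClass ℂ A A] [StarModule ℂ A] (G : AlgQuantumGroup A)

/-- The element `(1 ⊗ a)Δ(b)` of `A ⊗ A`. -/
def T₄ (a b : A) : A ⊗[ℂ] A := star (G.T₁ (star b ⊗ₜ star a))

theorem T₄_mul (a b : A) (x : A ⊗[ℂ] A) :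
    G.T₄ a b * x = (LinearMap.mulLeft ℂ a).lTensor A ((G.Δ b).L x) := by
  have h := G.R_T₁ (star b) (star a) (star x)
  rw [map_star G.Δ, Mult.R_star, star_star] at h
  have h' := congrArg star h
  rw [star_mul, star_star] at h'
  rw [T₄, ← h']
  generalize (G.Δ b).L x = z
  induction z with
  | zero => simp
  | add s s' hs hs' => simp only [map_add, star_add, hs, hs']
  | tmul c d => simp

theorem span_T₄ (t : A ⊗[ℂ] A) : t ∈ Submodule.span ℂ {s | ∃ a b, G.T₄ a b = s} := by
  obtain ⟨w, hw⟩ := G.T₁.surjective (star t)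
  have : t = star (G.T₁ w) := by rw [hw, star_star]
  rw [this]
  clear hw this
  induction w with
  | zero => simp
  | add s s' hs hs' => rw [map_add, star_add]; exact add_mem hs hs'
  | tmul a b => exact Submodule.subset_span ⟨star b, star a, by simp [T₄]⟩

theorem L_Δ_T₃ (c y x : A) : (G.Δ c).L (G.T₃ y x) = G.T₃ (c * y) x := by
  rw [← sub_eq_zero]
  refine tensor_nondeg G _ fun z => ?_
  rw [sub_mul, sub_eq_zero, ← Mult.L_mul, ← L_T₃, ← L_T₃, map_mul, Mult.L_mul']

theorem eq_of_φ_mul {x y : A} (h : ∀ c, G.φ (c * x) = G.φ (c * y)) : x = y :=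
  sub_eq_zero.1 (G.φ_faithful _ fun c => by rw [mul_sub, map_sub, h, sub_self])

/-- Since Δ(c)Δ(y)(x ⊗ 1) = Δ(cy)(x ⊗ 1), left invariance evaluates the pairing with c as φ(x)φ(cy).
The elements Δ(y)(x ⊗ 1) span A ⊗ A, so this describes m̃ completely. -/
theorem mTilde_T₃ (y x : A) : G.mTilde (G.T₃ y x) = G.φ x • y := by
  refine G.eq_of_φ_mul fun c => ?_
  rw [φ_mul_mTilde, L_Δ_T₃, φ_left_invariant']
  simp [mul_smul_comm, mul_comm]

/-- Paired with c, both sides become (φ ⊗ φ)(Δ(ca)t). This is the intertwining property of m̃. -/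
theorem mTilde_L_Δ (a : A) (t : A ⊗[ℂ] A) : G.mTilde ((G.Δ a).L t) = a * G.mTilde t := by
  refine G.eq_of_φ_mul fun c => ?_
  rw [φ_mul_mTilde, ← mul_assoc, φ_mul_mTilde, map_mul, Mult.L_mul']

theorem sliceR_ε_T₃ (y x : A) : sliceR (G.ε : A →ₗ[ℂ] ℂ) (G.T₃ y x) = y * x := by
  rw [← sub_eq_zero]
  refine G.nondeg' _ fun c => ?_
  rw [mul_sub, sub_eq_zero, ← sliceR_rTensor_mulLeft, mixed', sliceR_rTensor_mulRight, sliceR_ε,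
    mul_assoc]

/-- Left invariant linear maps: `(ι ⊗ χ)((a ⊗ 1)Δ(b)) = a ⊗ χ(b)`. -/
def IsLeftInvariant {V : Type*} [AddCommGroup V] [Module ℂ V] (χ : A →ₗ[ℂ] V) : Prop :=
  ∀ a b, χ.lTensor A (G.T₂ (a ⊗ₜ b)) = a ⊗ₜ χ b

theorem φ_isLeftInvariant : G.IsLeftInvariant G.φ := fun a b => by
  apply (TensorProduct.rid ℂ A).injective
  exact (G.φ_left_invariant a b).trans (TensorProduct.rid_tmul ..).symm

variable {G} in
-- Multiplying the first leg by c on the left compares Δ(y)(x ⊗ 1) with ((c ⊗ 1)Δ(y))(x ⊗ 1), where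
-- the invariance applies; non-degeneracy removes c.
theorem IsLeftInvariant.T₃ {V : Type*} [AddCommGroup V] [Module ℂ V] {χ : A →ₗ[ℂ] V}
    (h : G.IsLeftInvariant χ) (y x : A) : χ.lTensor A (G.T₃ y x) = x ⊗ₜ χ y := by
  rw [← sub_eq_zero]
  refine rTensor_joint_inj (fun c : A => LinearMap.mulLeft ℂ c) (fun m hm => G.nondeg' m hm) _
    fun c => ?_
  have e : ∀ (g : A →ₗ[ℂ] A) (t : A ⊗[ℂ] A),
      g.rTensor V (χ.lTensor A t) = χ.lTensor A (g.rTensor A t) := fun g t =>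
    LinearMap.congr_fun ((LinearMap.rTensor_comp_lTensor ..).trans
      (LinearMap.lTensor_comp_rTensor ..).symm) t
  rw [map_sub, sub_eq_zero, e, mixed', ← e, h]
  simp

variable {G} in
-- On t = Δ(y)(x ⊗ 1) both sides are φ(x)χ(y), and such t span. For χ = φ this is multiplicativity
-- of φ under m̃; the vector-valued case serves the left twist.
theorem IsLeftInvariant.mTilde {V : Type*} [AddCommGroup V] [Module ℂ V] {χ : A →ₗ[ℂ] V}
    (h : G.IsLeftInvariant χ) (t : A ⊗[ℂ] A) :
    χ (G.mTilde t) = leftSlice V G.φ (χ.lTensor A t) := by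
  induction G.span_T₃ t using Submodule.span_induction with
  | zero => simp
  | add x y _ _ hx hy => simp only [map_add, hx, hy]
  | smul a x _ hx => simp only [map_smul, hx]
  | mem s hs =>
    obtain ⟨y, x, rfl⟩ := hs
    rw [mTilde_T₃, h.T₃]
    simp

theorem φ_mTilde_tmul (x y : A) : G.φ (G.mTilde (x ⊗ₜ y)) = G.φ x * G.φ y := by
  rw [G.φ_isLeftInvariant.mTilde]; simp

/-- The integral absorbs the first leg of Δ(c) through ε, so Δ(c)(h ⊗ y) = h ⊗ cy by the counit
identity. -/
theorem mTilde_integral_tmul {h : A} (hh : ∀ a, a * h = G.ε a • h) (y : A) :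
    G.mTilde (h ⊗ₜ y) = G.φ h • y := by
  refine G.eq_of_φ_mul fun c => ?_
  have e : ∀ t : A ⊗[ℂ] A, (LinearMap.mulRight ℂ h).rTensor A t =
      h ⊗ₜ sliceL (G.ε : A →ₗ[ℂ] ℂ) t := by
    intro t
    induction t with
    | zero => simp
    | add s s' hs hs' => simp only [map_add, tmul_add, hs, hs']
    | tmul p q => simp [hh, smul_tmul]
  rw [φ_mul_mTilde, L_Δ_tmul', e, sliceL_ε]
  simp [mul_smul_comm, mul_comm]

theorem mTilde_tmul_integral {h : A} (hh : ∀ a, a * h = G.ε a • h) (x : A) :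
    G.mTilde (x ⊗ₜ h) = G.φ h • x := by
  refine G.eq_of_φ_mul fun c => ?_
  have e : ∀ t : A ⊗[ℂ] A, (LinearMap.mulRight ℂ h).lTensor A t =
      sliceR (G.ε : A →ₗ[ℂ] ℂ) t ⊗ₜ h := by
    intro t
    induction t with
    | zero => simp
    | add s s' hs hs' => simp only [map_add, add_tmul, hs, hs']
    | tmul p q => simp [hh, smul_tmul]
  rw [φ_mul_mTilde, L_Δ_tmul, e, sliceR_ε_T₃]
  simp [mul_smul_comm]

/-- Otherwise φ(bh) = ε(b)φ(h) = 0 for all b, against faithfulness. -/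
theorem φ_integral_ne_zero {h : A} (hh : ∀ a, a * h = G.ε a • h) (h0 : h ≠ 0) : G.φ h ≠ 0 :=
  fun h1 => h0 (G.φ_faithful h fun b => by rw [hh, map_smul, h1, smul_zero])

end AlgQuantumGroup

/-! ### Arrows into π_l and its tensor products, separated by φ. -/

namespace StarRep

variable {A : Type u} [NonUnitalRing A] [StarRing A] [Module ℂ A]
  [IsScalarTower ℂ A A] [SMulCommClass ℂ A A] [StarModule ℂ A] {G : AlgQuantumGroup A}

theorem extAct_apply_tmul (X Y : StarRep G) (t : A ⊗[ℂ] A) (v : X.K) (w : Y.K) :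
    X.extAct Y t (v ⊗ₜ w) = TensorProduct.map (X.orbit v) (Y.orbit w) t := by
  induction t with
  | zero => simp
  | add s s' hs hs' => simp only [map_add, LinearMap.add_apply, hs, hs']
  | tmul p q => simp

theorem tensorAct_actL (X Y : StarRep G) (a b : A) (u : X.K ⊗[ℂ] Y.K) :
    (Y.act a).lTensor X.K (X.tensorAct Y b u) = X.extAct Y (G.T₄ a b) u := by
  have e : ∀ (t : A ⊗[ℂ] A) (u : X.K ⊗[ℂ] Y.K), (Y.act a).lTensor X.K (X.extAct Y t u) =
      X.extAct Y ((LinearMap.mulLeft ℂ a).lTensor A t) u := by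
    intro t u
    induction t with
    | zero => simp
    | add s s' hs hs' => simp only [map_add, LinearMap.add_apply, hs, hs']
    | tmul p q =>
      induction u with
      | zero => simp
      | add s s' hs hs' => simp only [map_add, hs, hs']
      | tmul p q => simp
  have : (Y.act a).lTensor X.K ∘ₗ X.tensorAct Y b = X.extAct Y (G.T₄ a b) := by
    refine ext_on_act (X.extAct Y) (X.extAct_nondeg Y) fun x v => ?_
    rw [LinearMap.comp_apply, tensorAct_apply, e, ← G.T₄_mul, map_mul]
    rfl
  exact LinearMap.congr_fun this u

theorem extAct_piL (s t : A ⊗[ℂ] A) : G.piL.extAct G.piL s t = s * t := by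
  induction s with
  | zero => simp
  | add s s' hs hs' => simp only [map_add, LinearMap.add_apply, add_mul, hs, hs']
  | tmul p q =>
    induction t with
    | zero => simp
    | add s s' hs hs' => simp only [map_add, mul_add, hs, hs']
    | tmul r s => exact (Algebra.TensorProduct.tmul_mul_tmul p r q s).symm

theorem tensorAct_piL (a : A) (t : A ⊗[ℂ] A) :
    G.piL.tensorAct G.piL a t = (G.Δ a).L t := by
  have : G.piL.tensorAct G.piL a = (G.Δ a).L := by
    refine ext_on_act (G.piL.extAct G.piL) (G.piL.extAct_nondeg G.piL) fun x v => ?_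
    rw [tensorAct_apply, extAct_piL, extAct_piL, Mult.L_mul]
  exact LinearMap.congr_fun this t

/-- Right multiplication, an endomorphism of the regular representation. -/
def mulRightHom (G : AlgQuantumGroup A) (b : A) : G.piL ⟶ G.piL :=
  ⟨LinearMap.mulRight ℂ b, fun a v => mul_assoc a v b⟩

/-- The arrow `m̃ : π_l × π_l → π_l`. -/
def mHom (G : AlgQuantumGroup A) : G.piL ⊗ G.piL ⟶ G.piL :=
  ⟨G.mTilde, fun a t => (congrArg G.mTilde (tensorAct_piL a t)).trans (G.mTilde_L_Δ a t)⟩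

/-- Intertwining turns φ(c f(u)) into φ(f(cu)), so φ ∘ f knows every φ(c f(u)), and φ is faithful.
-/
theorem hom_piL_ext {X : StarRep G} {f g : X ⟶ G.piL}
    (h : ∀ u, G.φ (f.lin u) = G.φ (g.lin u)) : f = g := by
  apply hom_ext
  ext u
  refine G.eq_of_φ_mul fun c => ?_
  have e : ∀ f : X ⟶ G.piL, c * f.lin u = f.lin (X.act c u) := fun f => (f.comm c u).symm
  rw [e, e, h]

/-- For the difference z of the two values, the slice of (θ × π_l)(c)z vanishes for all c. The
elements (a ⊗ 1)Δ(c) span A ⊗ A, so the slice of (θ ⊗ π_l)(t)z vanishes for all t; on t = a ⊗ b,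
faithfulness of φ and non-degeneracy of θ give z = 0. -/
theorem hom_tensor_piL_ext {X θ : StarRep G} {f g : X ⟶ θ ⊗ G.piL}
    (h : ∀ u, rightSlice θ.K G.φ (f.lin u) = rightSlice θ.K G.φ (g.lin u)) : f = g := by
  apply hom_ext
  ext u
  rw [← sub_eq_zero]
  have h1 : ∀ c, rightSlice θ.K G.φ (θ.tensorAct G.piL c (f.lin u - g.lin u)) = 0 := by
    intro c
    have e : ∀ f : X ⟶ θ ⊗ G.piL, θ.tensorAct G.piL c (f.lin u) = f.lin (X.act c u) :=
      fun f => (f.comm c u).symm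
    rw [map_sub, e, e, map_sub, h, sub_self]
  generalize f.lin u - g.lin u = z at h1
  have h2 : ∀ t : A ⊗[ℂ] A, rightSlice θ.K G.φ (θ.extAct G.piL t z) = 0 := by
    intro t
    obtain ⟨w, rfl⟩ := G.T₂.surjective t
    induction w with
    | zero => simp
    | add s s' hs hs' => simp only [map_add, LinearMap.add_apply, hs, hs', add_zero]
    | tmul a c => rw [← tensorAct_left, rightSlice_rTensor, h1, map_zero]
  refine eq_zero_of_rightSlice (fun b => G.φ ∘ₗ LinearMap.mulLeft ℂ b)
    (fun n hn => G.φ_faithful n hn) _ fun b => θ.cancel _ fun a => ?_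
  rw [← rightSlice_rTensor, ← rightSlice_lTensor]
  have h3 := h2 (a ⊗ₜ b)
  rw [extAct_tmul, ← LinearMap.lTensor_comp_rTensor] at h3
  exact h3

/-- The mirror argument, with the spanning elements (1 ⊗ a)Δ(b), which leave the first leg free for
φ. -/
theorem hom_piL_tensor_ext {X θ : StarRep G} {f g : X ⟶ G.piL ⊗ θ}
    (h : ∀ u, leftSlice θ.K G.φ (f.lin u) = leftSlice θ.K G.φ (g.lin u)) : f = g := by
  apply hom_ext
  ext u
  rw [← sub_eq_zero]
  have h1 : ∀ c, leftSlice θ.K G.φ (G.piL.tensorAct θ c (f.lin u - g.lin u)) = 0 := by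
    intro c
    have e : ∀ f : X ⟶ G.piL ⊗ θ, G.piL.tensorAct θ c (f.lin u) = f.lin (X.act c u) :=
      fun f => (f.comm c u).symm
    rw [map_sub, e, e, map_sub, h, sub_self]
  generalize f.lin u - g.lin u = z at h1
  have h2 : ∀ t : A ⊗[ℂ] A, leftSlice θ.K G.φ (G.piL.extAct θ t z) = 0 := by
    intro t
    induction G.span_T₄ t using Submodule.span_induction with
    | zero => simp
    | add s s' _ _ hs hs' => simp only [map_add, LinearMap.add_apply, hs, hs', add_zero]
    | smul a x _ hx => simp only [map_smul, LinearMap.smul_apply, hx, smul_zero]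
    | mem s hs =>
      obtain ⟨a, b, rfl⟩ := hs
      rw [← tensorAct_actL, leftSlice_lTensor, h1, map_zero]
  refine eq_zero_of_leftSlice (fun b => G.φ ∘ₗ LinearMap.mulLeft ℂ b)
    (fun n hn => G.φ_faithful n hn) _ fun b => θ.cancel _ fun a => ?_
  rw [← leftSlice_lTensor, ← leftSlice_rTensor]
  have h3 := h2 (b ⊗ₜ a)
  rw [extAct_tmul, ← LinearMap.rTensor_comp_lTensor] at h3
  exact h3

/-- After φ is applied, either bracketing gives φ(x)φ(y)φ(z). -/
theorem mHom_isSemigroupObj (G : AlgQuantumGroup A) : IsSemigroupObj (mHom G) := by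
  refine hom_piL_ext fun u => ?_
  have e : G.φ ∘ₗ Hom.lin (mHom G ▷ G.piL ≫ mHom G) =
      G.φ ∘ₗ Hom.lin ((α_ G.piL G.piL G.piL).hom ≫ G.piL ◁ mHom G ≫ mHom G) := by
    refine TensorProduct.ext_threefold fun x y z => ?_
    change G.φ (G.mTilde (G.mTilde (x ⊗ₜ y) ⊗ₜ z)) = G.φ (G.mTilde (x ⊗ₜ G.mTilde (y ⊗ₜ z)))
    simp only [G.φ_mTilde_tmul, mul_assoc]
  exact LinearMap.congr_fun e u

end StarRep

/-! ### Free modules over a semigroup in a monoidal category. -/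

section Modules

universe w

variable {C : Type*} [Category.{w} C] [MonoidalCategory C] {Q : C} {m : Q ⊗ Q ⟶ Q}

theorem IsSemigroupObj.isLeftModule (h : IsSemigroupObj m) (X : C) :
    IsLeftModule m (leftAction m X) := by
  have h' := congrArg (fun f => f ▷ X) h
  simp only [comp_whiskerRight] at h'
  simp only [IsLeftModule, leftAction]
  rw [associator_inv_naturality_left_assoc, h']
  simp

theorem IsSemigroupObj.isRightModule (h : IsSemigroupObj m) (X : C) :
    IsRightModule m (rightAction m X) := by
  have h' := congrArg (fun f => X ◁ f) h
  simp only [whiskerLeft_comp] at h'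
  simp only [IsRightModule, rightAction]
  simp only [comp_whiskerRight, Category.assoc]
  rw [associator_naturality_middle_assoc, h']
  simp

end Modules

/-! ### Units for m̃, and tensoring with trivial representations. -/

namespace StarRep

variable {A : Type u} [NonUnitalRing A] [StarRing A] [Module ℂ A]
  [IsScalarTower ℂ A A] [SMulCommClass ℂ A A] [StarModule ℂ A] {G : AlgQuantumGroup A}

theorem exists_isMonoidObj_iff (G : AlgQuantumGroup A) :
    (∃ η : 𝟙_ (StarRep G) ⟶ G.piL, IsMonoidObj (mHom G) η) ↔ G.IsDiscrete := by
  constructor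
  · rintro ⟨η, -, h1, -⟩
    refine ⟨η.lin ⟨1⟩, fun h0 => ?_, fun a => ?_⟩
    -- The unit law gives m̃(η(1) ⊗ p) = p, so η(1) = 0 would force p = 0.
    · obtain ⟨p, hp⟩ := G.exists_φ_one
      have h2 : G.mTilde (η.lin ⟨1⟩ ⊗ₜ p) = (1 : ℂ) • p :=
        LinearMap.congr_fun (congrArg Hom.lin h1) ((⟨1⟩ : ULift.{u} ℂ) ⊗ₜ[ℂ] p)
      rw [h0, zero_tmul, map_zero, one_smul] at h2
      rw [← h2, map_zero] at hp
      exact zero_ne_one hp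
    · exact ((η.comm a ⟨1⟩).symm.trans (map_smul η.lin (G.ε a) _))
  · rintro ⟨h, h0, hh⟩
    have hφ := G.φ_integral_ne_zero hh h0
    -- The normalisation 1 ↦ φ(h)⁻¹h cancels the factor φ(h) in m̃(h ⊗ y) = φ(h)y.
    let η : 𝟙_ (StarRep G) ⟶ G.piL :=
      ⟨((G.φ h)⁻¹ • LinearMap.toSpanSingleton ℂ A h) ∘ₗ
        (ULift.moduleEquiv : ULift.{u} ℂ ≃ₗ[ℂ] ℂ).toLinearMap, fun a v => by
          change (G.φ h)⁻¹ • (G.ε a * v.down) • h = a * (G.φ h)⁻¹ • v.down • h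
          rw [mul_smul_comm, mul_smul_comm, hh, smul_smul (v.down), mul_comm]⟩
    have hη : ∀ z : ULift.{u} ℂ, η.lin z = (G.φ h)⁻¹ • z.down • h := fun z => rfl
    refine ⟨η, mHom_isSemigroupObj G, ?_, ?_⟩
    · apply hom_ext
      refine TensorProduct.ext' fun z y => ?_
      change G.mTilde (η.lin z ⊗ₜ y) = z.down • y
      rw [hη, ← smul_tmul', ← smul_tmul', map_smul, map_smul, G.mTilde_integral_tmul hh,
        smul_comm z.down, inv_smul_smul₀ hφ]
    · apply hom_ext
      refine TensorProduct.ext' fun y z => ?_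
      change G.mTilde (y ⊗ₜ η.lin z) = z.down • y
      rw [hη, tmul_smul, tmul_smul, map_smul, map_smul, G.mTilde_tmul_integral hh,
        smul_comm z.down, inv_smul_smul₀ hφ]

/-- On the trivial leg Δ(a) is evaluated by ε. Only (b ⊗ 1)Δ(a) lies in A ⊗ A, so the identity is
checked after acting with b on the first leg. -/
theorem tensorAct_triv_right (X Y : StarRep G) (a : A) (x : X.K) (v : Y.K) :
    X.tensorAct Y.triv a (x ⊗ₜ v) = X.act a x ⊗ₜ v := by
  have key : ∀ b, (X.act b).rTensor Y.K (X.tensorAct Y.triv a (x ⊗ₜ v)) =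
      (X.act b).rTensor Y.K (X.act a x ⊗ₜ v) := by
    intro b
    have e : ∀ t : A ⊗[ℂ] A, X.extAct Y.triv t (x ⊗ₜ v) =
        X.act (sliceR (G.ε : A →ₗ[ℂ] ℂ) t) x ⊗ₜ v := by
      intro t
      induction t with
      | zero => simp
      | add s s' hs hs' => simp only [map_add, LinearMap.add_apply, add_tmul, hs, hs']
      | tmul p q =>
        change X.act p x ⊗ₜ (G.ε q • v) = _
        simp [smul_tmul]
    refine (tensorAct_left X Y.triv b a _).trans ?_
    rw [e, G.sliceR_ε]
    simp
  rw [← sub_eq_zero]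
  exact rTensor_joint_inj (fun b => X.act b) X.cancel _ fun b => by rw [map_sub, key, sub_self]

theorem tensorAct_triv_left (X Y : StarRep G) (a : A) (v : X.K) (y : Y.K) :
    X.triv.tensorAct Y a (v ⊗ₜ y) = v ⊗ₜ Y.act a y := by
  have : X.triv.tensorAct Y a ∘ₗ TensorProduct.mk ℂ X.K Y.K v =
      TensorProduct.mk ℂ X.K Y.K v ∘ₗ Y.act a := by
    refine ext_on_act Y.act Y.nondeg fun c w => ?_
    have e : ∀ t : A ⊗[ℂ] A, X.triv.extAct Y t (v ⊗ₜ w) =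
        v ⊗ₜ Y.act (sliceL (G.ε : A →ₗ[ℂ] ℂ) t) w := by
      intro t
      induction t with
      | zero => simp
      | add s s' hs hs' => simp only [map_add, LinearMap.add_apply, tmul_add, hs, hs']
      | tmul p q =>
        change (G.ε p • v) ⊗ₜ Y.act q w = _
        simp [smul_tmul]
    refine (tensorAct_right X.triv Y a c v w).trans ?_
    rw [e, G.sliceL_ε]
    simp
  exact LinearMap.congr_fun this y

/-- A acts on the regular leg alone, so a basis of K splits the tensor product into copies of π_l.
The isomorphism is linear; no orthonormality of the basis is involved. -/
theorem nonempty_iso_copies (θ : StarRep G) (I : Type u)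
    (hI : Cardinal.mk I = Module.rank ℂ θ.K) :
    Nonempty (G.piL ⊗ θ.triv ≅ copies I G.piL) ∧
      Nonempty (θ.triv ⊗ G.piL ≅ copies I G.piL) := by
  classical
  let b₀ := Module.Basis.ofVectorSpace ℂ θ.K
  obtain ⟨e⟩ := Cardinal.eq.1 (hI.trans b₀.mk_eq_rank''.symm)
  let b : Module.Basis I ℂ θ.K := b₀.reindex e.symm
  constructor
  · refine ⟨isoMk (equivFinsuppOfBasisRight b) fun a (t : A ⊗[ℂ] θ.K) => ?_⟩
    change equivFinsuppOfBasisRight b (G.piL.tensorAct θ.triv a t) =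
      copiesAct I G.piL a (equivFinsuppOfBasisRight b t)
    induction t with
    | zero => simp
    | add s s' hs hs' => simp only [map_add, hs, hs']
    | tmul x v =>
      rw [tensorAct_triv_right]
      ext i
      refine Eq.trans ?_ (congrArg (fun y => a * y)
        (equivFinsuppOfBasisRight_apply_tmul_apply b x v i).symm)
      simp [mul_smul_comm]
  · refine ⟨isoMk (equivFinsuppOfBasisLeft b) fun a (t : θ.K ⊗[ℂ] A) => ?_⟩
    change equivFinsuppOfBasisLeft b (θ.triv.tensorAct G.piL a t) =
      copiesAct I G.piL a (equivFinsuppOfBasisLeft b t)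
    induction t with
    | zero => simp
    | add s s' hs hs' => simp only [map_add, hs, hs']
    | tmul v x =>
      rw [tensorAct_triv_left]
      ext i
      refine Eq.trans ?_ (congrArg (fun y => a * y)
        (equivFinsuppOfBasisLeft_apply_tmul_apply b v x i).symm)
      simp [mul_smul_comm]

end StarRep

end TensorSquare

/-! ### The left and right twists. -/

noncomputable section Twists

namespace AlgQuantumGroup

variable {A : Type u} [NonUnitalRing A] [StarRing A] [Module ℂ A]
  [IsScalarTower ℂ A A] [SMulCommClass ℂ A A] [StarModule ℂ A] (G : AlgQuantumGroup A)

theorem T₁_mulRight (x c w : A) :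
    G.T₁ (x ⊗ₜ (c * w)) = (LinearMap.mulRight ℂ w).lTensor A (G.T₁ (x ⊗ₜ c)) := by
  rw [← sub_eq_zero]
  refine tensor_nondeg G _ fun y => ?_
  rw [sub_mul, sub_eq_zero, lTensor_mulRight_mul, ← L_T₁, ← L_T₁, LinearMap.mulLeft_mul,
    LinearMap.lTensor_comp]
  rfl

end AlgQuantumGroup

namespace StarRep

variable {A : Type u} [NonUnitalRing A] [StarRing A] [Module ℂ A]
  [IsScalarTower ℂ A A] [SMulCommClass ℂ A A] [StarModule ℂ A] {G : AlgQuantumGroup A}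

theorem span_tmul_act (X : StarRep G) (V : Type u) [AddCommGroup V] [Module ℂ V] :
    Submodule.span ℂ {t : V ⊗[ℂ] X.K | ∃ x a v, x ⊗ₜ X.act a v = t} = ⊤ := by
  rw [eq_top_iff, ← TensorProduct.span_tmul_eq_top, Submodule.span_le]
  rintro _ ⟨x, v, rfl⟩
  have hv : v ∈ Submodule.span ℂ {w | ∃ b v, X.act b v = w} := X.nondeg ▸ Submodule.mem_top
  rw [SetLike.mem_coe]
  induction hv using Submodule.span_induction with
  | zero => simp
  | add x y _ _ hx hy => rw [tmul_add]; exact add_mem hx hy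
  | smul a x _ hx => rw [tmul_smul]; exact Submodule.smul_mem _ _ hx
  | mem y h => obtain ⟨a, w, rfl⟩ := h; exact Submodule.subset_span ⟨x, a, w, rfl⟩

theorem span_act_tmul (X : StarRep G) (V : Type u) [AddCommGroup V] [Module ℂ V] :
    Submodule.span ℂ {t : X.K ⊗[ℂ] V | ∃ a v x, X.act a v ⊗ₜ x = t} = ⊤ := by
  rw [eq_top_iff, ← TensorProduct.span_tmul_eq_top, Submodule.span_le]
  rintro _ ⟨v, x, rfl⟩
  have hv : v ∈ Submodule.span ℂ {w | ∃ b v, X.act b v = w} := X.nondeg ▸ Submodule.mem_top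
  rw [SetLike.mem_coe]
  induction hv using Submodule.span_induction with
  | zero => simp
  | add x y _ _ hx hy => rw [add_tmul]; exact add_mem hx hy
  | smul a x _ hx => rw [← smul_tmul']; exact Submodule.smul_mem _ _ hx
  | mem y h => obtain ⟨a, w, rfl⟩ := h; exact Submodule.subset_span ⟨a, w, x, rfl⟩

theorem eq_of_rTensor_mulRight (G : AlgQuantumGroup A) {V : Type u} [AddCommGroup V] [Module ℂ V]
    {s t : A ⊗[ℂ] V}
    (h : ∀ b, (LinearMap.mulRight ℂ b).rTensor V s = (LinearMap.mulRight ℂ b).rTensor V t) :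
    s = t :=
  sub_eq_zero.1 (rTensor_joint_inj (fun b : A => LinearMap.mulRight ℂ b) G.nondeg _
    fun b => by rw [map_sub, h, sub_self])

theorem eq_of_lTensor_mulRight (G : AlgQuantumGroup A) {V : Type u} [AddCommGroup V] [Module ℂ V]
    {s t : V ⊗[ℂ] A}
    (h : ∀ b, (LinearMap.mulRight ℂ b).lTensor V s = (LinearMap.mulRight ℂ b).lTensor V t) :
    s = t :=
  sub_eq_zero.1 (lTensor_joint_inj (fun b : A => LinearMap.mulRight ℂ b) G.nondeg _
    fun b => by rw [map_sub, h, sub_self])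

/-- For b = cw the right factor w can be pulled out of Δ(x)(a ⊗ cw); products span A, which settles
general b. -/
theorem tensorAct_tmul_act_piL (X : StarRep G) (x a b : A) (v : X.K) :
    X.tensorAct G.piL x (X.act a v ⊗ₜ b) = (X.orbit v).rTensor A ((G.Δ x).L (a ⊗ₜ b)) := by
  have : X.tensorAct G.piL x ∘ₗ TensorProduct.mk ℂ X.K A (X.act a v) =
      (X.orbit v).rTensor A ∘ₗ (G.Δ x).L ∘ₗ TensorProduct.mk ℂ A A a := by
    refine ext_on_act G.piL.act G.piL.nondeg fun c w => ?_
    have h1 : X.act a v ⊗ₜ[ℂ] (c * w) = X.extAct G.piL (a ⊗ₜ c) (v ⊗ₜ w) := rfl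
    change X.tensorAct G.piL x (X.act a v ⊗ₜ (c * w)) =
      (X.orbit v).rTensor A ((G.Δ x).L (a ⊗ₜ (c * w)))
    have h2 : ∀ t : A ⊗[ℂ] A, X.extAct G.piL t (v ⊗ₜ w) =
        (X.orbit v).rTensor A ((LinearMap.mulRight ℂ w).lTensor A t) := by
      intro t
      induction t with
      | zero => simp
      | add s s' hs hs' => simp only [map_add, LinearMap.add_apply, hs, hs']
      | tmul p q => rfl
    rw [h1, tensorAct_apply, h2, G.L_Δ_tmul, G.L_Δ_tmul, LinearMap.mulRight_mul,
      LinearMap.lTensor_comp]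
    rfl
  exact LinearMap.congr_fun this b

/-! ### The maps `x ⊗ v ↦ Δ(x)(1 ⊗ v)` -/

/-- The value on x ⊗ θ(a)v could depend on the way the vector is written as θ(a)v. The equations
imposed here for all b do not mention such a presentation and determine the value by non-degeneracy;
solutions on the spanning vectors x ⊗ θ(a)v therefore glue to a linear map. -/
theorem exists_leftTwist (θ : StarRep G) : ∃ T : A ⊗[ℂ] θ.K →ₗ[ℂ] A ⊗[ℂ] θ.K, ∀ b t,
    (LinearMap.mulRight ℂ b).rTensor θ.K (T t) =
      TensorProduct.lift ((LinearMap.lcomp ℂ (A ⊗[ℂ] θ.K) (TensorProduct.mk ℂ A θ.K b)) ∘ₗ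
        (G.piL.tensorAct θ : A →ₗ[ℂ] Module.End ℂ (A ⊗[ℂ] θ.K))) t := by
  refine exists_lift_of_joint_inj (fun b : A => (LinearMap.mulRight ℂ b).rTensor θ.K)
    (rTensor_joint_inj _ G.nondeg) _ (span_tmul_act θ A) ?_
  rintro _ ⟨x, a, v, rfl⟩
  refine ⟨(θ.orbit v).lTensor A (G.T₁ (x ⊗ₜ a)), fun b => ?_⟩
  refine Eq.trans ?_ (tensorAct_right G.piL θ x a b v).symm
  rw [extAct_apply_tmul]
  exact LinearMap.congr_fun (LinearMap.rTensor_comp_lTensor ..) _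

/-- The map `x ⊗ v ↦ Δ(x)(1 ⊗ v)`. -/
def leftTwist (θ : StarRep G) : A ⊗[ℂ] θ.K →ₗ[ℂ] A ⊗[ℂ] θ.K := (exists_leftTwist θ).choose

theorem mulRight_leftTwist (θ : StarRep G) (b x : A) (v : θ.K) :
    (LinearMap.mulRight ℂ b).rTensor θ.K (θ.leftTwist (x ⊗ₜ v)) =
      G.piL.tensorAct θ x (b ⊗ₜ v) :=
  (exists_leftTwist θ).choose_spec b (x ⊗ₜ v)

theorem leftTwist_tmul_act (θ : StarRep G) (x a : A) (v : θ.K) :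
    θ.leftTwist (x ⊗ₜ θ.act a v) = (θ.orbit v).lTensor A (G.T₁ (x ⊗ₜ a)) := by
  refine eq_of_rTensor_mulRight G fun b => ?_
  rw [mulRight_leftTwist]
  refine (tensorAct_right G.piL θ x a b v).trans ?_
  rw [extAct_apply_tmul]
  exact (LinearMap.congr_fun (LinearMap.rTensor_comp_lTensor ..) _).symm

/-- Δ is multiplicative, and right multiplication by b on the first leg commutes with the action of
y, being an endomorphism of π_l. -/
theorem leftTwist_mul (θ : StarRep G) (y x : A) (v : θ.K) :
    θ.leftTwist ((y * x) ⊗ₜ v) = G.piL.tensorAct θ y (θ.leftTwist (x ⊗ₜ v)) := by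
  refine eq_of_rTensor_mulRight G fun b => ?_
  rw [mulRight_leftTwist, map_mul]
  refine Eq.trans ?_ ((tensorMap (mulRightHom G b) (𝟙 θ)).comm y _).symm
  exact congrArg _ (mulRight_leftTwist θ b x v).symm

theorem leftTwist_natural {X Y : StarRep G} (f : X ⟶ Y) (t : A ⊗[ℂ] X.K) :
    Y.leftTwist (f.lin.lTensor A t) = f.lin.lTensor A (X.leftTwist t) := by
  induction t with
  | zero => simp
  | add s s' hs hs' => simp only [map_add, hs, hs']
  | tmul x v =>
    refine eq_of_rTensor_mulRight G fun b => ?_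
    rw [LinearMap.lTensor_tmul, mulRight_leftTwist]
    have e : (LinearMap.mulRight ℂ b).rTensor Y.K (f.lin.lTensor A (X.leftTwist (x ⊗ₜ v))) =
        f.lin.lTensor A ((LinearMap.mulRight ℂ b).rTensor X.K (X.leftTwist (x ⊗ₜ v))) :=
      LinearMap.congr_fun ((LinearMap.rTensor_comp_lTensor ..).trans
        (LinearMap.lTensor_comp_rTensor ..).symm) _
    rw [e, mulRight_leftTwist]
    exact ((tensorMap (𝟙 G.piL) f).comm x (b ⊗ₜ v)).symm

theorem leftTwist_triv (θ : StarRep G) (t : A ⊗[ℂ] θ.K) : θ.triv.leftTwist t = t := by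
  induction t with
  | zero => simp
  | add s s' hs hs' => simp only [map_add, hs, hs']
  | tmul x v =>
    refine eq_of_rTensor_mulRight G fun b => ?_
    rw [mulRight_leftTwist]
    exact tensorAct_triv_right G.piL θ x b v

/-- `T₁` is onto, so for each v the image contains every element x ⊗ θ(a)v. -/
theorem leftTwist_surjective (θ : StarRep G) : Function.Surjective θ.leftTwist := by
  rw [← LinearMap.range_eq_top, eq_top_iff, ← span_tmul_act θ A, Submodule.span_le]
  rintro _ ⟨x, a, v, rfl⟩
  have h : ∀ t : A ⊗[ℂ] A, (θ.orbit v).lTensor A t ∈ LinearMap.range θ.leftTwist := by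
    intro t
    obtain ⟨w, rfl⟩ := G.T₁.surjective t
    induction w with
    | zero => simp
    | add s s' hs hs' => simp only [map_add]; exact add_mem hs hs'
    | tmul x a => exact ⟨_, leftTwist_tmul_act θ x a v⟩
  simpa using h (x ⊗ₜ a)

/-- Coassociativity with the middle leg in θ: writing V for the twist, V of θ × π_l is (V of θ) on
legs 1, 2 after `T₁` on legs 1, 3. The permutations only move the θ-leg out of the way. This
identity drives the injectivity of the left twist. -/
theorem leftTwist_tensor_piL (θ : StarRep G) (s : (A ⊗[ℂ] A) ⊗[ℂ] θ.K) :
    (θ.tensor G.piL).leftTwist (TensorProduct.assoc ℂ A θ.K A (TensorProduct.rightComm ℂ A A θ.K s))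
      = TensorProduct.assoc ℂ A θ.K A (θ.leftTwist.rTensor A
        (TensorProduct.rightComm ℂ A A θ.K (G.T₁.toLinearMap.rTensor θ.K s))) := by
  induction s with
  | zero => simp
  | add s s' hs hs' => simp only [map_add, hs, hs']
  | tmul t v =>
  induction t with
  | zero => simp
  | add s s' hs hs' => simp only [map_add, add_tmul, hs, hs']
  | tmul x y =>
  -- Writing y as a sum of products cw makes the action on the last leg computable through `T₁`.
  have hy : y ∈ Submodule.span ℂ {w | ∃ b v, G.piL.act b v = w} := G.piL.nondeg ▸ Submodule.mem_top
  induction hy using Submodule.span_induction with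
  | zero => simp
  | add x y _ _ hx hy => simp only [tmul_add, add_tmul, map_add, hx, hy]
  | smul a x _ hx => simp only [tmul_smul, ← smul_tmul', map_smul, hx]
  | mem y h =>
  obtain ⟨c, w, rfl⟩ := h
  change (θ.tensor G.piL).leftTwist (x ⊗ₜ (v ⊗ₜ (c * w))) = TensorProduct.assoc ℂ A θ.K A
    (θ.leftTwist.rTensor A (TensorProduct.rightComm ℂ A A θ.K (G.T₁ (x ⊗ₜ (c * w)) ⊗ₜ v)))
  refine eq_of_rTensor_mulRight G fun b => ?_
  rw [mulRight_leftTwist, G.T₁_mulRight]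
  refine (assoc_comm G.piL θ G.piL x ((b ⊗ₜ v) ⊗ₜ (c * w))).symm.trans ?_
  refine (congrArg (TensorProduct.assoc ℂ A θ.K A)
    (tensorAct_right (G.piL.tensor θ) G.piL x c (b ⊗ₜ v) w)).trans ?_
  generalize G.T₁ (x ⊗ₜ c) = t
  induction t with
  | zero => simp
  | add s s' hs hs' => simp only [map_add, LinearMap.add_apply, add_tmul, hs, hs']
  | tmul p q =>
    have h1 : ∀ z : A ⊗[ℂ] θ.K, (LinearMap.mulRight ℂ b).rTensor (θ.K ⊗[ℂ] A)
        (TensorProduct.assoc ℂ A θ.K A (z ⊗ₜ (q * w))) =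
        TensorProduct.assoc ℂ A θ.K A ((LinearMap.mulRight ℂ b).rTensor θ.K z ⊗ₜ (q * w)) := by
      intro z
      induction z with
      | zero => simp
      | add s s' hs hs' => simp only [map_add, add_tmul, hs, hs']
      | tmul p q => simp
    refine Eq.trans ?_ (h1 (θ.leftTwist (p ⊗ₜ v))).symm
    rw [mulRight_leftTwist]
    rfl

/-! ### The maps `v ⊗ x ↦ Δ(x)(v ⊗ 1)` -/

theorem mulRight_rTensor_orbit_T₃ (θ : StarRep G) (b x a : A) (v : θ.K) :
    (LinearMap.mulRight ℂ b).lTensor θ.K ((θ.orbit v).rTensor A (G.T₃ x a)) =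
      θ.tensorAct G.piL x (θ.act a v ⊗ₜ b) := by
  rw [tensorAct_tmul_act_piL, G.L_Δ_tmul]
  exact LinearMap.congr_fun ((LinearMap.lTensor_comp_rTensor ..).trans
    (LinearMap.rTensor_comp_lTensor ..).symm) _

/-- Well-definedness comes as for the left twist, here with right multiplications on the second leg
and solutions Δ(x)(a ⊗ 1) evaluated at v. -/
theorem exists_rightTwist (θ : StarRep G) : ∃ T : θ.K ⊗[ℂ] A →ₗ[ℂ] θ.K ⊗[ℂ] A, ∀ b t,
    (LinearMap.mulRight ℂ b).lTensor θ.K (T t) =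
      TensorProduct.lift ((LinearMap.lcomp ℂ (θ.K ⊗[ℂ] A)
        ((TensorProduct.mk ℂ θ.K A).flip b)) ∘ₗ
        (θ.tensorAct G.piL : A →ₗ[ℂ] Module.End ℂ (θ.K ⊗[ℂ] A))).flip t := by
  refine exists_lift_of_joint_inj (fun b : A => (LinearMap.mulRight ℂ b).lTensor θ.K)
    (lTensor_joint_inj _ G.nondeg) _ (span_act_tmul θ A) ?_
  rintro _ ⟨a, v, x, rfl⟩
  exact ⟨(θ.orbit v).rTensor A (G.T₃ x a), fun b => mulRight_rTensor_orbit_T₃ θ b x a v⟩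

/-- The map `v ⊗ x ↦ Δ(x)(v ⊗ 1)`. -/
def rightTwist (θ : StarRep G) : θ.K ⊗[ℂ] A →ₗ[ℂ] θ.K ⊗[ℂ] A := (exists_rightTwist θ).choose

theorem mulRight_rightTwist (θ : StarRep G) (b x : A) (v : θ.K) :
    (LinearMap.mulRight ℂ b).lTensor θ.K (θ.rightTwist (v ⊗ₜ x)) =
      θ.tensorAct G.piL x (v ⊗ₜ b) :=
  (exists_rightTwist θ).choose_spec b (v ⊗ₜ x)

theorem rightTwist_act_tmul (θ : StarRep G) (x a : A) (v : θ.K) :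
    θ.rightTwist (θ.act a v ⊗ₜ x) = (θ.orbit v).rTensor A (G.T₃ x a) :=
  eq_of_lTensor_mulRight G fun b => by rw [mulRight_rightTwist, mulRight_rTensor_orbit_T₃]

theorem rightTwist_mul (θ : StarRep G) (y x : A) (v : θ.K) :
    θ.rightTwist (v ⊗ₜ (y * x)) = θ.tensorAct G.piL y (θ.rightTwist (v ⊗ₜ x)) := by
  refine eq_of_lTensor_mulRight G fun b => ?_
  rw [mulRight_rightTwist, map_mul]
  refine Eq.trans ?_ ((tensorMap (𝟙 θ) (mulRightHom G b)).comm y _).symm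
  exact congrArg _ (mulRight_rightTwist θ b x v).symm

theorem rightTwist_natural {X Y : StarRep G} (f : X ⟶ Y) (t : X.K ⊗[ℂ] A) :
    Y.rightTwist (f.lin.rTensor A t) = f.lin.rTensor A (X.rightTwist t) := by
  induction t with
  | zero => simp
  | add s s' hs hs' => simp only [map_add, hs, hs']
  | tmul v x =>
    refine eq_of_lTensor_mulRight G fun b => ?_
    rw [LinearMap.rTensor_tmul, mulRight_rightTwist]
    have e : (LinearMap.mulRight ℂ b).lTensor Y.K (f.lin.rTensor A (X.rightTwist (v ⊗ₜ x))) =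
        f.lin.rTensor A ((LinearMap.mulRight ℂ b).lTensor X.K (X.rightTwist (v ⊗ₜ x))) :=
      LinearMap.congr_fun ((LinearMap.lTensor_comp_rTensor ..).trans
        (LinearMap.rTensor_comp_lTensor ..).symm) _
    rw [e, mulRight_rightTwist]
    exact ((tensorMap f (𝟙 G.piL)).comm x (v ⊗ₜ b)).symm

theorem rightTwist_surjective (θ : StarRep G) : Function.Surjective θ.rightTwist := by
  rw [← LinearMap.range_eq_top, eq_top_iff, ← span_act_tmul θ A, Submodule.span_le]
  rintro _ ⟨a, v, x, rfl⟩
  have h : ∀ t : A ⊗[ℂ] A, (θ.orbit v).rTensor A t ∈ LinearMap.range θ.rightTwist := by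
    intro t
    induction G.span_T₃ t using Submodule.span_induction with
    | zero => simp
    | add s s' _ _ hs hs' => simp only [map_add]; exact add_mem hs hs'
    | smul a x _ hx => simp only [map_smul]; exact Submodule.smul_mem _ _ hx
    | mem s hs => obtain ⟨y, x, rfl⟩ := hs; exact ⟨_, rightTwist_act_tmul θ y x v⟩
  simpa using h (a ⊗ₜ x)

/-- Moving the operators of the first entry to the second by * reduces inner products in K ⊗ A to
slices of s*t, where invariance of φ can act. -/
theorem inner_orbit_rTensor (θ : StarRep G) (v w : θ.K) (s t : A ⊗[ℂ] A) :
    coreForm (tensorCore θ.core G.regCore) ((θ.orbit v).rTensor A s) ((θ.orbit w).rTensor A t) =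
      coreForm θ.core v (θ.act (sliceR G.φ (star s * t)) w) := by
  induction s with
  | zero => simp
  | add s s' hs hs' => simp only [map_add, star_add, add_mul, LinearMap.add_apply, hs, hs']
  | tmul p q =>
    induction t with
    | zero => simp
    | add s s' hs hs' => simp only [map_add, mul_add, LinearMap.add_apply, hs, hs']
    | tmul r s =>
      simp only [star_tmul, Algebra.TensorProduct.tmul_mul_tmul, sliceR_tmul, map_smul,
        LinearMap.smul_apply, LinearMap.rTensor_tmul, orbit_apply, map_mul, Module.End.mul_apply,
        smul_eq_mul]
      rw [coreForm_apply, coreForm_apply, tensorCore_tmul, θ.act_star, G.regCore_apply, mul_comm]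

theorem inner_orbit_lTensor (θ : StarRep G) (v w : θ.K) (s t : A ⊗[ℂ] A) :
    coreForm (tensorCore G.regCore θ.core) ((θ.orbit v).lTensor A s) ((θ.orbit w).lTensor A t) =
      coreForm θ.core v (θ.act (sliceL G.φ (star s * t)) w) := by
  induction s with
  | zero => simp
  | add s s' hs hs' => simp only [map_add, star_add, add_mul, LinearMap.add_apply, hs, hs']
  | tmul p q =>
    induction t with
    | zero => simp
    | add s s' hs hs' => simp only [map_add, mul_add, LinearMap.add_apply, hs, hs']
    | tmul r s =>
      simp only [star_tmul, Algebra.TensorProduct.tmul_mul_tmul, sliceL_tmul, map_smul,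
        LinearMap.smul_apply, LinearMap.lTensor_tmul, orbit_apply, map_mul, Module.End.mul_apply,
        smul_eq_mul]
      rw [coreForm_apply, coreForm_apply, tensorCore_tmul, θ.act_star, G.regCore_apply]

/-- The relevant product is (a* ⊗ 1)Δ(x*y)(b ⊗ 1), and ι ⊗ φ sends it to φ(x*y)a*b by left
invariance. -/
theorem inner_rightTwist (θ : StarRep G) (s t : θ.K ⊗[ℂ] A) :
    (tensorCore θ.core G.regCore).inner (θ.rightTwist s) (θ.rightTwist t) =
      (tensorCore θ.core G.regCore).inner s t := by
  rw [← coreForm_apply, ← coreForm_apply]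
  have hs : s ∈ Submodule.span ℂ _ := (span_act_tmul θ A).symm ▸ Submodule.mem_top
  have ht : t ∈ Submodule.span ℂ _ := (span_act_tmul θ A).symm ▸ Submodule.mem_top
  induction hs using Submodule.span_induction with
  | zero => simp
  | add s s' _ _ hs hs' => simp only [map_add, LinearMap.add_apply, hs, hs']
  | smul a x _ hx => simp only [map_smulₛₗ, RingHom.id_apply, LinearMap.smul_apply, hx]
  | mem s hs =>
    obtain ⟨a, v, x, rfl⟩ := hs
    induction ht using Submodule.span_induction with
    | zero => simp
    | add s s' _ _ hs hs' => simp only [map_add, hs, hs']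
    | smul a x _ hx => simp only [map_smul, hx]
    | mem t ht =>
      obtain ⟨b, w, y, rfl⟩ := ht
      rw [rightTwist_act_tmul, rightTwist_act_tmul, inner_orbit_rTensor, AlgQuantumGroup.T₃,
        star_star, ← G.L_T₂, G.L_Δ_T₃, sliceR_rTensor_mulLeft, G.φ_left_invariant', mul_smul_comm,
        coreForm_apply, coreForm_apply, tensorCore_tmul, θ.act_star, G.regCore_apply]
      simp only [map_smul, map_mul, LinearMap.smul_apply, Module.End.mul_apply]
      rw [← coreForm_apply, map_smul, coreForm_apply, smul_eq_mul, mul_comm]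

theorem rightTwist_injective (θ : StarRep G) : Function.Injective θ.rightTwist := by
  rw [injective_iff_map_eq_zero]
  intro s hs
  refine (tensorCore θ.core G.regCore).definite s ?_
  rw [← inner_rightTwist, hs, ← coreForm_apply, map_zero]

/-- The isomorphism `v ⊗ x ↦ Δ(x)(v ⊗ 1)`. -/
def rightTwistIso (θ : StarRep G) : θ.triv ⊗ G.piL ≅ θ ⊗ G.piL :=
  isoMk (LinearEquiv.ofBijective θ.rightTwist ⟨θ.rightTwist_injective, θ.rightTwist_surjective⟩)
    fun a (t : θ.K ⊗[ℂ] A) => by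
      change θ.rightTwist (θ.triv.tensorAct G.piL a t) = θ.tensorAct G.piL a (θ.rightTwist t)
      induction t with
      | zero => simp
      | add s s' hs hs' => simp only [map_add, hs, hs']
      | tmul v x => rw [tensorAct_triv_left, ← rightTwist_mul]; rfl

/-- Injectivity is known after tensoring with π_l and is then brought back to θ through
`leftTwist_tensor_piL`. -/
theorem leftTwist_injective (θ : StarRep G) : Function.Injective θ.leftTwist := by
  -- For I_θ the twist is the identity, so the twist of I_θ × π_l is `T₁` up to permutation of legs.
  have h1 : Function.Injective (θ.triv.tensor G.piL).leftTwist := by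
    rw [injective_iff_map_eq_zero]
    intro z hz
    obtain ⟨s, rfl⟩ := ((TensorProduct.rightComm ℂ A A θ.K).trans
      (TensorProduct.assoc ℂ A θ.K A)).surjective z
    have h := (leftTwist_tensor_piL θ.triv s).symm.trans hz
    have e : θ.triv.leftTwist = LinearMap.id := LinearMap.ext (leftTwist_triv θ)
    rw [e, LinearMap.rTensor_id] at h
    have h' : (((G.T₁.rTensor θ.K).trans (TensorProduct.rightComm ℂ A A θ.K)).trans
      (TensorProduct.assoc ℂ A θ.K A)) s = 0 := h
    rw [LinearEquiv.map_eq_zero_iff] at h'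
    rw [h', map_zero]
  -- Naturality along the isomorphism I_θ × π_l ≅ θ × π_l given by the right twist.
  have h2 : Function.Injective (θ.tensor G.piL).leftTwist := by
    rw [injective_iff_map_eq_zero]
    intro z hz
    let e : θ.K ⊗[ℂ] A ≃ₗ[ℂ] θ.K ⊗[ℂ] A :=
      LinearEquiv.ofBijective θ.rightTwist ⟨θ.rightTwist_injective, θ.rightTwist_surjective⟩
    obtain ⟨s, rfl⟩ := (e.lTensor A).surjective z
    have h3 := (leftTwist_natural θ.rightTwistIso.hom s).symm.trans hz
    have h4 : (e.lTensor A) ((θ.triv.tensor G.piL).leftTwist s) = 0 := h3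
    rw [LinearEquiv.map_eq_zero_iff] at h4
    rw [(injective_iff_map_eq_zero _).1 h1 _ h4, map_zero]
  rw [injective_iff_map_eq_zero]
  intro t ht
  obtain ⟨p, hp⟩ := G.exists_φ_one
  -- Choosing s so that `T₁` on legs 1, 3 yields t ⊗ p makes the twist of θ hit t; φ(p) = 1 allows t
  -- to be recovered at the end.
  obtain ⟨s, hs⟩ := ((G.T₁.rTensor θ.K).trans (TensorProduct.rightComm ℂ A A θ.K)).surjective
    (t ⊗ₜ[ℂ] p)
  have h3 := leftTwist_tensor_piL θ s
  have h4 : TensorProduct.rightComm ℂ A A θ.K (G.T₁.toLinearMap.rTensor θ.K s) = t ⊗ₜ[ℂ] p := hs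
  rw [h4, LinearMap.rTensor_tmul, ht, zero_tmul, map_zero] at h3
  have h5 := (injective_iff_map_eq_zero _).1 h2 _ h3
  rw [LinearEquiv.map_eq_zero_iff, LinearEquiv.map_eq_zero_iff] at h5
  rw [h5, map_zero, map_zero] at h4
  have h6 := congrArg (rightSlice (A ⊗[ℂ] θ.K) G.φ) h4
  rw [rightSlice_tmul, hp, one_smul, map_zero] at h6
  exact h6.symm

/-- The isomorphism `x ⊗ v ↦ Δ(x)(1 ⊗ v)`. -/
def leftTwistIso (θ : StarRep G) : G.piL ⊗ θ.triv ≅ G.piL ⊗ θ :=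
  isoMk (LinearEquiv.ofBijective θ.leftTwist ⟨θ.leftTwist_injective, θ.leftTwist_surjective⟩)
    fun a (t : A ⊗[ℂ] θ.K) => by
      change θ.leftTwist (G.piL.tensorAct θ.triv a t) = G.piL.tensorAct θ a (θ.leftTwist t)
      induction t with
      | zero => simp
      | add s s' hs hs' => simp only [map_add, hs, hs']
      | tmul x v => rw [tensorAct_triv_right, ← leftTwist_mul]; rfl

/-- The natural isomorphism `I_θ × π_l ≅ θ × π_l`. -/
def rightTwistNatIso (G : AlgQuantumGroup A) :
    trivFunctor G ⋙ tensorRight G.piL ≅ tensorRight G.piL :=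
  NatIso.ofComponents (fun θ => θ.rightTwistIso) fun f =>
    hom_ext (LinearMap.ext fun t => rightTwist_natural f t)

/-- The natural isomorphism `π_l × I_θ ≅ π_l × θ`. -/
def leftTwistNatIso (G : AlgQuantumGroup A) :
    trivFunctor G ⋙ tensorLeft G.piL ≅ tensorLeft G.piL :=
  NatIso.ofComponents (fun θ => θ.leftTwistIso) fun f =>
    hom_ext (LinearMap.ext fun t => leftTwist_natural f t)

/-! ### Slices of the twists: module property and inner products. -/

theorem leftSlice_leftAction (θ : StarRep G) (x : A) (z : A ⊗[ℂ] θ.K) :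
    leftSlice θ.K G.φ ((leftAction (mHom G) θ).lin (x ⊗ₜ[ℂ] z)) =
      G.φ x • leftSlice θ.K G.φ z := by
  induction z with
  | zero => rw [tmul_zero, map_zero, map_zero, smul_zero]
  | add s s' hs hs' => rw [tmul_add, map_add, map_add, map_add, hs, hs', smul_add]
  | tmul y v =>
    change leftSlice θ.K G.φ (G.mTilde (x ⊗ₜ y) ⊗ₜ v) = _
    rw [leftSlice_tmul, leftSlice_tmul, G.φ_mTilde_tmul, mul_smul]

theorem rightSlice_rightAction (θ : StarRep G) (x : A) (z : θ.K ⊗[ℂ] A) :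
    rightSlice θ.K G.φ ((rightAction (mHom G) θ).lin (z ⊗ₜ[ℂ] x)) =
      G.φ x • rightSlice θ.K G.φ z := by
  induction z with
  | zero => rw [zero_tmul, map_zero, map_zero, smul_zero]
  | add s s' hs hs' => rw [add_tmul, map_add, map_add, map_add, hs, hs', smul_add]
  | tmul v y =>
    change rightSlice θ.K G.φ (v ⊗ₜ G.mTilde (y ⊗ₜ x)) = _
    rw [rightSlice_tmul, rightSlice_tmul, G.φ_mTilde_tmul, mul_comm, mul_smul]

theorem rightSlice_rightTwist (θ : StarRep G) (x : A) (v : θ.K) :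
    rightSlice θ.K G.φ (θ.rightTwist (v ⊗ₜ x)) = G.φ x • v := by
  have : rightSlice θ.K G.φ ∘ₗ θ.rightTwist ∘ₗ (TensorProduct.mk ℂ θ.K A).flip x =
      G.φ x • LinearMap.id := by
    refine ext_on_act θ.act θ.nondeg fun a v => ?_
    change rightSlice θ.K G.φ (θ.rightTwist (θ.act a v ⊗ₜ x)) = G.φ x • θ.act a v
    rw [rightTwist_act_tmul, rightSlice_rTensor]
    refine (congrArg (θ.orbit v) (G.φ_left_invariant' x a)).trans ?_
    simp
  exact LinearMap.congr_fun this v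

/-- Both composites have slice φ(x)φ(y)v, since the slice of Δ(x)(v ⊗ 1) is φ(x)v by left
invariance. -/
theorem rightTwist_isRightModuleHom (θ : StarRep G) :
    IsRightModuleHom (rightAction (mHom G) θ.triv) (rightAction (mHom G) θ)
      θ.rightTwistIso.hom := by
  refine hom_tensor_piL_ext fun u => ?_
  have e : rightSlice θ.K G.φ ∘ₗ
        Hom.lin (rightAction (mHom G) θ.triv ≫ θ.rightTwistIso.hom) =
      rightSlice θ.K G.φ ∘ₗ Hom.lin (θ.rightTwistIso.hom ▷ G.piL ≫ rightAction (mHom G) θ) := by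
    refine TensorProduct.ext_threefold fun v x y => ?_
    change rightSlice θ.K G.φ (θ.rightTwist (v ⊗ₜ G.mTilde (x ⊗ₜ y))) =
      rightSlice θ.K G.φ ((rightAction (mHom G) θ).lin (θ.rightTwist (v ⊗ₜ x) ⊗ₜ[ℂ] y))
    rw [rightSlice_rightAction, rightSlice_rightTwist, rightSlice_rightTwist, G.φ_mTilde_tmul,
      mul_comm, mul_smul]
  exact LinearMap.congr_fun e u

theorem leftSlice_leftTwist_act (θ : StarRep G) (x a : A) (v : θ.K) :
    leftSlice θ.K G.φ (θ.leftTwist (x ⊗ₜ θ.act a v)) =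
      θ.act (sliceL G.φ (G.T₁ (x ⊗ₜ a))) v := by
  rw [leftTwist_tmul_act, leftSlice_lTensor]
  rfl

/-- In three legs, (b ⊗ 1 ⊗ 1)(Δ ⊗ ι)Δ(x) sliced by φ in the middle leg is b ⊗ (φ ⊗ ι)Δ(x), by
invariance of φ. Coassociativity identifies this with the map applied to the second leg of (b ⊗
1)Δ(x). -/
theorem leftSlice_leftTwist_isLeftInvariant (θ : StarRep G) (v : θ.K) :
    G.IsLeftInvariant
      (leftSlice θ.K G.φ ∘ₗ θ.leftTwist ∘ₗ (TensorProduct.mk ℂ A θ.K).flip v) := by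
  intro b x
  have hv : v ∈ Submodule.span ℂ {w | ∃ b v, θ.act b v = w} := θ.nondeg ▸ Submodule.mem_top
  induction hv using Submodule.span_induction with
  | zero => simp
  | add v w _ _ hv hw =>
    simp only [map_add, LinearMap.comp_add, LinearMap.lTensor_add, LinearMap.add_apply, hv, hw,
      tmul_add]
  | smul c v _ hv =>
    simp only [map_smul, LinearMap.comp_smul, LinearMap.lTensor_smul, LinearMap.smul_apply, hv,
      tmul_smul]
  | mem w hw =>
    obtain ⟨a, v, rfl⟩ := hw
    let Ψ : A ⊗[ℂ] A →ₗ[ℂ] θ.K := θ.orbit v ∘ₗ sliceL G.φ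
    have e1 : leftSlice θ.K G.φ ∘ₗ θ.leftTwist ∘ₗ (TensorProduct.mk ℂ A θ.K).flip (θ.act a v) =
        Ψ ∘ₗ G.T₁.toLinearMap ∘ₗ (TensorProduct.mk ℂ A A).flip a :=
      LinearMap.ext fun y => leftSlice_leftTwist_act θ y a v
    have e2 : ∀ t : A ⊗[ℂ] A, (Ψ ∘ₗ G.T₁.toLinearMap ∘ₗ
        (TensorProduct.mk ℂ A A).flip a).lTensor A t =
        Ψ.lTensor A (G.Q (TensorProduct.assoc ℂ A A A (t ⊗ₜ a))) := by
      intro t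
      induction t with
      | zero => simp
      | add s s' hs hs' => simp only [map_add, add_tmul, hs, hs']
      | tmul p q => rfl
    -- `P` puts (b ⊗ 1)Δ(·) on the first two legs, and φ, sitting on the second of these, collapses
    -- it.
    have e3 : ∀ t : A ⊗[ℂ] A, Ψ.lTensor A (G.P (b ⊗ₜ t)) = b ⊗ₜ Ψ t := by
      intro t
      induction t with
      | zero => simp
      | add s s' hs hs' => simp only [map_add, tmul_add, hs, hs']
      | tmul p q =>
        have h1 : G.P (b ⊗ₜ (p ⊗ₜ q)) = TensorProduct.assoc ℂ A A A (G.T₂ (b ⊗ₜ p) ⊗ₜ q) := rfl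
        have h2 : ∀ s : A ⊗[ℂ] A, Ψ.lTensor A (TensorProduct.assoc ℂ A A A (s ⊗ₜ q)) =
            sliceR G.φ s ⊗ₜ θ.act q v := by
          intro s
          induction s with
          | zero => simp
          | add s s' hs hs' => simp only [map_add, add_tmul, hs, hs']
          | tmul r s => simp [Ψ, smul_tmul]
        rw [h1, h2, G.φ_left_invariant]
        simp [Ψ, smul_tmul]
    rw [e1, e2]
    exact (congrArg (Ψ.lTensor A) (G.P_Q (b ⊗ₜ (x ⊗ₜ a))).symm).trans (e3 _)

theorem leftSlice_leftTwist_mTilde (θ : StarRep G) (x y : A) (v : θ.K) :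
    leftSlice θ.K G.φ (θ.leftTwist (G.mTilde (x ⊗ₜ y) ⊗ₜ v)) =
      G.φ x • leftSlice θ.K G.φ (θ.leftTwist (y ⊗ₜ v)) := by
  refine ((leftSlice_leftTwist_isLeftInvariant θ v).mTilde (x ⊗ₜ y)).trans ?_
  simp

/-- By invariance of the sliced twist, m̃(x ⊗ y) contributes the factor φ(x), exactly what the slice
of the action on the other side produces. -/
theorem leftTwist_isLeftModuleHom (θ : StarRep G) :
    IsLeftModuleHom (leftAction (mHom G) θ.triv) (leftAction (mHom G) θ) θ.leftTwistIso.hom := by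
  refine hom_piL_tensor_ext fun u => ?_
  have e : (leftSlice θ.K G.φ ∘ₗ
        Hom.lin (leftAction (mHom G) θ.triv ≫ θ.leftTwistIso.hom)) ∘ₗ
          (TensorProduct.assoc ℂ A A θ.K).toLinearMap =
      (leftSlice θ.K G.φ ∘ₗ Hom.lin (G.piL ◁ θ.leftTwistIso.hom ≫ leftAction (mHom G) θ)) ∘ₗ
          (TensorProduct.assoc ℂ A A θ.K).toLinearMap := by
    refine TensorProduct.ext_threefold fun x y v => ?_
    change leftSlice θ.K G.φ (θ.leftTwist (G.mTilde (x ⊗ₜ y) ⊗ₜ v)) =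
      leftSlice θ.K G.φ ((leftAction (mHom G) θ).lin (x ⊗ₜ[ℂ] θ.leftTwist (y ⊗ₜ v)))
    rw [leftSlice_leftAction, leftSlice_leftTwist_mTilde]
  obtain ⟨s, rfl⟩ := (TensorProduct.assoc ℂ A A θ.K).surjective u
  exact LinearMap.congr_fun e s

/-- The product of the two entries is (1 ⊗ a*)Δ(x*y)(1 ⊗ b). Here φ meets the first leg, where left
invariance says nothing, so a slice remains; it measures the failure to be isometric. -/
theorem inner_leftTwist (θ : StarRep G) (x y : A) (v w : θ.K) :
    (tensorCore G.regCore θ.core).inner (θ.leftTwist (x ⊗ₜ v)) (θ.leftTwist (y ⊗ₜ w)) =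
      θ.core.inner v (leftSlice θ.K G.φ (θ.leftTwist ((star x * y) ⊗ₜ w))) := by
  rw [← coreForm_apply, ← coreForm_apply]
  have hv : v ∈ Submodule.span ℂ {w | ∃ b v, θ.act b v = w} := θ.nondeg ▸ Submodule.mem_top
  have hw : w ∈ Submodule.span ℂ {w | ∃ b v, θ.act b v = w} := θ.nondeg ▸ Submodule.mem_top
  induction hv using Submodule.span_induction with
  | zero => simp
  | add s s' _ _ hs hs' => simp only [map_add, tmul_add, LinearMap.add_apply, hs, hs']
  | smul a x _ hx => simp only [map_smulₛₗ, RingHom.id_apply, tmul_smul, LinearMap.smul_apply, hx]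
  | mem s hs =>
    obtain ⟨a, v, rfl⟩ := hs
    induction hw using Submodule.span_induction with
    | zero => simp
    | add s s' _ _ hs hs' => simp only [map_add, tmul_add, hs, hs']
    | smul a x _ hx => simp only [map_smul, tmul_smul, hx]
    | mem t ht =>
      obtain ⟨b, w, rfl⟩ := ht
      have h1 : star (G.T₁ (x ⊗ₜ a)) = G.T₄ (star a) (star x) := by
        rw [AlgQuantumGroup.T₄, star_star, star_star]
      have h2 : ∀ t : A ⊗[ℂ] A, sliceL G.φ ((LinearMap.mulLeft ℂ (star a)).lTensor A t) =
          star a * sliceL G.φ t := leftSlice_lTensor G.φ _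
      rw [leftTwist_tmul_act, leftTwist_tmul_act, inner_orbit_lTensor, h1, G.T₄_mul, ← G.T₁_mul,
        h2, map_mul, Module.End.mul_apply, ← leftSlice_leftTwist_act, leftTwist_tmul_act,
        coreForm_apply, coreForm_apply, θ.act_star]

end StarRep

end Twists

/-! ### Finite dimensional spectral theory in pre-Hilbert spaces. -/

noncomputable section DiscreteTwist

section CoreGeometry

variable {V : Type u} [AddCommGroup V] [Module ℂ V]

theorem core_exists_riesz (c : InnerProductSpace.Core ℂ V) (W : Submodule ℂ V)
    [FiniteDimensional ℂ W] (f : V →ₗ[ℂ] ℂ) : ∃ p ∈ W, ∀ w ∈ W, c.inner p w = f w := by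
  let _ : NormedAddCommGroup V := c.toNormedAddCommGroup
  let _ : InnerProductSpace ℂ V := InnerProductSpace.ofCore c.toCore
  let g : W →L[ℂ] ℂ := LinearMap.toContinuousLinearMap (f ∘ₗ W.subtype)
  refine ⟨(InnerProductSpace.toDual ℂ W).symm g, Subtype.prop _, fun w hw => ?_⟩
  exact InnerProductSpace.toDual_symm_apply (x := (⟨w, hw⟩ : W)) (y := g)

theorem core_exists_proj (c : InnerProductSpace.Core ℂ V) (W : Submodule ℂ V)
    [FiniteDimensional ℂ W] (v : V) : ∃ p ∈ W, ∀ w ∈ W, c.inner p w = c.inner v w :=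
  core_exists_riesz c W (coreForm c v)

theorem core_inner_self (c : InnerProductSpace.Core ℂ V) {v : V} (hv : v ≠ 0) :
    ∃ r : ℝ, 0 < r ∧ c.inner v v = r := by
  let _ := c
  have h1 : (c.inner v v).im = 0 := InnerProductSpace.Core.inner_self_im (𝕜 := ℂ) v
  have h2 : 0 ≤ (c.inner v v).re := c.re_inner_nonneg v
  have h3 : c.inner v v = ((c.inner v v).re : ℂ) := Complex.ext rfl (by simpa using h1)
  refine ⟨(c.inner v v).re, lt_of_le_of_ne h2 fun h => hv (c.definite v ?_), h3⟩
  rw [h3, ← h, Complex.ofReal_zero]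

/-- No completeness is needed: the spectral theorem is applied to the restriction of D to W. -/
theorem core_le_iSup_eigenspace (c : InnerProductSpace.Core ℂ V) (D : Module.End ℂ V)
    (hD : ∀ u v, c.inner (D u) v = c.inner u (D v)) (W : Submodule ℂ V) [FiniteDimensional ℂ W]
    (hW : ∀ w ∈ W, D w ∈ W) : W ≤ ⨆ μ, Module.End.eigenspace D μ := by
  let _ : NormedAddCommGroup V := c.toNormedAddCommGroup
  let _ : InnerProductSpace ℂ V := InnerProductSpace.ofCore c.toCore
  let T : Module.End ℂ W := D.restrict hW
  have hT : LinearMap.IsSymmetric T := fun u v => hD u v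
  have h1 : ⨆ μ, Module.End.eigenspace T μ = ⊤ :=
    Submodule.orthogonal_eq_bot_iff.1 hT.orthogonalComplement_iSup_eigenspaces_eq_bot
  have h2 : W = (⨆ μ, Module.End.eigenspace T μ).map W.subtype := by
    rw [h1, Submodule.map_top, Submodule.range_subtype]
  rw [h2, Submodule.map_iSup]
  refine iSup_mono fun μ => ?_
  rintro _ ⟨w, hw, rfl⟩
  rw [Module.End.mem_eigenspace_iff]
  exact congrArg Subtype.val (Module.End.mem_eigenspace_iff.1 hw)

theorem eigenvector_induction {D : Module.End ℂ V} (hD : ⨆ μ, Module.End.eigenspace D μ = ⊤)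
    {p : V → Prop} (h : ∀ (μ : ℂ) v, D v = μ • v → p v) (hadd : ∀ v w, p v → p w → p (v + w))
    (v : V) : p v := by
  have hv : v ∈ ⨆ μ, Module.End.eigenspace D μ := hD ▸ Submodule.mem_top
  exact Submodule.iSup_induction _ (motive := p) hv
    (fun μ v hv => h μ v (Module.End.mem_eigenspace_iff.1 hv)) (h 0 0 (by simp)) hadd

/-- The eigenspaces form an internal direct sum, so a scalar may be prescribed independently on
each; f need not be continuous or bounded. -/
theorem exists_eigenvalue_calculus {D : Module.End ℂ V}
    (hD : ⨆ μ, Module.End.eigenspace D μ = ⊤) (f : ℂ → ℂ) :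
    ∃ R : Module.End ℂ V, ∀ (μ : ℂ) v, D v = μ • v → R v = f μ • v := by
  classical
  have hint : DirectSum.IsInternal fun μ => Module.End.eigenspace D μ :=
    DirectSum.isInternal_submodule_of_iSupIndep_of_iSup_eq_top
      (Module.End.eigenspaces_iSupIndep D) hD
  let e := LinearEquiv.ofBijective
    (DirectSum.coeLinearMap fun μ => Module.End.eigenspace D μ) hint
  refine ⟨DirectSum.toModule ℂ ℂ V (fun μ => f μ • (Module.End.eigenspace D μ).subtype) ∘ₗ
    e.symm.toLinearMap, fun μ v hv => ?_⟩
  have h1 : e (DirectSum.lof ℂ ℂ (fun μ => Module.End.eigenspace D μ) μ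
      ⟨v, Module.End.mem_eigenspace_iff.2 hv⟩) = v := DirectSum.coeLinearMap_lof _ _ _
  have h2 := e.symm_apply_eq.2 h1.symm
  rw [LinearMap.comp_apply, LinearEquiv.coe_coe, h2, DirectSum.toModule_lof]
  rfl

end CoreGeometry

theorem exists_finite_rightSlice {A : Type*} [AddCommGroup A] [Module ℂ A] (z : A ⊗[ℂ] A) : ∃ P : Submodule ℂ A, FiniteDimensional ℂ P ∧
    ∀ f : A →ₗ[ℂ] ℂ, rightSlice A f z ∈ P := by
  induction z with
  | zero => exact ⟨⊥, inferInstance, fun f => by simp⟩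
  | add s t hs ht =>
    obtain ⟨P, hP, h1⟩ := hs
    obtain ⟨Q, hQ, h2⟩ := ht
    exact ⟨P ⊔ Q, inferInstance, fun f => by
      rw [map_add]; exact Submodule.add_mem_sup (h1 f) (h2 f)⟩
  | tmul p q =>
    exact ⟨ℂ ∙ p, inferInstance, fun f => by
      rw [rightSlice_tmul]; exact Submodule.smul_mem _ _ (Submodule.mem_span_singleton_self p)⟩

/-! ### Finite dimensional left ideals in the discrete case. -/

namespace AlgQuantumGroup

variable {A : Type u} [NonUnitalRing A] [StarRing A] [Module ℂ A]
  [IsScalarTower ℂ A A] [SMulCommClass ℂ A A] [StarModule ℂ A] (G : AlgQuantumGroup A)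

theorem T₃_smul (c : ℂ) (y x : A) : G.T₃ (c • y) x = c • G.T₃ y x := by
  simp [T₃, tmul_smul]

variable {G} in
/-- In the discrete case every element lies in a finite dimensional left ideal. -/
theorem IsDiscrete.exists_finite_leftIdeal (hG : G.IsDiscrete) (a : A) :
    ∃ P : Submodule ℂ A, FiniteDimensional ℂ P ∧ a ∈ P ∧ ∀ c, ∀ p ∈ P, c * p ∈ P := by
  obtain ⟨h, h0, hh⟩ := hG
  have hφ := G.φ_integral_ne_zero hh h0
  let z := G.T₃ h a
  let s : A → A := fun d => sliceR G.φ ((LinearMap.mulLeft ℂ d).lTensor A z)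
  have hs : ∀ d, s d = sliceR (G.φ ∘ₗ LinearMap.mulLeft ℂ d) z := fun d => sliceR_lTensor _ _ _
  -- P consists of the slices (ι ⊗ φ)((1 ⊗ d)Δ(h)(a ⊗ 1)); it is finite dimensional because they are
  -- slices of a single tensor.
  let P : Submodule ℂ A := Submodule.span ℂ (Set.range s)
  -- On the spanning elements t = (1 ⊗ r)Δ(q) the integral gives Δ(q)Δ(h) = ε(q)Δ(h), so only 1 ⊗ r
  -- survives. Taking t = c ⊗ d later shows that P is a left ideal.
  have hclosed : ∀ t : A ⊗[ℂ] A, sliceR G.φ (t * z) ∈ P := by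
    intro t
    induction G.span_T₄ t using Submodule.span_induction with
    | zero => simp
    | add s s' _ _ hs hs' => rw [add_mul, map_add]; exact add_mem hs hs'
    | smul a x _ hx => rw [smul_mul_assoc, map_smul]; exact Submodule.smul_mem _ _ hx
    | mem t ht =>
      obtain ⟨r, q, rfl⟩ := ht
      rw [T₄_mul, L_Δ_T₃, hh, T₃_smul, map_smul, map_smul]
      exact Submodule.smul_mem _ _ (Submodule.subset_span ⟨r, rfl⟩)
  refine ⟨P, ?_, ?_, fun c p hp => ?_⟩
  · obtain ⟨Q, hQ, h1⟩ := exists_finite_rightSlice z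
    refine Submodule.finiteDimensional_of_le (S₂ := Q) (Submodule.span_le.2 ?_)
    rintro _ ⟨d, rfl⟩
    rw [hs]
    exact h1 _
  -- Without a unit, d = 1 is unavailable. A functional f killing P but not a gives (f ⊗ ι)(z) = 0
  -- by faithfulness, whereas φ of it is φ(h)f(a), which is non-zero.
  · by_contra ha
    obtain ⟨f, hf, hP⟩ := Submodule.exists_le_ker_of_notMem ha
    have e : ∀ (g : A →ₗ[ℂ] ℂ) (t : A ⊗[ℂ] A), g (sliceL f t) = f (sliceR g t) := by
      intro g t
      induction t with
      | zero => simp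
      | add s s' hs hs' => simp only [map_add, hs, hs']
      | tmul p q => simp [mul_comm]
    have h1 : sliceL f z = 0 := by
      refine G.φ_faithful _ fun d => ?_
      have h2 := e (G.φ ∘ₗ LinearMap.mulLeft ℂ d) z
      rw [← hs] at h2
      exact h2.trans (hP (Submodule.subset_span ⟨d, rfl⟩))
    have h2 := e G.φ z
    rw [h1, map_zero, φ_left_invariant', map_smul, smul_eq_mul] at h2
    exact mul_ne_zero hφ hf h2.symm
  · induction hp using Submodule.span_induction with
    | zero => simp
    | add s s' _ _ hs hs' => rw [mul_add]; exact add_mem hs hs'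
    | smul a x _ hx => rw [mul_smul_comm]; exact Submodule.smul_mem _ _ hx
    | mem t ht =>
      obtain ⟨d, rfl⟩ := ht
      have h1 := hclosed (c ⊗ₜ d)
      rwa [tmul_mul_eq, sliceR_rTensor_mulLeft] at h1

theorem φ_star_mul_self {h : A} (h0 : h ≠ 0) : ∃ r : ℝ, 0 < r ∧ G.φ (star h * h) = r :=
  core_inner_self G.regCore h0

end AlgQuantumGroup

/-! ### The modular operator and the unitary left twist. -/

namespace StarRep

variable {A : Type u} [NonUnitalRing A] [StarRing A] [Module ℂ A]
  [IsScalarTower ℂ A A] [SMulCommClass ℂ A A] [StarModule ℂ A] {G : AlgQuantumGroup A}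

/-- The arrow `a ↦ π(a)v`. -/
def orbitHom (X : StarRep G) (v : X.K) : G.piL ⟶ X :=
  ⟨X.orbit v, fun a b => LinearMap.congr_fun (map_mul X.act a b) v⟩

/-- The operator `v ↦ φ(h)⁻¹ (φ ⊗ id)Δ(h)(1 ⊗ v)`; for an integral `h` it is the action of the
modular element. -/
def modular (X : StarRep G) (h : A) : Module.End ℂ X.K :=
  (G.φ h)⁻¹ • (leftSlice X.K G.φ ∘ₗ X.leftTwist ∘ₗ TensorProduct.mk ℂ A X.K h)

theorem modular_natural {X Y : StarRep G} (f : X ⟶ Y) (h : A) (v : X.K) :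
    f.lin (X.modular h v) = Y.modular h (f.lin v) := by
  have h1 := leftTwist_natural f (h ⊗ₜ v)
  change f.lin ((G.φ h)⁻¹ • leftSlice X.K G.φ (X.leftTwist (h ⊗ₜ v))) =
    (G.φ h)⁻¹ • leftSlice Y.K G.φ (Y.leftTwist (h ⊗ₜ f.lin v))
  rw [map_smul, ← leftSlice_lTensor, ← h1, LinearMap.lTensor_tmul]

/-- Naturality of the modular operator along right multiplication by b. -/
theorem modular_mul (h a b : A) : G.piL.modular h (a * b) = G.piL.modular h a * b :=
  (modular_natural (mulRightHom G b) h a).symm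

/-- Apply the module property with second factor h: m̃(x ⊗ h) = φ(h)x on one side, φ(x) times the
slice at h on the other. Thus the dependence on x is only through φ(x). -/
theorem leftSlice_leftTwist {h : A} (hh : ∀ a, a * h = G.ε a • h)
    (h0 : h ≠ 0) (X : StarRep G) (x : A) (v : X.K) :
    leftSlice X.K G.φ (X.leftTwist (x ⊗ₜ v)) = G.φ x • X.modular h v := by
  have hφ := G.φ_integral_ne_zero hh h0
  have h1 := leftSlice_leftTwist_mTilde X x h v
  rw [G.mTilde_tmul_integral hh, ← smul_tmul', map_smul, map_smul] at h1
  rw [← inv_smul_smul₀ hφ (leftSlice X.K G.φ (X.leftTwist (x ⊗ₜ v))), h1, smul_comm]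
  rfl

theorem inner_leftTwist_eq {h : A} (hh : ∀ a, a * h = G.ε a • h)
    (h0 : h ≠ 0) (X : StarRep G) (x y : A) (v w : X.K) :
    (tensorCore G.regCore X.core).inner (X.leftTwist (x ⊗ₜ v)) (X.leftTwist (y ⊗ₜ w)) =
      G.φ (star x * y) * X.core.inner v (X.modular h w) := by
  rw [inner_leftTwist, leftSlice_leftTwist hh h0, ← coreForm_apply, map_smul]
  rfl

/-- Both sides occur, multiplied by the positive number φ(h*h), in the inner product of the twists
of h ⊗ v and h ⊗ w, which is hermitian. -/
theorem modular_symm {h : A} (hh : ∀ a, a * h = G.ε a • h)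
    (h0 : h ≠ 0) (X : StarRep G) (v w : X.K) :
    X.core.inner (X.modular h v) w = X.core.inner v (X.modular h w) := by
  obtain ⟨r, hr, hr'⟩ := G.φ_star_mul_self h0
  have h1 := inner_leftTwist_eq hh h0 X h h v w
  have h2 := inner_leftTwist_eq hh h0 X h h w v
  rw [← (tensorCore G.regCore X.core).conj_inner_symm, h2, map_mul, X.core.conj_inner_symm, hr',
    Complex.conj_ofReal] at h1
  exact mul_left_cancel₀ (Complex.ofReal_ne_zero.2 hr.ne') h1

/-- The twist of h ⊗ v is non-zero by injectivity, and its squared norm is φ(h*h) μ (v, v). -/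
theorem modular_eigenvalue_pos {h : A} (hh : ∀ a, a * h = G.ε a • h)
    (h0 : h ≠ 0) (X : StarRep G) {μ : ℂ} {v : X.K} (hv : v ≠ 0)
    (hμ : X.modular h v = μ • v) : ∃ r : ℝ, 0 < r ∧ μ = r := by
  obtain ⟨a, ha, ha'⟩ := G.φ_star_mul_self h0
  obtain ⟨b, hb, hb'⟩ := core_inner_self X.core hv
  have hne : X.leftTwist (h ⊗ₜ v) ≠ 0 := by
    intro h1
    have h2 := congrArg (leftSlice X.K G.φ) ((injective_iff_map_eq_zero _).1
      X.leftTwist_injective _ h1)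
    rw [leftSlice_tmul, map_zero] at h2
    exact (smul_ne_zero (G.φ_integral_ne_zero hh h0) hv) h2
  obtain ⟨n, hn, hn'⟩ := core_inner_self (tensorCore G.regCore X.core) hne
  have h1 := inner_leftTwist_eq hh h0 X h h v v
  rw [hn', ha', hμ, ← coreForm_apply, map_smul, coreForm_apply, hb', smul_eq_mul] at h1
  refine ⟨n / (a * b), div_pos hn (mul_pos ha hb), ?_⟩
  have ha0 : (a : ℂ) ≠ 0 := Complex.ofReal_ne_zero.2 ha.ne'
  have hb0 : (b : ℂ) ≠ 0 := Complex.ofReal_ne_zero.2 hb.ne'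
  push_cast
  rw [h1]
  field_simp

/-- For π_l the finite dimensional left ideals supply invariant subspaces on which the symmetric
operator diagonalises. The orbit arrows a ↦ θ(a)v carry eigenvectors to eigenvectors and reach a
spanning set of any representation. -/
theorem iSup_eigenspace_modular {h : A} (hh : ∀ a, a * h = G.ε a • h)
    (h0 : h ≠ 0) (X : StarRep G) :
    ⨆ μ, Module.End.eigenspace (X.modular h) μ = ⊤ := by
  have hreg : ∀ a, a ∈ ⨆ μ, Module.End.eigenspace (G.piL.modular h) μ := by
    suffices H : ⨆ μ, Module.End.eigenspace (G.piL.modular h) μ = ⊤ from fun a =>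
      H ▸ Submodule.mem_top
    rw [eq_top_iff, ← G.piL.nondeg, Submodule.span_le]
    rintro _ ⟨b, a, rfl⟩
    obtain ⟨P, hP, ha, hmul⟩ :=
      AlgQuantumGroup.IsDiscrete.exists_finite_leftIdeal ⟨h, h0, hh⟩ (a : A)
    -- The ideal P need not visibly be stable under the modular operator, but its subspace AP is:
    -- δ(cp) = δ(c)p.
    let W : Submodule ℂ A := Submodule.span ℂ {w | ∃ c, ∃ p ∈ P, c * p = w}
    have hWP : W ≤ P := Submodule.span_le.2 (by rintro _ ⟨c, p, hp, rfl⟩; exact hmul c p hp)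
    have hW : FiniteDimensional ℂ W := Submodule.finiteDimensional_of_le hWP
    refine core_le_iSup_eigenspace G.regCore (G.piL.modular h) (modular_symm hh h0 G.piL) W ?_
      (Submodule.subset_span ⟨b, a, ha, rfl⟩)
    intro w hw
    induction hw using Submodule.span_induction with
    | zero => rw [map_zero]; exact zero_mem _
    | add s s' _ _ hs hs' => rw [map_add]; exact add_mem hs hs'
    | smul a x _ hx => rw [map_smul]; exact Submodule.smul_mem _ _ hx
    | mem t ht =>
      obtain ⟨c, p, hp, rfl⟩ := ht
      rw [modular_mul]
      exact Submodule.subset_span ⟨_, p, hp, rfl⟩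
  rw [eq_top_iff, ← X.nondeg, Submodule.span_le]
  rintro _ ⟨a, v, rfl⟩
  have hle : ⨆ μ, Module.End.eigenspace (G.piL.modular h) μ ≤
      (⨆ μ, Module.End.eigenspace (X.modular h) μ).comap (X.orbitHom v).lin := by
    refine iSup_le fun μ b hb => ?_
    refine Submodule.mem_iSup_of_mem μ (Module.End.mem_eigenspace_iff.2 ?_)
    rw [← modular_natural, Module.End.mem_eigenspace_iff.1 hb, map_smul]
  exact hle (hreg a)

/-- Eigenvalues with a non-zero eigenvector are positive reals, so `μ.re` is μ there and the two
functional calculi are mutually inverse; at other μ only v = 0 occurs. -/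
theorem exists_modular_invSqrt {h : A} (hh : ∀ a, a * h = G.ε a • h)
    (h0 : h ≠ 0) (X : StarRep G) : ∃ R : X.K ≃ₗ[ℂ] X.K, ∀ (μ : ℂ) v,
    X.modular h v = μ • v → R v = (((√μ.re)⁻¹ : ℝ) : ℂ) • v := by
  have htop := iSup_eigenspace_modular hh h0 X
  obtain ⟨R, hR⟩ := exists_eigenvalue_calculus htop fun μ => (((√μ.re)⁻¹ : ℝ) : ℂ)
  obtain ⟨S, hS⟩ := exists_eigenvalue_calculus htop fun μ => ((√μ.re : ℝ) : ℂ)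
  have key : ∀ (μ : ℂ) v, X.modular h v = μ • v → v ≠ 0 → ((√μ.re : ℝ) : ℂ) ≠ 0 := by
    intro μ v hv hv0
    obtain ⟨r, hr, rfl⟩ := modular_eigenvalue_pos hh h0 X hv0 hv
    exact Complex.ofReal_ne_zero.2 (Real.sqrt_pos.2 hr).ne'
  refine ⟨LinearEquiv.ofLinearMap R S (LinearMap.ext fun v => ?_) (LinearMap.ext fun v => ?_), hR⟩
  · refine eigenvector_induction (p := fun v => R (S v) = v) htop (fun μ v hv => ?_) (fun v w hv hw => ?_) v
    · rcases eq_or_ne v 0 with rfl | hv0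
      · simp
      · rw [hS μ v hv, map_smul, hR μ v hv, Complex.ofReal_inv,
          smul_inv_smul₀ (key μ v hv hv0)]
    · rw [map_add, map_add, hv, hw]
  · refine eigenvector_induction (p := fun v => S (R v) = v) htop (fun μ v hv => ?_) (fun v w hv hw => ?_) v
    · rcases eq_or_ne v 0 with rfl | hv0
      · simp
      · rw [hR μ v hv, map_smul, hS μ v hv, Complex.ofReal_inv,
          inv_smul_smul₀ (key μ v hv hv0)]
    · rw [map_add, map_add, hv, hw]

/-- The inverse square root of the action of the modular element. -/
def modularInvSqrt {h : A} (hh : ∀ a, a * h = G.ε a • h)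
    (h0 : h ≠ 0) (X : StarRep G) : X.K ≃ₗ[ℂ] X.K := (exists_modular_invSqrt hh h0 X).choose

theorem modularInvSqrt_apply {h : A} (hh : ∀ a, a * h = G.ε a • h)
    (h0 : h ≠ 0) (X : StarRep G) (μ : ℂ) (v : X.K) (hv : X.modular h v = μ • v) :
    modularInvSqrt hh h0 X v = (((√μ.re)⁻¹ : ℝ) : ℂ) • v :=
  (exists_modular_invSqrt hh h0 X).choose_spec μ v hv

theorem modularInvSqrt_natural {h : A} (hh : ∀ a, a * h = G.ε a • h)
    (h0 : h ≠ 0) {X Y : StarRep G} (f : X ⟶ Y) (v : X.K) :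
    f.lin (modularInvSqrt hh h0 X v) = modularInvSqrt hh h0 Y (f.lin v) := by
  refine eigenvector_induction (p := fun v => f.lin (modularInvSqrt hh h0 X v) =
    modularInvSqrt hh h0 Y (f.lin v)) (iSup_eigenspace_modular hh h0 X) (fun μ v hv => ?_)
    (fun v w hv hw => ?_) v
  · rw [modularInvSqrt_apply hh h0 X μ v hv, map_smul, modularInvSqrt_apply hh h0 Y μ (f.lin v)]
    rw [← modular_natural, hv, map_smul]
  · simp only [map_add, hv, hw]

/-- It suffices to treat eigenvectors v and w, since these span. -/
theorem inner_modularInvSqrt {h : A} (hh : ∀ a, a * h = G.ε a • h)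
    (h0 : h ≠ 0) (X : StarRep G) (v w : X.K) :
    X.core.inner (modularInvSqrt hh h0 X v) (X.modular h (modularInvSqrt hh h0 X w)) =
      X.core.inner v w := by
  have htop := iSup_eigenspace_modular hh h0 X
  simp only [← coreForm_apply]
  refine eigenvector_induction (p := fun v => coreForm X.core (modularInvSqrt hh h0 X v)
    (X.modular h (modularInvSqrt hh h0 X w)) = coreForm X.core v w) htop
    (fun μ v hv => ?_) (fun v w hv hw => ?_) v
  · refine eigenvector_induction (p := fun w => coreForm X.core (modularInvSqrt hh h0 X v)
    (X.modular h (modularInvSqrt hh h0 X w)) = coreForm X.core v w) htop (fun ν w hw => ?_) (fun v w hv hw => ?_) w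
    · rcases eq_or_ne v 0 with rfl | hv0
      · simp
      rcases eq_or_ne w 0 with rfl | hw0
      · simp
      obtain ⟨r, hr, rfl⟩ := modular_eigenvalue_pos hh h0 X hv0 hv
      obtain ⟨s, hs, rfl⟩ := modular_eigenvalue_pos hh h0 X hw0 hw
      rw [modularInvSqrt_apply hh h0 X _ v hv, modularInvSqrt_apply hh h0 X _ w hw, map_smul (X.modular h), hw]
      simp only [map_smulₛₗ, LinearMap.smul_apply, Complex.conj_ofReal, RingHom.id_apply,
        smul_eq_mul, Complex.ofReal_re]
      have h1 := modular_symm hh h0 X v w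
      rw [hv, hw, ← coreForm_apply, ← coreForm_apply] at h1
      simp only [map_smulₛₗ, LinearMap.smul_apply, Complex.conj_ofReal, RingHom.id_apply,
        smul_eq_mul] at h1
      -- Equal eigenvalues give the factor r^(-1/2) r^(-1/2) r = 1; for different ones symmetry
      -- makes v and w orthogonal, and both sides vanish.
      rcases eq_or_ne r s with rfl | hrs
      · have h2 : (((√r)⁻¹ : ℝ) : ℂ) * ((((√r)⁻¹ : ℝ) : ℂ) * (r : ℂ)) = 1 := by
          rw [← Complex.ofReal_mul, ← Complex.ofReal_mul, ← Complex.ofReal_one]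
          congr 1
          have h3 := Real.mul_self_sqrt hr.le
          have h4 := (Real.sqrt_pos.2 hr).ne'
          field_simp
          rw [sq, h3]
        linear_combination (coreForm X.core v w) * h2
      · have h2 : coreForm X.core v w = 0 := by
          have h3 : ((r : ℂ) - s) * coreForm X.core v w = 0 := by linear_combination h1
          refine (mul_eq_zero.1 h3).resolve_left (sub_ne_zero.2 ?_)
          exact_mod_cast hrs
        rw [h2]; simp
    · simp only [map_add, hv, hw]
  · simp only [map_add, LinearMap.add_apply, hv, hw]

/-- The isomorphism `x ⊗ v ↦ Δ(x)(1 ⊗ δ^{-1/2} v)`, where `δ` is the modular element. -/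
def leftTwistUnitaryIso {h : A} (hh : ∀ a, a * h = G.ε a • h)
    (h0 : h ≠ 0) (X : StarRep G) : G.piL ⊗ X.triv ≅ G.piL ⊗ X :=
  whiskerLeftIso G.piL (isoMk (X := X.triv) (Y := X.triv) (modularInvSqrt hh h0 X)
    fun a v => map_smul (modularInvSqrt hh h0 X) (G.ε a) v) ≪≫ X.leftTwistIso

/-- The natural isomorphism `x ⊗ v ↦ Δ(x)(1 ⊗ δ^{-1/2} v)`. -/
def leftTwistUnitaryNatIso {h : A} (hh : ∀ a, a * h = G.ε a • h)
    (h0 : h ≠ 0) : trivFunctor G ⋙ tensorLeft G.piL ≅ tensorLeft G.piL :=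
  NatIso.ofComponents (fun X => leftTwistUnitaryIso hh h0 X) fun {X Y} f => by
    apply hom_ext
    refine TensorProduct.ext' fun x v => ?_
    change Y.leftTwist (x ⊗ₜ modularInvSqrt hh h0 Y (f.lin v)) =
      f.lin.lTensor A (X.leftTwist (x ⊗ₜ modularInvSqrt hh h0 X v))
    rw [← leftTwist_natural, LinearMap.lTensor_tmul]
    exact congrArg (fun w => Y.leftTwist (x ⊗ₜ w)) (modularInvSqrt_natural hh h0 f v).symm

/-- The left twist changes the inner product by δ in the second leg, which the two factors δ^(-1/2)
undo. -/
theorem leftTwistUnitaryIso_isUnitary {h : A} (hh : ∀ a, a * h = G.ε a • h)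
    (h0 : h ≠ 0) (X : StarRep G) :
    IsUnitary (leftTwistUnitaryIso hh h0 X).hom := by
  refine ⟨inferInstance, fun (s t : A ⊗[ℂ] X.K) => ?_⟩
  change (tensorCore G.regCore X.core).inner
    (X.leftTwist ((modularInvSqrt hh h0 X).toLinearMap.lTensor A s))
    (X.leftTwist ((modularInvSqrt hh h0 X).toLinearMap.lTensor A t)) =
      (tensorCore G.regCore X.core).inner s t
  rw [← coreForm_apply, ← coreForm_apply]
  induction s with
  | zero => simp
  | add s s' hs hs' => simp only [map_add, LinearMap.add_apply, hs, hs']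
  | tmul x v =>
    induction t with
    | zero => simp
    | add s s' hs hs' => simp only [map_add, hs, hs']
    | tmul y w =>
      rw [LinearMap.lTensor_tmul, LinearMap.lTensor_tmul, coreForm_apply, coreForm_apply,
        inner_leftTwist_eq hh h0, LinearEquiv.coe_coe, inner_modularInvSqrt]
      rfl

/-- The correction acts on the leg of X and the module action on the π_l legs, so they commute by
the exchange law. -/
theorem leftTwistUnitaryIso_isLeftModuleHom {h : A} (hh : ∀ a, a * h = G.ε a • h)
    (h0 : h ≠ 0) (X : StarRep G) :
    IsLeftModuleHom (leftAction (mHom G) X.triv) (leftAction (mHom G) X)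
      (leftTwistUnitaryIso hh h0 X).hom := by
  have h1 := leftTwist_isLeftModuleHom X
  simp only [IsLeftModuleHom, leftTwistUnitaryIso, Iso.trans_hom, whiskerLeftIso_hom,
    whiskerLeft_comp, Category.assoc] at h1 ⊢
  rw [← h1]
  simp only [leftAction, Category.assoc]
  rw [← whisker_exchange_assoc]
  simp

end StarRep

end DiscreteTwist

/-! ### Locally finite representations and the decomposition of π_l. -/

noncomputable section RepStar

theorem core_ext_left {V : Type u} [AddCommGroup V] [Module ℂ V]
    (c : InnerProductSpace.Core ℂ V) {u v : V} (h : ∀ x, c.inner u x = c.inner v x) : u = v := by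
  rw [← sub_eq_zero]
  refine c.definite _ ?_
  rw [← coreForm_apply, LinearMap.map_sub (coreForm c), LinearMap.sub_apply, sub_eq_zero]
  exact h _

theorem core_ext_right {V : Type u} [AddCommGroup V] [Module ℂ V]
    (c : InnerProductSpace.Core ℂ V) {u v : V} (h : ∀ x, c.inner x u = c.inner x v) : u = v :=
  core_ext_left c fun x => by rw [← c.conj_inner_symm, h, c.conj_inner_symm]

namespace StarRep

variable {A : Type u} [NonUnitalRing A] [StarRing A] [Module ℂ A]
  [IsScalarTower ℂ A A] [SMulCommClass ℂ A A] [StarModule ℂ A] {G : AlgQuantumGroup A}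

section Invariant

variable (X : StarRep G)

/-- The algebra of operators generated by the action. -/
abbrev actAlgebra : Subalgebra ℂ (Module.End ℂ X.K) := Algebra.adjoin ℂ (Set.range X.act)

variable {X} in
/-- An invariant subspace as a submodule over the algebra generated by the action. -/
def IsInvariant.toSubmodule {W : Submodule ℂ X.K} (hW : X.IsInvariant W) :
    Submodule X.actAlgebra X.K where
  carrier := W
  add_mem' := W.add_mem
  zero_mem' := W.zero_mem
  smul_mem' := by
    rintro ⟨r, hr⟩
    change ∀ w ∈ W, r w ∈ W
    induction hr using Algebra.adjoin_induction with
    | mem x hx => obtain ⟨a, rfl⟩ := hx; exact hW a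
    | algebraMap c => exact fun w hw => W.smul_mem c hw
    | add x y _ _ hx hy => exact fun w hw => W.add_mem (hx w hw) (hy w hw)
    | mul x y _ _ hx hy => exact fun w hw => hx _ (hy w hw)

theorem isInvariant_restrictScalars (W : Submodule X.actAlgebra X.K) :
    X.IsInvariant (W.restrictScalars ℂ) := fun a _ hw =>
  W.smul_mem (⟨X.act a, Algebra.subset_adjoin ⟨a, rfl⟩⟩ : X.actAlgebra) hw

variable {X} in
theorem IsInvariant.iSup {ι : Type*} {W : ι → Submodule ℂ X.K} (hW : ∀ i, X.IsInvariant (W i)) :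
    X.IsInvariant (⨆ i, W i) := by
  intro a
  change ⨆ i, W i ≤ (⨆ i, W i).comap (X.act a)
  exact iSup_le fun i w hw => Submodule.mem_iSup_of_mem i (hW i a w hw)

/-- Inside a finite dimensional invariant subspace every invariant subspace has an invariant
orthogonal complement, the action being a *-action. Such pieces exhaust X, so complements exist
globally. The unital algebra `actAlgebra` stands in for A, which may lack a unit. -/
theorem isSemisimpleModule_of_locally_finite
    (hX : ∀ v : X.K, ∃ P : Submodule ℂ X.K, FiniteDimensional ℂ P ∧ v ∈ P ∧ X.IsInvariant P) :
    IsSemisimpleModule X.actAlgebra X.K := by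
  choose P hfin hmem hinv using hX
  rw [isSemisimpleModule_iff]
  refine complementedLattice_of_complementedLattice_Iic (s := Set.univ)
    (f := fun v => (hinv v).toSubmodule) (fun v _ => ⟨?_⟩) ?_
  · rintro ⟨W, hW⟩
    have hW' : W.restrictScalars ℂ ≤ P v := hW
    have := hfin v
    have hWfin : FiniteDimensional ℂ (W.restrictScalars ℂ) := Submodule.finiteDimensional_of_le hW'
    let O : Submodule ℂ X.K :=
      { carrier := {p | p ∈ P v ∧ ∀ w ∈ W, coreForm X.core w p = 0}
        add_mem' := fun {p q} hp hq => ⟨add_mem hp.1 hq.1, fun w hw => by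
          rw [map_add, hp.2 w hw, hq.2 w hw, add_zero]⟩
        zero_mem' := ⟨zero_mem _, fun w _ => map_zero _⟩
        smul_mem' := fun c p hp => ⟨Submodule.smul_mem _ _ hp.1, fun w hw => by
          rw [map_smul, hp.2 w hw, smul_zero]⟩ }
    have hO : X.IsInvariant O := fun a p hp => ⟨hinv v a p hp.1, fun w hw => by
      have h1 := X.act_star (star a) w p
      rw [star_star] at h1
      exact h1.symm.trans (hp.2 _ (isInvariant_restrictScalars X W (star a) w hw))⟩
    refine ⟨⟨hO.toSubmodule, fun p hp => hp.1⟩, IsCompl.of_le ?_ ?_⟩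
    · rintro p ⟨hp1, hp2⟩
      exact X.core.definite p (hp2.2 p hp1)
    · change (hinv v).toSubmodule ≤ W ⊔ hO.toSubmodule
      intro p hp
      obtain ⟨q, hq, hq'⟩ := core_exists_proj X.core (W.restrictScalars ℂ) p
      refine Submodule.mem_sup.2 ⟨q, hq, p - q, ⟨sub_mem hp (hW' hq), fun w hw => ?_⟩, by abel⟩
      rw [map_sub, sub_eq_zero, coreForm_apply, coreForm_apply, ← X.core.conj_inner_symm,
        ← hq' w hw, X.core.conj_inner_symm]
  · rw [eq_top_iff]
    intro v _
    exact Submodule.mem_iSup_of_mem v (Submodule.mem_iSup_of_mem (Set.mem_univ v) (hmem v))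

/-- A semisimple module is an independent sum of simple ones. A simple summand meeting a finite
dimensional invariant subspace in a non-zero vector is contained in it, hence is finite dimensional.
-/
theorem exists_isFinIrreducible_decomposition
    (hX : ∀ v : X.K, ∃ P : Submodule ℂ X.K, FiniteDimensional ℂ P ∧ v ∈ P ∧ X.IsInvariant P) :
    ∃ (I : Type u) (W : I → Submodule ℂ X.K), (∀ i, X.IsFinIrreducible (W i)) ∧ iSupIndep W ∧
      ⨆ i, W i = ⊤ := by
  have := isSemisimpleModule_of_locally_finite X hX
  obtain ⟨s, hs1, hs2, hs3⟩ :=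
    IsSemisimpleModule.exists_sSupIndep_sSup_simples_eq_top X.actAlgebra X.K
  have hinv : ∀ i : s, X.IsInvariant (i.1.restrictScalars ℂ) := fun i =>
    isInvariant_restrictScalars X i.1
  refine ⟨s, fun i => i.1.restrictScalars ℂ, fun i => ?_, ?_, ?_⟩
  · have hatom := isSimpleModule_iff_isAtom.1 (hs3 i.1 i.2)
    obtain ⟨w, hw, hw0⟩ := Submodule.exists_mem_ne_zero_of_ne_bot hatom.1
    obtain ⟨P, hP, hwP, hPinv⟩ := hX w
    refine ⟨hinv i, ?_, fun h => hw0 ?_, fun W' hW' hW'inv => ?_⟩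
    · have h1 : i.1 ≤ hPinv.toSubmodule := by
        rcases hatom.le_iff.1 (inf_le_left : i.1 ⊓ hPinv.toSubmodule ≤ i.1) with h | h
        · have h2 : w ∈ i.1 ⊓ hPinv.toSubmodule := ⟨hw, hwP⟩
          rw [h] at h2
          exact absurd ((Submodule.mem_bot _).1 h2) hw0
        · exact inf_eq_left.1 h
      exact Submodule.finiteDimensional_of_le (S₂ := P) h1
    · have : w ∈ i.1.restrictScalars ℂ := hw
      exact (Submodule.mem_bot ℂ).1 (h.le this)
    · have h1 : hW'inv.toSubmodule ≤ i.1 := hW'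
      rcases hatom.le_iff.1 h1 with h | h
      · left
        rw [Submodule.eq_bot_iff]
        intro x hx
        have hx' : x ∈ hW'inv.toSubmodule := hx
        rw [h] at hx'
        exact (Submodule.mem_bot _).1 hx'
      · right
        ext x
        change x ∈ hW'inv.toSubmodule ↔ x ∈ i.1
        rw [h]
  · have hind := (sSupIndep_iff s).1 hs1
    intro i
    rw [disjoint_iff, Submodule.eq_bot_iff]
    rintro x ⟨hx1, hx2⟩
    have hle : ⨆ (j : s) (_ : j ≠ i), j.1.restrictScalars ℂ ≤
        (⨆ (j : s) (_ : j ≠ i), j.1).restrictScalars ℂ :=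
      iSup₂_le fun j hj x hx => Submodule.mem_iSup_of_mem j (Submodule.mem_iSup_of_mem hj hx)
    exact Submodule.disjoint_def.1 (hind i) x hx1 (hle hx2)
  · rw [eq_top_iff]
    have h1 : sSup s ≤ (IsInvariant.iSup hinv).toSubmodule :=
      sSup_le fun j hj x hx => Submodule.mem_iSup_of_mem (⟨j, hj⟩ : s) hx
    rw [hs2] at h1
    exact fun x _ => h1 (Submodule.mem_top : x ∈ (⊤ : Submodule X.actAlgebra X.K))

end Invariant

/-- AW is an invariant subspace of W, so it is W or zero; AW = 0 would give W = 0 by non-degeneracy.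
-/
theorem IsFinIrreducible.mem_span_mul {W : Submodule ℂ A} (hW : G.piL.IsFinIrreducible W) :
    W ≤ Submodule.span ℂ {w | ∃ b, ∃ x ∈ W, b * x = w} := by
  obtain ⟨hinv, -, hne, hmin⟩ := hW
  have hle : Submodule.span ℂ {w | ∃ b, ∃ x ∈ W, b * x = w} ≤ W :=
    Submodule.span_le.2 (by rintro _ ⟨b, x, hx, rfl⟩; exact hinv b x hx)
  rcases hmin _ hle fun a w hw => Submodule.subset_span ⟨a, w, hle hw, rfl⟩ with h | h
  · refine absurd ((Submodule.eq_bot_iff W).2 fun w hw => G.nondeg' w fun b => ?_) hne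
    have h1 : b * w ∈ Submodule.span ℂ {w | ∃ b, ∃ x ∈ W, b * x = w} :=
      Submodule.subset_span ⟨b, w, hw, rfl⟩
    rw [h] at h1
    exact (Submodule.mem_bot ℂ).1 h1
  · exact h.ge

/-- The * of a finite dimensional left ideal containing b* contains bA. -/
theorem exists_finite_rightIdeal (hG : G.IsDiscrete) (b : A) :
    ∃ F : Submodule ℂ A, FiniteDimensional ℂ F ∧ ∀ x, b * x ∈ F := by
  obtain ⟨P, hP, hb, hmul⟩ := hG.exists_finite_leftIdeal (star b)
  refine ⟨P.map (starLinearEquiv ℂ (A := A) : A →ₗ⋆[ℂ] A), ?_, fun x => ?_⟩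
  · exact Module.Finite.iff_fg.2 ((Module.Finite.iff_fg.1 hP).map _)
  · exact ⟨star x * star b, hmul _ _ hb, by simp⟩

/-- Write a fixed non-zero w in W i as a sum of b x with x in W i. Every intertwiner maps w into the
sum of the finite dimensional spaces bA. Equivalences onto different W j yield independent vectors
there, so there are finitely many. -/
theorem finite_subEquiv (hG : G.IsDiscrete) {I : Type u} (W : I → Submodule ℂ A)
    (hW : ∀ i, G.piL.IsFinIrreducible (W i)) (hind : iSupIndep W) (i : I) :
    {j | G.piL.SubEquiv (W i) (W j)}.Finite := by
  obtain ⟨w, hw, hw0⟩ := Submodule.exists_mem_ne_zero_of_ne_bot (hW i).2.2.1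
  have key : ∀ w ∈ Submodule.span ℂ {w | ∃ b, ∃ x ∈ W i, b * x = w}, w ∈ W i ∧
      ∃ F : Submodule ℂ A, FiniteDimensional ℂ F ∧ ∀ f : W i →ₗ[ℂ] A,
        (∀ (a : A) (w v : W i), (v : A) = a * w → f v = a * f w) →
          ∀ hw : w ∈ W i, f ⟨w, hw⟩ ∈ F := by
    intro w hw
    induction hw using Submodule.span_induction with
    | zero =>
      refine ⟨zero_mem _, ⊥, inferInstance, fun f _ h => ?_⟩
      have : (⟨0, h⟩ : W i) = 0 := rfl
      rw [this, map_zero]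
      exact zero_mem _
    | add x y _ _ hx hy =>
      obtain ⟨hx, F, hF, hF'⟩ := hx
      obtain ⟨hy, F₁, hF₁, hF₁'⟩ := hy
      refine ⟨add_mem hx hy, F ⊔ F₁, inferInstance, fun f hf h => ?_⟩
      have : (⟨x + y, h⟩ : W i) = ⟨x, hx⟩ + ⟨y, hy⟩ := rfl
      rw [this, map_add]
      exact Submodule.add_mem_sup (hF' f hf hx) (hF₁' f hf hy)
    | smul c x _ hx =>
      obtain ⟨hx, F, hF, hF'⟩ := hx
      refine ⟨Submodule.smul_mem _ _ hx, F, hF, fun f hf h => ?_⟩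
      have : (⟨c • x, h⟩ : W i) = c • ⟨x, hx⟩ := rfl
      rw [this, map_smul]
      exact Submodule.smul_mem _ _ (hF' f hf hx)
    | mem x hx =>
      obtain ⟨b, y, hy, rfl⟩ := hx
      obtain ⟨F, hF, hF'⟩ := exists_finite_rightIdeal hG b
      refine ⟨(hW i).1 b y hy, F, hF, fun f hf h => ?_⟩
      rw [hf b ⟨y, hy⟩ ⟨b * y, h⟩ rfl]
      exact hF' _
  obtain ⟨-, F, hF, hF'⟩ := key w ((hW i).mem_span_mul hw)
  let J := {j | G.piL.SubEquiv (W i) (W j)}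
  choose e he using fun j : J => j.2
  let x : J → F := fun j => ⟨e j ⟨w, hw⟩, hF' ((W j).subtype ∘ₗ (e j).toLinearMap) (he j) hw⟩
  -- The vectors are non-zero, being images of w under equivalences, and lie in independent
  -- subspaces.
  have hx : LinearIndependent ℂ fun j => (x j : A) := by
    refine iSupIndep.linearIndependent (fun j : J => W j)
      (hind.comp Subtype.val_injective) (fun j => (e j ⟨w, hw⟩).2) fun j h => hw0 ?_
    have h1 : e j ⟨w, hw⟩ = 0 := Subtype.ext h
    exact congrArg Subtype.val ((e j).map_eq_zero_iff.1 h1)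
  have hx' : LinearIndependent ℂ x := LinearIndependent.of_comp F.subtype hx
  have : Finite J := hx'.finite_of_isNoetherian
  exact Set.toFinite J

theorem piL_repStar (hG : G.IsDiscrete) : repStar G G.piL := by
  obtain ⟨I, W, h1, h2, h3⟩ := exists_isFinIrreducible_decomposition G.piL fun v => by
    obtain ⟨P, hP, hv, hmul⟩ := hG.exists_finite_leftIdeal (v : A)
    exact ⟨P, hP, hv, hmul⟩
  exact ⟨I, W, h1, h2, h3, finite_subEquiv hG W h1 h2⟩

/-! ### Schur's lemma and the adjoints in Rep_*. -/

/-- Equivalence of subrepresentations of two representations. -/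
def CrossEquiv (X Y : StarRep G) (W : Submodule ℂ X.K) (W' : Submodule ℂ Y.K) : Prop :=
  ∃ e : W ≃ₗ[ℂ] W', ∀ (a : A) (w v : W), (v : X.K) = X.act a w → (e v : Y.K) = Y.act a (e w)

theorem CrossEquiv.trans {X Y Z : StarRep G} {W : Submodule ℂ X.K} {W' : Submodule ℂ Y.K}
    {W'' : Submodule ℂ Z.K} (h : CrossEquiv X Y W W') (h' : CrossEquiv Y Z W' W'') :
    CrossEquiv X Z W W'' := by
  obtain ⟨e, he⟩ := h
  obtain ⟨f, hf⟩ := h'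
  exact ⟨e.trans f, fun a w v hv => hf a _ _ (he a w v hv)⟩

theorem CrossEquiv.symm {X Y : StarRep G} {W : Submodule ℂ X.K} {W' : Submodule ℂ Y.K}
    (hW : X.IsInvariant W) (h : CrossEquiv X Y W W') : CrossEquiv Y X W' W := by
  obtain ⟨e, he⟩ := h
  refine ⟨e.symm, fun a w v hv => ?_⟩
  have h1 := he a (e.symm w) ⟨X.act a (e.symm w), hW a _ (e.symm w).2⟩ rfl
  rw [LinearEquiv.apply_symm_apply, ← hv] at h1
  rw [← Subtype.ext h1, LinearEquiv.symm_apply_apply]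

/-- Schur's lemma for matrix coefficients. -/
theorem crossEquiv_of_inner_ne_zero {X Y : StarRep G} (s : X ⟶ Y) {W : Submodule ℂ X.K}
    {W' : Submodule ℂ Y.K} (hW : X.IsFinIrreducible W) (hW' : Y.IsFinIrreducible W')
    {w : X.K} {w' : Y.K} (hw : w ∈ W) (hw' : w' ∈ W') (h : Y.core.inner (s.lin w) w' ≠ 0) :
    CrossEquiv X Y W W' := by
  have := hW'.2.1
  choose p hp hp' using core_exists_proj Y.core W'
  have huniq : ∀ {u v : Y.K}, u ∈ W' → v ∈ W' →
      (∀ y ∈ W', Y.core.inner u y = Y.core.inner v y) → u = v := by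
    intro u v hu hv huv
    rw [← sub_eq_zero]
    refine Y.core.definite _ ?_
    rw [← coreForm_apply, LinearMap.map_sub (coreForm Y.core), LinearMap.sub_apply, sub_eq_zero]
    exact huv _ (sub_mem hu hv)
  let T : W →ₗ[ℂ] W' :=
    { toFun := fun x => ⟨p (s.lin x), hp _⟩
      map_add' := fun x y => Subtype.ext (huniq (hp _) (add_mem (hp _) (hp _)) fun z hz => by
        simp only [← coreForm_apply] at hp' ⊢
        simp only [map_add, LinearMap.add_apply, hp' _ z hz, Submodule.coe_add])
      map_smul' := fun c x => Subtype.ext (huniq (hp _) (Submodule.smul_mem _ _ (hp _))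
        fun z hz => by
          simp only [← coreForm_apply] at hp' ⊢
          simp only [map_smulₛₗ, LinearMap.smul_apply, hp' _ z hz, Submodule.coe_smul,
            RingHom.id_apply]) }
  have hT : ∀ x : W, (T x : Y.K) = p (s.lin x) := fun _ => rfl
  have hcomm : ∀ (a : A) (w v : W), (v : X.K) = X.act a w → (T v : Y.K) = Y.act a (T w) := by
    intro a w v hv
    refine huniq (hp _) (hW'.1 a _ (hp _)) fun z hz => ?_
    rw [hT, hT, hp' _ z hz, Y.act_star, hp' _ _ (hW'.1 _ z hz), ← Y.act_star, ← s.comm, ← hv]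
  have hne : T ≠ 0 := by
    intro h0
    have h1 : p (s.lin w) = 0 :=
      congrArg Subtype.val (LinearMap.congr_fun h0 (⟨w, hw⟩ : W))
    refine h ?_
    rw [← hp' _ _ hw', h1, ← coreForm_apply, map_zero, LinearMap.zero_apply]
  have hker : LinearMap.ker T = ⊥ := by
    have h1 : X.IsInvariant ((LinearMap.ker T).map W.subtype) := by
      rintro a _ ⟨x, hx, rfl⟩
      refine ⟨⟨X.act a x, hW.1 a _ x.2⟩, LinearMap.mem_ker.2 (Subtype.ext ?_), rfl⟩
      rw [hcomm a x _ rfl, LinearMap.mem_ker.1 hx]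
      exact map_zero _
    rcases hW.2.2.2 _ (Submodule.map_subtype_le _ _) h1 with h2 | h2
    · exact Submodule.map_injective_of_injective W.subtype_injective (h2.trans (Submodule.map_bot _).symm)
    · refine absurd (LinearMap.ext fun x => ?_) hne
      obtain ⟨y, hy, hyx⟩ := h2.ge x.2
      rw [← Subtype.ext hyx]
      exact LinearMap.mem_ker.1 hy
  have hrange : LinearMap.range T = ⊤ := by
    have h1 : Y.IsInvariant ((LinearMap.range T).map W'.subtype) := by
      rintro a _ ⟨_, ⟨x, rfl⟩, rfl⟩
      exact ⟨_, ⟨⟨X.act a x, hW.1 a _ x.2⟩, rfl⟩, hcomm a x _ rfl⟩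
    rcases hW'.2.2.2 _ (Submodule.map_subtype_le _ _) h1 with h2 | h2
    · exact absurd (LinearMap.range_eq_bot.1
        (Submodule.map_injective_of_injective W'.subtype_injective (h2.trans (Submodule.map_bot _).symm))) hne
    · rw [eq_top_iff]
      intro y _
      obtain ⟨z, hz, hzy⟩ := h2.ge y.2
      rwa [← Subtype.ext hzy]
  exact ⟨LinearEquiv.ofBijective T ⟨LinearMap.ker_eq_bot.1 hker, LinearMap.range_eq_top.1 hrange⟩,
    hcomm⟩

/-- For v in an irreducible W' j, the functional x ↦ (v, s x) vanishes on every summand of X not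
equivalent to W' j. Finite multiplicity confines it to a finite dimensional sum U, where the Riesz
lemma represents it. -/
theorem exists_adjoint {X Y : StarRep G} (hX : repStar G X) (hY : repStar G Y) (s : X ⟶ Y)
    (v : Y.K) : ∃ u, ∀ x, Y.core.inner (s.lin x) v = X.core.inner x u := by
  obtain ⟨I, W, hW, -, hWtop, hWfin⟩ := hX
  obtain ⟨J, W', hW', -, hWtop', -⟩ := hY
  have hv : v ∈ ⨆ j, W' j := hWtop' ▸ Submodule.mem_top
  simp only [← coreForm_apply]
  induction hv using Submodule.iSup_induction' with
  | zero => exact ⟨0, fun x => by simp⟩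
  | add v w _ _ hv hw =>
    obtain ⟨u, hu⟩ := hv
    obtain ⟨u', hu'⟩ := hw
    exact ⟨u + u', fun x => by rw [map_add, map_add, hu, hu']⟩
  | mem j v hv =>
    let F : Set I := {i | CrossEquiv X Y (W i) (W' j)}
    have hF : F.Finite := by
      rcases F.eq_empty_or_nonempty with h | ⟨i₀, hi₀⟩
      · rw [h]; exact Set.finite_empty
      · exact (hWfin i₀).subset fun k hk => CrossEquiv.trans hi₀ (CrossEquiv.symm (hW k).1 hk)
    have : Finite F := hF
    have := fun i => (hW i).2.1
    let U : Submodule ℂ X.K := ⨆ i : F, W i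
    obtain ⟨p, hp, hp'⟩ := core_exists_riesz X.core U (coreForm Y.core v ∘ₗ s.lin)
    refine ⟨p, fun x => ?_⟩
    have hx : x ∈ ⨆ i, W i := hWtop ▸ Submodule.mem_top
    have key : X.core.inner p x = Y.core.inner v (s.lin x) := by
      simp only [← coreForm_apply]
      induction hx using Submodule.iSup_induction' with
      | zero => simp
      | add x y _ _ hx hy => simp only [map_add, hx, hy]
      | mem i x hx =>
        by_cases hi : i ∈ F
        · exact hp' x (Submodule.mem_iSup_of_mem (⟨i, hi⟩ : F) hx)
        · have h1 : coreForm Y.core v (s.lin x) = 0 := by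
            by_contra hne
            refine hi (crossEquiv_of_inner_ne_zero s (hW i) (hW' j) hx hv fun h0 => hne ?_)
            rw [coreForm_apply, ← Y.core.conj_inner_symm, h0, map_zero]
          rw [h1]
          -- The decomposition is not assumed orthogonal, so p in U must be shown orthogonal to W i.
          -- Schur's lemma for the identity arrow does this: otherwise W i would be equivalent to a
          -- summand of U, hence to W' j.
          clear hp'
          induction hp using Submodule.iSup_induction' with
          | zero => simp
          | add x y _ _ hx hy => simp only [map_add, LinearMap.add_apply, hx, hy, add_zero]
          | mem k q hq =>
            by_contra hne
            exact hi (CrossEquiv.trans (CrossEquiv.symm (hW k).1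
              (crossEquiv_of_inner_ne_zero (𝟙 X) (hW k) (hW i) hq hx hne)) k.2)
    simp only [coreForm_apply]
    rw [← Y.core.conj_inner_symm, ← key, X.core.conj_inner_symm]

/-- The adjoint of an arrow of `Rep_*(A, Δ)`. -/
def adjoint {X Y : StarRep G} (hX : repStar G X) (hY : repStar G Y) (s : X ⟶ Y) : Y ⟶ X where
  lin :=
    { toFun := fun v => (exists_adjoint hX hY s v).choose
      map_add' := fun v w => core_ext_right X.core fun x => by
        rw [← (exists_adjoint hX hY s (v + w)).choose_spec x, ← coreForm_apply,
          ← coreForm_apply, map_add, map_add, coreForm_apply, coreForm_apply, coreForm_apply,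
          coreForm_apply, (exists_adjoint hX hY s v).choose_spec x,
          (exists_adjoint hX hY s w).choose_spec x]
      map_smul' := fun c v => core_ext_right X.core fun x => by
        rw [← (exists_adjoint hX hY s (c • v)).choose_spec x, ← coreForm_apply,
          ← coreForm_apply, map_smul, map_smul, coreForm_apply, coreForm_apply,
          (exists_adjoint hX hY s v).choose_spec x, RingHom.id_apply] }
  comm a v := core_ext_right X.core fun x => by
    have h := fun v => (exists_adjoint hX hY s v).choose_spec
    have e := X.act_star (star a) x (exists_adjoint hX hY s v).choose
    rw [star_star] at e
    refine (h (Y.act a v) x).symm.trans (Eq.trans ?_ e)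
    rw [← h v, s.comm, Y.act_star, star_star]

theorem inner_adjoint {X Y : StarRep G} (hX : repStar G X) (hY : repStar G Y) (s : X ⟶ Y)
    (u : X.K) (v : Y.K) :
    Y.core.inner (s.lin u) v = X.core.inner u ((adjoint hX hY s).lin v) :=
  (exists_adjoint hX hY s v).choose_spec u

theorem inner_adjoint_left {X Y : StarRep G} (hX : repStar G X) (hY : repStar G Y) (s : X ⟶ Y)
    (u : X.K) (v : Y.K) :
    X.core.inner ((adjoint hX hY s).lin v) u = Y.core.inner v (s.lin u) := by
  rw [← X.core.conj_inner_symm, ← inner_adjoint, Y.core.conj_inner_symm]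

/-- The `*`-operation of `Rep_*(A, Δ)`. -/
def starOperation (G : AlgQuantumGroup A) : StarOperation (repStar G) where
  adj := adjoint
  adj_id hX := hom_ext (LinearMap.ext fun v => core_ext_right _ fun x =>
    (inner_adjoint hX hX (𝟙 _) x v).symm)
  adj_comp hX hY hZ s t := hom_ext (LinearMap.ext fun v => core_ext_right _ fun x => by
    rw [← inner_adjoint hX hZ, comp_lin, comp_lin, LinearMap.comp_apply, LinearMap.comp_apply,
      inner_adjoint hY hZ, inner_adjoint hX hY])
  adj_adj hX hY s := hom_ext (LinearMap.ext fun v => core_ext_right _ fun x => by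
    rw [← inner_adjoint hY hX, inner_adjoint_left])
  adj_linear hX hY r s t c h := LinearMap.ext fun v => core_ext_right _ fun x => by
    rw [← inner_adjoint hX hY, h, ← coreForm_apply, ← coreForm_apply]
    simp only [LinearMap.add_apply, LinearMap.smul_apply, map_add, map_smulₛₗ, RingHom.id_apply,
      coreForm_apply]
    rw [inner_adjoint hX hY, inner_adjoint hX hY]
  inner_adj := inner_adjoint

end StarRep

end RepStar

/-! ### Assembly of the theorem. -/

theorem mainTheorem3 {A : Type u} [NonUnitalRing A] [StarRing A] [Module ℂ A]
    [IsScalarTower ℂ A A] [SMulCommClass ℂ A A] [StarModule ℂ A] (G : AlgQuantumGroup A) :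
    ∃ m : G.piL ⊗ G.piL ⟶ G.piL,
      (∀ a b : A, m.lin (a ⊗ₜ[ℂ] b) = G.mTilde (a ⊗ₜ[ℂ] b)) ∧
      IsSemigroupObj m ∧
      (∀ θ : StarRep G, IsLeftModule m (leftAction m θ) ∧ IsRightModule m (rightAction m θ)) ∧
      (∀ (θ : StarRep G) (I : Type u), Cardinal.mk I = Module.rank ℂ θ.K →
        Nonempty (G.piL ⊗ θ.triv ≅ StarRep.copies I G.piL) ∧
        Nonempty (θ.triv ⊗ G.piL ≅ StarRep.copies I G.piL)) ∧
      (∃ V : StarRep.trivFunctor G ⋙ tensorLeft G.piL ≅ tensorLeft G.piL,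
        (∀ θ : StarRep G, IsLeftModuleHom (leftAction m θ.triv) (leftAction m θ) (V.hom.app θ)) ∧
        (G.IsDiscrete → ∀ θ : StarRep G, FiniteDimensional ℂ θ.K → StarRep.IsUnitary (V.hom.app θ))) ∧
      (∃ V : StarRep.trivFunctor G ⋙ tensorLeft G.piL ≅ tensorLeft G.piL,
        (∀ (θ : StarRep G) (x a : A) (v : θ.K), (V.hom.app θ).lin (x ⊗ₜ[ℂ] θ.act a v) =
          (θ.orbit v).lTensor A (G.T₁ (x ⊗ₜ[ℂ] a))) ∧
        (∀ θ : StarRep G, IsLeftModuleHom (leftAction m θ.triv) (leftAction m θ) (V.hom.app θ))) ∧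
      (∃ U : StarRep.trivFunctor G ⋙ tensorRight G.piL ≅ tensorRight G.piL,
        (∀ (θ : StarRep G) (x a : A) (v : θ.K), (U.hom.app θ).lin (θ.act a v ⊗ₜ[ℂ] x) =
          (θ.orbit v).rTensor A (G.T₃ x a)) ∧
        (∀ θ : StarRep G,
          IsRightModuleHom (rightAction m θ.triv) (rightAction m θ) (U.hom.app θ)) ∧
        (G.IsDiscrete → ∀ θ : StarRep G, FiniteDimensional ℂ θ.K → StarRep.IsUnitary (U.hom.app θ))) ∧
      ((∃ η : 𝟙_ (StarRep G) ⟶ G.piL, IsMonoidObj m η) ↔ G.IsDiscrete) ∧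
      (G.IsDiscrete → StarRep.repStar G G.piL ∧
        Nonempty (StarRep.StarOperation (StarRep.repStar G))) := by
  refine ⟨StarRep.mHom G, fun a b => rfl, StarRep.mHom_isSemigroupObj G, fun θ =>
    ⟨(StarRep.mHom_isSemigroupObj G).isLeftModule θ, (StarRep.mHom_isSemigroupObj G).isRightModule θ⟩,
    StarRep.nonempty_iso_copies, ?_,
    ⟨StarRep.leftTwistNatIso G, StarRep.leftTwist_tmul_act, StarRep.leftTwist_isLeftModuleHom⟩,
    ⟨StarRep.rightTwistNatIso G, fun θ x a v => StarRep.rightTwist_act_tmul θ x a v,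
      StarRep.rightTwist_isRightModuleHom,
      fun _ θ _ => ⟨inferInstance, StarRep.inner_rightTwist θ⟩⟩,
    StarRep.exists_isMonoidObj_iff G,
    fun hG => ⟨StarRep.piL_repStar hG, ⟨StarRep.starOperation G⟩⟩⟩
  -- The family V is chosen by cases: the twist corrected by δ^(-1/2) if there is an integral, and
  -- the plain left twist otherwise, where unitarity is not demanded.
  by_cases hG : G.IsDiscrete
  · obtain ⟨h, h0, hh⟩ := hG
    exact ⟨StarRep.leftTwistUnitaryNatIso hh h0,
      StarRep.leftTwistUnitaryIso_isLeftModuleHom hh h0,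
      fun _ θ _ => StarRep.leftTwistUnitaryIso_isUnitary hh h0 θ⟩
  · exact ⟨StarRep.leftTwistNatIso G, StarRep.leftTwist_isLeftModuleHom, fun h => absurd h hG⟩
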